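/- Let $x$ be a point of a Riemann surface $X$, let $\mathcal O$ be the ring of germs at $x$ of holomorphic functions, $\mathfrak m$ its maximal ideal, $K$ its fraction field (the germs of meromorphic functions) and $\Omega$ the one-dimensional $K$-space of germs of meromorphic differentials. Let $V$ be a $K$-vector space of finite dimension $n$ with a meromorphic connection $\nabla:V\to V\otimes_K\Omega$ (additive, with $\nabla(fv)=v\otimes df+f\nabla v$). A lattice is the $\mathcal O$-span of a $K$-basis of $V$. A lattice $\Lambda$ is logarithmic if $\nabla\Lambda\subset\Lambda\otimes_{\mathcal O}\Omega(1)$, where $\Omega(1)$ is the $\mathcal O$-module of differentials with at most a simple pole; then $\nabla$ induces a residue $\mathrm{Res}_\Lambda\nabla\in\mathrm{End}_{\mathbb C}(\Lambda/\mathfrak m\Lambda)$, namely the map induced by $\nabla_{z\,d/dz}$ for any uniformising parameter $z$. Let $\boldsymbol\Lambda_{\log}$ be the set of logarithmic lattices. Let $\sigma$ be a section of $\mathbb C\to\mathbb C/\mathbb Z$ (for instance the one with $\mathrm{Re}(\mathrm{im}\,\sigma)\subset[0,1[$), and let $\Delta$ be the corresponding Deligne lattice of $(V,\nabla)$, that is,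 the logarithmic lattice such that all eigenvalues of $\delta=\mathrm{Res}_\Delta\nabla$ lie in the image of $\sigma$ (so $\nabla$ is regular). Let $z$ be a uniformising parameter and let $\Upsilon=\Upsilon_z$ be the Birkhoff form of $\Delta$: the $\mathbb C$-span of all the $\mathcal O$-bases of $\Delta$ in which the matrix of $\nabla$ is $L\,\frac{dz}{z}$ with $L\in M_n(\mathbb C)$ constant. An admissible pair of $\Upsilon$ is a pair $(F,\mathbf k)$ where $F:0=F_0\subsetneq F_1\subsetneq\cdots\subsetneq F_s=\Upsilon$ is a flag of complex subspaces and $\mathbf k=(k_1,\ldots,k_n)\in\mathbb Z^n$ is $F$-admissible, i.e. there are integers $\kappa_1<\cdots<\kappa_s$ such that $k_i=\kappa_j$ whenever $\dim F_{j-1}<i\le\dim F_j$. Let $W_0(\Upsilon)$ be the set of admissible pairs $(F,\mathbf k)$ of $\Upsilon$ such that the images of the $F_j$ in $\Delta/\mathfrak m\Delta$ are stabilised by $\delta$. Then $\Upsilon$ is a form in $\Delta$ (the $\mathbb C$-span of some $\mathcal O$-basis of $\Delta$), and the map $$(F,\mathbf k)\longmapsto M(F,\mathbf k)=\sum_{j=1}^{s}z^{\kappa_j}\,\mathcal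 O F_j$$ is a bijection from $W_0(\Upsilon)$ onto $\boldsymbol\Lambda_{\log}$. Moreover, for $(F,\mathbf k)\in W_0(\Upsilon)$ and $M=M(F,\mathbf k)$: (i) the image of $F$ in $\Delta/\mathfrak m\Delta$ is the flag induced by $M$, whose members are the images of the $\mathfrak m^{-m}M\cap\Delta$, $m\in\mathbb Z$; (ii) $\mathbf k$ is the sequence of elementary divisors of $M$ in $\Delta$, and there is an $\mathcal O$-basis $(e_1,\ldots,e_n)$ of $\Delta$ whose $\mathbb C$-span is $\Upsilon$ such that $(z^{k_1}e_1,\ldots,z^{k_n}e_n)$ is an $\mathcal O$-basis of $M$. -/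

import Mathlib

open scoped Manifold ContDiff Topology TensorProduct

noncomputable section

namespace LogLattice

/-! ### Extension of a derivation to the field of fractions -/

section Extend

variable {k A : Type*} (K : Type*) [CommRing k] [CommRing A] [Field K] [Algebra k A] [Algebra k K]
  [Algebra A K] [IsScalarTower k A K] [IsFractionRing A K]

/-- The extension of a derivation of a domain to its field of fractions. -/
def extendDerivation (d : Derivation k A A) : Derivation k K K :=
  haveI : Algebra.FormallyEtale A K := Algebra.FormallyEtale.of_isLocalization (nonZeroDivisors A)
  (((((Algebra.linearMap A K).compDer d).liftKaehlerDifferential).liftBaseChange K) ∘ₗ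
    (KaehlerDifferential.tensorKaehlerEquivOfFormallyEtale k A K).symm.toLinearMap).compDer
      (KaehlerDifferential.D k K)

theorem extendDerivation_algebraMap (d : Derivation k A A) (a : A) :
    extendDerivation K d (algebraMap A K a) = algebraMap A K (d a) := by
  simp [extendDerivation, KaehlerDifferential.tensorKaehlerEquivOfFormallyEtale_symm_D_algebraMap]

end Extend

/-! ### The local ring and the field of meromorphic germs at a point of a Riemann surface -/

section Germs

variable {X : Type*} [TopologicalSpace X] [ChartedSpace ℂ X]

/-- The expression of a function on the surface in the preferred chart at `x`. -/
def inChart (x : X) (f : X → ℂ) : ℂ → ℂ := fun w => f ((chartAt ℂ x).symm w)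

theorem tendsto_chart_symm (x : X) :
    Filter.Tendsto (chartAt ℂ x).symm (𝓝 (chartAt ℂ x x)) (𝓝 x) := by
  have h := (chartAt ℂ x).continuousAt_symm (mem_chart_target ℂ x)
  rw [ContinuousAt, (chartAt ℂ x).left_inv (mem_chart_source ℂ x)] at h
  exact h

theorem tendsto_chart (x : X) :
    Filter.Tendsto (chartAt ℂ x) (𝓝 x) (𝓝 (chartAt ℂ x x)) :=
  (chartAt ℂ x).continuousAt (mem_chart_source ℂ x)

theorem inChart_congr {x : X} {f g : X → ℂ} (h : f =ᶠ[𝓝 x] g) :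
    inChart x f =ᶠ[𝓝 (chartAt ℂ x x)] inChart x g :=
  (tendsto_chart_symm x).eventually h

theorem eventually_of_inChart {x : X} {p : ℂ → Prop} (h : ∀ᶠ w in 𝓝 (chartAt ℂ x x), p w) :
    ∀ᶠ y in 𝓝 x, p (chartAt ℂ x y) :=
  (tendsto_chart x).eventually h

theorem chart_left_inv (x : X) :
    ∀ᶠ y in 𝓝 x, (chartAt ℂ x).symm (chartAt ℂ x y) = y :=
  Filter.mem_of_superset ((chartAt ℂ x).open_source.mem_nhds (mem_chart_source ℂ x))
    fun _ hy => (chartAt ℂ x).left_inv hy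

theorem chart_right_inv (x : X) :
    ∀ᶠ w in 𝓝 (chartAt ℂ x x), chartAt ℂ x ((chartAt ℂ x).symm w) = w :=
  Filter.mem_of_superset ((chartAt ℂ x).open_target.mem_nhds (mem_chart_target ℂ x))
    fun _ hy => (chartAt ℂ x).right_inv hy

instance germAlgebra (x : X) : Algebra ℂ (Filter.Germ (𝓝 x) ℂ) :=
  Algebra.ofModule
    (fun c f g => by
      induction f using Filter.Germ.inductionOn with | _ f => ?_
      induction g using Filter.Germ.inductionOn with | _ g => ?_
      exact congrArg Filter.Germ.ofFun (smul_mul_assoc c f g))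
    (fun c f g => by
      induction f using Filter.Germ.inductionOn with | _ f => ?_
      induction g using Filter.Germ.inductionOn with | _ g => ?_
      exact congrArg Filter.Germ.ofFun (mul_smul_comm c f g))

/-- The stalk at `x` of the sheaf of holomorphic functions. -/
def holGerm (x : X) : Subalgebra ℂ (Filter.Germ (𝓝 x) ℂ) where
  carrier := {g | ∃ f : X → ℂ, AnalyticAt ℂ (inChart x f) (chartAt ℂ x x) ∧ g = ↑f}
  mul_mem' := by
    rintro _ _ ⟨f, hf, rfl⟩ ⟨g, hg, rfl⟩
    exact ⟨f * g, hf.mul hg, rfl⟩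
  add_mem' := by
    rintro _ _ ⟨f, hf, rfl⟩ ⟨g, hg, rfl⟩
    exact ⟨f + g, hf.add hg, rfl⟩
  algebraMap_mem' c := ⟨fun _ => c • 1, analyticAt_const, rfl⟩

/-- The stalk at `x` of the sheaf of holomorphic functions, as a ring. -/
def HolGerm (x : X) : Type _ := ↥(holGerm x)

instance (x : X) : CommRing (HolGerm x) := inferInstanceAs (CommRing ↥(holGerm x))

instance (x : X) : Algebra ℂ (HolGerm x) := inferInstanceAs (Algebra ℂ ↥(holGerm x))

/-- A function which is holomorphic near `x` defines an element of the stalk. -/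
def HolGerm.mk {x : X} (f : X → ℂ) (hf : AnalyticAt ℂ (inChart x f) (chartAt ℂ x x)) :
    HolGerm x := ⟨↑f, f, hf, rfl⟩

theorem HolGerm.exists_rep {x : X} (g : HolGerm x) :
    ∃ (f : X → ℂ) (hf : AnalyticAt ℂ (inChart x f) (chartAt ℂ x x)), g = HolGerm.mk f hf := by
  obtain ⟨g, f, hf, rfl⟩ := g
  exact ⟨f, hf, rfl⟩

theorem HolGerm.mk_eq_mk {x : X} {f g : X → ℂ} {hf : AnalyticAt ℂ (inChart x f) (chartAt ℂ x x)}
    {hg : AnalyticAt ℂ (inChart x g) (chartAt ℂ x x)} :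
    HolGerm.mk f hf = HolGerm.mk g hg ↔ f =ᶠ[𝓝 x] g :=
  Subtype.ext_iff.trans Filter.Germ.coe_eq

instance (x : X) : Nontrivial (HolGerm x) := inferInstanceAs (Nontrivial ↥(holGerm x))

theorem eventually_iff_inChart {x : X} {p : X → Prop} :
    (∀ᶠ y in 𝓝 x, p y) ↔ ∀ᶠ w in 𝓝 (chartAt ℂ x x), p ((chartAt ℂ x).symm w) := by
  refine ⟨fun h => (tendsto_chart_symm x).eventually h, fun h => ?_⟩
  filter_upwards [eventually_of_inChart h, chart_left_inv x] with y h1 h2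
  rwa [h2] at h1

instance (x : X) : NoZeroDivisors (HolGerm x) where
  eq_zero_or_eq_zero_of_mul_eq_zero := by
    intro a b hab
    obtain ⟨f, hf, rfl⟩ := a.exists_rep
    obtain ⟨g, hg, rfl⟩ := b.exists_rep
    have h0 : (HolGerm.mk 0 analyticAt_const : HolGerm x) = 0 := rfl
    have hm : HolGerm.mk f hf * HolGerm.mk g hg = HolGerm.mk (f * g) (hf.mul hg) := rfl
    have hab1 : f * g =ᶠ[𝓝 x] 0 := HolGerm.mk_eq_mk.1 (hm.symm.trans (hab.trans h0.symm))
    have hab' : ∀ᶠ w in 𝓝 (chartAt ℂ x x), inChart x f w * inChart x g w = 0 :=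
      inChart_congr hab1
    rw [← h0]
    refine Or.imp HolGerm.mk_eq_mk.2 HolGerm.mk_eq_mk.2 ?_
    rcases hf.eventually_eq_zero_or_eventually_ne_zero with h | h
    · exact Or.inl (eventually_iff_inChart.2 h)
    · rcases hg.eventually_eq_zero_or_eventually_ne_zero with h' | h'
      · exact Or.inr (eventually_iff_inChart.2 h')
      · exfalso
        obtain ⟨w, hw1, hw2, hw3⟩ := (h.and (h'.and (hab'.filter_mono nhdsWithin_le_nhds))).exists
        exact (mul_ne_zero hw1 hw2) hw3

instance (x : X) : IsDomain (HolGerm x) := NoZeroDivisors.to_isDomain _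

/-- The value at `x` of a holomorphic germ. -/
def evalGerm (x : X) : HolGerm x →+* ℂ :=
  (Filter.Germ.valueRingHom (X := X) (E := ℂ) (x := x)).comp (holGerm x).subtype

theorem isUnit_iff_evalGerm_ne_zero {x : X} (a : HolGerm x) : IsUnit a ↔ evalGerm x a ≠ 0 := by
  refine ⟨fun h => (h.map (evalGerm x)).ne_zero, fun h => ?_⟩
  obtain ⟨f, hf, rfl⟩ := a.exists_rep
  have hfx : inChart x f (chartAt ℂ x x) ≠ 0 := by
    have : inChart x f (chartAt ℂ x x) = f x := by
      simp [inChart]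
    rw [this]; exact h
  have hev : ∀ᶠ w in 𝓝 (chartAt ℂ x x), inChart x f w ≠ 0 :=
    hf.continuousAt.eventually_ne hfx
  refine IsUnit.of_mul_eq_one (HolGerm.mk (f⁻¹) (hf.inv hfx)) ?_
  change HolGerm.mk (f * f⁻¹) (hf.mul (hf.inv hfx)) = HolGerm.mk 1 analyticAt_const
  refine HolGerm.mk_eq_mk.2 ?_
  exact eventually_iff_inChart.2 (hev.mono fun w hw => mul_inv_cancel₀ hw)

instance (x : X) : IsLocalRing (HolGerm x) :=
  IsLocalRing.of_nonunits_add fun a b ha hb => by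
    rw [mem_nonunits_iff, isUnit_iff_evalGerm_ne_zero, not_not] at *
    rw [map_add, ha, hb, add_zero]

theorem mem_maximalIdeal_iff {x : X} {a : HolGerm x} :
    a ∈ IsLocalRing.maximalIdeal (HolGerm x) ↔ evalGerm x a = 0 := by
  rw [IsLocalRing.mem_maximalIdeal, mem_nonunits_iff, isUnit_iff_evalGerm_ne_zero, not_not]

/-- The field of germs at `x` of meromorphic functions. -/
def MerGerm (x : X) : Type _ := FractionRing (HolGerm x)

instance (x : X) : Field (MerGerm x) := inferInstanceAs (Field (FractionRing (HolGerm x)))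

instance (x : X) : Algebra (HolGerm x) (MerGerm x) :=
  inferInstanceAs (Algebra (HolGerm x) (FractionRing (HolGerm x)))

instance (x : X) : Algebra ℂ (MerGerm x) :=
  inferInstanceAs (Algebra ℂ (FractionRing (HolGerm x)))

instance (x : X) : IsScalarTower ℂ (HolGerm x) (MerGerm x) :=
  inferInstanceAs (IsScalarTower ℂ (HolGerm x) (FractionRing (HolGerm x)))

instance (x : X) : IsFractionRing (HolGerm x) (MerGerm x) :=
  inferInstanceAs (IsFractionRing (HolGerm x) (FractionRing (HolGerm x)))

/-- The germ at `x` of the chart coordinate, centred at `x`. -/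
def chartCoord (x : X) : HolGerm x :=
  HolGerm.mk (fun y => chartAt ℂ x y - chartAt ℂ x x) <| by
    have h : AnalyticAt ℂ (fun w : ℂ => w - chartAt ℂ x x) (chartAt ℂ x x) :=
      analyticAt_id.sub analyticAt_const
    refine h.congr ?_
    filter_upwards [chart_right_inv x] with w hw
    simp only [inChart, hw]

theorem chartCoord_mem (x : X) : chartCoord x ∈ IsLocalRing.maximalIdeal (HolGerm x) := by
  rw [mem_maximalIdeal_iff]
  exact sub_self (chartAt ℂ x x)

/-- The derivative of a function with respect to the chart coordinate at `x`. -/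
def chartDeriv (x : X) (f : X → ℂ) : X → ℂ := fun y => deriv (inChart x f) (chartAt ℂ x y)

theorem inChart_chartDeriv (x : X) (f : X → ℂ) :
    inChart x (chartDeriv x f) =ᶠ[𝓝 (chartAt ℂ x x)] deriv (inChart x f) := by
  filter_upwards [chart_right_inv x] with w hw
  simp only [inChart, chartDeriv, hw]

theorem chartDeriv_congr {x : X} {f g : X → ℂ} (h : f =ᶠ[𝓝 x] g) :
    chartDeriv x f =ᶠ[𝓝 x] chartDeriv x g :=
  (tendsto_chart x).eventually (inChart_congr h).deriv

theorem analyticAt_chartDeriv {x : X} {f : X → ℂ}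
    (hf : AnalyticAt ℂ (inChart x f) (chartAt ℂ x x)) :
    AnalyticAt ℂ (inChart x (chartDeriv x f)) (chartAt ℂ x x) :=
  hf.deriv.congr (inChart_chartDeriv x f).symm

/-- Derivative of a holomorphic germ with respect to the chart coordinate. -/
def holDerivFun (x : X) (a : HolGerm x) : HolGerm x :=
  ⟨Filter.Germ.map' (chartDeriv x) (fun _ _ h => chartDeriv_congr h) a.1, by
    obtain ⟨f, hf, rfl⟩ := a.exists_rep
    exact ⟨chartDeriv x f, analyticAt_chartDeriv hf, rfl⟩⟩

theorem holDerivFun_mk {x : X} {f : X → ℂ} (hf : AnalyticAt ℂ (inChart x f) (chartAt ℂ x x)) :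
    holDerivFun x (HolGerm.mk f hf) = HolGerm.mk (chartDeriv x f) (analyticAt_chartDeriv hf) := rfl

theorem eventually_differentiableAt {x : X} {f : X → ℂ}
    (hf : AnalyticAt ℂ (inChart x f) (chartAt ℂ x x)) :
    ∀ᶠ y in 𝓝 x, DifferentiableAt ℂ (inChart x f) (chartAt ℂ x y) :=
  (tendsto_chart x).eventually (hf.eventually_analyticAt.mono fun _ h => h.differentiableAt)

/-- The derivation of the ring of holomorphic germs given by the chart coordinate. -/
def holDeriv (x : X) : Derivation ℂ (HolGerm x) (HolGerm x) :=
  Derivation.mk'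
    { toFun := holDerivFun x
      map_add' := fun a b => by
        obtain ⟨f, hf, rfl⟩ := a.exists_rep
        obtain ⟨g, hg, rfl⟩ := b.exists_rep
        change HolGerm.mk (chartDeriv x (f + g)) (analyticAt_chartDeriv (hf.add hg)) =
          HolGerm.mk (chartDeriv x f + chartDeriv x g)
            ((analyticAt_chartDeriv hf).add (analyticAt_chartDeriv hg))
        refine HolGerm.mk_eq_mk.2 ?_
        filter_upwards [eventually_differentiableAt hf, eventually_differentiableAt hg]
          with y h1 h2
        exact deriv_add h1 h2
      map_smul' := fun c a => by
        obtain ⟨f, hf, rfl⟩ := a.exists_rep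
        change HolGerm.mk (chartDeriv x (c • f)) (analyticAt_chartDeriv (hf.const_smul (c := c))) =
          HolGerm.mk (c • chartDeriv x f) ((analyticAt_chartDeriv hf).const_smul (c := c))
        refine HolGerm.mk_eq_mk.2 ?_
        filter_upwards [eventually_differentiableAt hf] with y h1
        exact deriv_const_smul c h1 }
    (fun a b => by
      obtain ⟨f, hf, rfl⟩ := a.exists_rep
      obtain ⟨g, hg, rfl⟩ := b.exists_rep
      change HolGerm.mk (chartDeriv x (f * g)) (analyticAt_chartDeriv (hf.mul hg)) =
          HolGerm.mk (f * chartDeriv x g + g * chartDeriv x f)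
            ((hf.mul (analyticAt_chartDeriv hg)).add (hg.mul (analyticAt_chartDeriv hf)))
      refine HolGerm.mk_eq_mk.2 ?_
      filter_upwards [eventually_differentiableAt hf, eventually_differentiableAt hg,
        chart_left_inv x] with y h1 h2 h3
      have := deriv_mul h1 h2
      change deriv (inChart x f * inChart x g) (chartAt ℂ x y) =
        f y * deriv (inChart x g) (chartAt ℂ x y) + g y * deriv (inChart x f) (chartAt ℂ x y)
      rw [this]
      simp only [inChart, h3]
      ring)

theorem holDeriv_chartCoord (x : X) : holDeriv x (chartCoord x) = 1 := by
  refine (holDerivFun_mk _).trans ?_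
  refine HolGerm.mk_eq_mk (hg := analyticAt_const (v := (1 : ℂ))) |>.2 ?_
  have h : inChart x (fun y => chartAt ℂ x y - chartAt ℂ x x) =ᶠ[𝓝 (chartAt ℂ x x)]
      fun w => w - chartAt ℂ x x := by
    filter_upwards [chart_right_inv x] with w hw
    simp only [inChart, hw]
  filter_upwards [(tendsto_chart x).eventually h.deriv] with y hy
  simp only [chartDeriv, hy]
  simp

/-- The derivation of the field of meromorphic germs given by the chart coordinate: the unique
extension of `holDeriv x`. -/
def merDeriv (x : X) : Derivation ℂ (MerGerm x) (MerGerm x) :=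
  extendDerivation (MerGerm x) (holDeriv x)

theorem merDeriv_algebraMap {x : X} (a : HolGerm x) :
    merDeriv x (algebraMap _ (MerGerm x) a) = algebraMap _ (MerGerm x) (holDeriv x a) :=
  extendDerivation_algebraMap _ _ a

/-- A uniformising parameter (local coordinate) at `x`: a generator of the maximal ideal. -/
def IsUniformizer {x : X} (z : HolGerm x) : Prop :=
  IsLocalRing.maximalIdeal (HolGerm x) = Ideal.span {z}

/-! ### Meromorphic vector fields and differentials -/

/-- The germs at `x` of meromorphic vector fields `f d/dz`, that is, the one-dimensional
`K`-space of (continuous) derivations of the field `K` of meromorphic germs. -/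
def merVectorField (x : X) : Submodule (MerGerm x) (Derivation ℂ (MerGerm x) (MerGerm x)) :=
  Submodule.span (MerGerm x) {merDeriv x}

/-- The germs at `x` of meromorphic differentials: the dual of the space of vector fields. -/
abbrev MerForm (x : X) : Type _ := Module.Dual (MerGerm x) (merVectorField x)

/-- The differential `df` of a meromorphic germ `f`, given by `⟨df, τ⟩ = τ f`. -/
def merD {x : X} (f : MerGerm x) : MerForm x where
  toFun τ := (τ : Derivation ℂ (MerGerm x) (MerGerm x)) f
  map_add' _ _ := rfl
  map_smul' _ _ := rfl

/-- The `O`-module of the differentials `α` with `v(α) ≥ -k`, where `v(g dz) = v(g)`: it is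
generated by the `z⁻ᵏ dz` for the uniformising parameters `z`. -/
def polarForms (x : X) (k : ℤ) : Submodule (HolGerm x) (MerForm x) :=
  Submodule.span (HolGerm x) {α | ∃ z : HolGerm x, IsUniformizer z ∧
    α = (algebraMap (HolGerm x) (MerGerm x) z ^ (-k)) • merD (algebraMap _ (MerGerm x) z)}

/-- The logarithmic differential `dz/z`. -/
def dlog {x : X} (z : HolGerm x) : MerForm x :=
  (algebraMap (HolGerm x) (MerGerm x) z)⁻¹ • merD (algebraMap _ (MerGerm x) z)

/-- The vector field `ζ d/dζ` where `ζ` is the centred chart coordinate. -/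
def eulerField (x : X) : merVectorField x :=
  ⟨algebraMap (HolGerm x) (MerGerm x) (chartCoord x) • merDeriv x,
    Submodule.smul_mem _ _ (Submodule.mem_span_singleton_self _)⟩

theorem eulerField_apply {x : X} (f : MerGerm x) :
    (eulerField x : Derivation ℂ (MerGerm x) (MerGerm x)) f =
      algebraMap (HolGerm x) (MerGerm x) (chartCoord x) * merDeriv x f := rfl

theorem eulerField_algebraMap {x : X} (a : HolGerm x) :
    (eulerField x : Derivation ℂ (MerGerm x) (MerGerm x)) (algebraMap _ _ a) =
      algebraMap (HolGerm x) (MerGerm x) (chartCoord x * holDeriv x a) := by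
  rw [eulerField_apply, merDeriv_algebraMap, map_mul]

theorem polarForms_one_apply {x : X} {α : MerForm x} (h : α ∈ polarForms x 1) :
    ∃ a : HolGerm x, α (eulerField x) = algebraMap _ (MerGerm x) a := by
  induction h using Submodule.span_induction with
  | mem α h =>
    obtain ⟨z, hz, rfl⟩ := h
    have h1 : chartCoord x ∈ Ideal.span {z} := hz ▸ chartCoord_mem x
    obtain ⟨a, ha⟩ := Ideal.mem_span_singleton'.1 h1
    by_cases hz0 : algebraMap (HolGerm x) (MerGerm x) z = 0
    · refine ⟨0, ?_⟩
      simp [hz0]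
    · refine ⟨a * holDeriv x z, ?_⟩
      have : merD (algebraMap _ (MerGerm x) z) (eulerField x) =
        algebraMap (HolGerm x) (MerGerm x) (chartCoord x * holDeriv x z) :=
          eulerField_algebraMap z
      rw [LinearMap.smul_apply, this, ← ha, smul_eq_mul, zpow_neg_one, map_mul, map_mul, map_mul]
      field_simp
  | zero => exact ⟨0, by simp⟩
  | add α η _ _ h1 h2 =>
    obtain ⟨a, ha⟩ := h1
    obtain ⟨b, hb⟩ := h2
    exact ⟨a + b, by rw [LinearMap.add_apply, ha, hb, map_add]⟩
  | smul c α _ h1 =>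
    obtain ⟨a, ha⟩ := h1
    exact ⟨c * a, by rw [LinearMap.smul_apply, ha, map_mul, Algebra.smul_def]⟩

end Germs

/-! ### Connections, lattices, forms -/

section Connection

variable {X : Type*} [TopologicalSpace X] [ChartedSpace ℂ X] {x : X}
  {V : Type*} [AddCommGroup V] [Module (MerGerm x) V]

/-- A meromorphic connection on the `K`-vector space `V`: an additive map `V → V ⊗ Ω` with
`∇ (f v) = v ⊗ df + f ∇ v`. -/
structure Connection (x : X) (V : Type*) [AddCommGroup V] [Module (MerGerm x) V] where
  toFun : V →+ V ⊗[MerGerm x] MerForm x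
  leibniz : ∀ (f : MerGerm x) (v : V), toFun (f • v) = v ⊗ₜ merD f + f • toFun v

/-- The contraction of `V`-valued differentials with a vector field. -/
def contract (V : Type*) [AddCommGroup V] [Module (MerGerm x) V] (τ : merVectorField x) :
    V ⊗[MerGerm x] MerForm x →ₗ[MerGerm x] V :=
  (TensorProduct.rid (MerGerm x) V).toLinearMap ∘ₗ
    LinearMap.lTensor V (Module.Dual.eval (MerGerm x) (merVectorField x) τ)

theorem contract_tmul (τ : merVectorField x) (v : V) (α : MerForm x) :
    contract V τ (v ⊗ₜ α) = α τ • v := by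
  simp [contract]

/-- The covariant derivative `∇_τ` along a vector field. -/
def Connection.along (nabla : Connection x V) (τ : merVectorField x) : V →+ V :=
  (contract V τ).toAddMonoidHom.comp nabla.toFun

theorem Connection.along_smul (nabla : Connection x V) (τ : merVectorField x) (f : MerGerm x)
    (v : V) : nabla.along τ (f • v) =
      (τ : Derivation ℂ (MerGerm x) (MerGerm x)) f • v + f • nabla.along τ v := by
  change contract V τ (nabla.toFun (f • v)) = _ + f • contract V τ (nabla.toFun v)
  rw [nabla.leibniz, map_add, contract_tmul, map_smul]
  rfl

theorem algebraMap_complex [Module ℂ V] [IsScalarTower ℂ (MerGerm x) V] (c : ℂ) (v : V) :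
    algebraMap ℂ (MerGerm x) c • v = c • v := algebraMap_smul _ c v

/-- `A` is the matrix of the connection in the basis `b`, with the sign convention
`∇ bⱼ = - ∑ᵢ bᵢ ⊗ Aᵢⱼ`. -/
def Connection.IsMatrix (nabla : Connection x V) {n : ℕ} (b : Module.Basis (Fin n) (MerGerm x) V)
    (A : Matrix (Fin n) (Fin n) (MerForm x)) : Prop :=
  ∀ j, nabla.toFun (b j) = -∑ i, b i ⊗ₜ[MerGerm x] A i j

end Connection

section Lattices

variable {X : Type*} [TopologicalSpace X] [ChartedSpace ℂ X] {x : X}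
  {V : Type*} [AddCommGroup V] [Module (MerGerm x) V] [Module (HolGerm x) V]
  [IsScalarTower (HolGerm x) (MerGerm x) V] [Module ℂ V] [IsScalarTower ℂ (MerGerm x) V]
  [IsScalarTower ℂ (HolGerm x) V]

/-- `L` is a lattice: the `O`-span of some `K`-basis of `V`. -/
def IsLattice (L : Submodule (HolGerm x) V) : Prop :=
  ∃ b : Module.Basis (Fin (Module.finrank (MerGerm x) V)) (MerGerm x) V,
    L = Submodule.span (HolGerm x) (Set.range b)

/-- `Y` is a form in the lattice `L`: the complex span of some `O`-basis of `L`. -/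
def IsForm (L : Submodule (HolGerm x) V) (Y : Submodule ℂ V) : Prop :=
  ∃ b : Module.Basis (Fin (Module.finrank (MerGerm x) V)) (MerGerm x) V,
    L = Submodule.span (HolGerm x) (Set.range b) ∧ Y = Submodule.span ℂ (Set.range b)

/-- The image of `L ⊗ Ω(k)` in `V ⊗ Ω`, where `Ω(k)` is the module of the differentials with a pole
of order at most `k`. -/
def latticeForms (L : Submodule (HolGerm x) V) (k : ℤ) :
    Submodule (HolGerm x) (V ⊗[MerGerm x] MerForm x) :=
  Submodule.span (HolGerm x) {t | ∃ v ∈ L, ∃ α ∈ polarForms x k, t = v ⊗ₜ α}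

/-- `L` is stable under the connection up to simple poles: `∇ L ⊆ L ⊗ Ω(1)`. -/
def Connection.IsLogarithmic (nabla : Connection x V) (L : Submodule (HolGerm x) V) : Prop :=
  ∀ v ∈ L, nabla.toFun v ∈ latticeForms L 1

/-- The set of logarithmic lattices. -/
def Connection.logLattices (nabla : Connection x V) : Set (Submodule (HolGerm x) V) :=
  {L | IsLattice L ∧ nabla.IsLogarithmic L}

theorem Connection.IsLogarithmic.along_mem {nabla : Connection x V} {L : Submodule (HolGerm x) V}
    (h : nabla.IsLogarithmic L) {v : V} (hv : v ∈ L) : nabla.along (eulerField x) v ∈ L := by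
  have key : ∀ t ∈ latticeForms L 1, contract V (eulerField x) t ∈ L := by
    intro t ht
    induction ht using Submodule.span_induction with
    | mem t ht =>
      obtain ⟨v, hv, α, hα, rfl⟩ := ht
      obtain ⟨a, ha⟩ := polarForms_one_apply hα
      rw [contract_tmul, ha, algebraMap_smul]
      exact L.smul_mem a hv
    | zero => rw [map_zero]; exact L.zero_mem
    | add s t _ _ h1 h2 => rw [map_add]; exact L.add_mem h1 h2
    | smul c t _ h1 =>
      rw [← algebraMap_smul (MerGerm x) c t, map_smul, algebraMap_smul]
      exact L.smul_mem c h1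
  exact key _ (h v hv)

/-- The fibre `L / 𝔪 L` of a lattice; it is a complex vector space. -/
abbrev Fiber (L : Submodule (HolGerm x) V) : Type _ :=
  ↥L ⧸ (IsLocalRing.maximalIdeal (HolGerm x) • ⊤ : Submodule (HolGerm x) L)

/-- The projection from a lattice to its fibre. -/
def toFiber (L : Submodule (HolGerm x) V) : L →ₗ[ℂ] Fiber L :=
  (Submodule.mkQ (IsLocalRing.maximalIdeal (HolGerm x) • ⊤ :
    Submodule (HolGerm x) L)).restrictScalars ℂ

/-- The operator `v ↦ ∇_{ζ d/dζ} v` on a logarithmic lattice. -/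
def Connection.eulerOp (nabla : Connection x V) (L : Submodule (HolGerm x) V)
    (h : nabla.IsLogarithmic L) : L →ₗ[ℂ] L where
  toFun v := ⟨nabla.along (eulerField x) v, h.along_mem v.2⟩
  map_add' v w := Subtype.ext (map_add (nabla.along (eulerField x)) (v : V) w)
  map_smul' c v := Subtype.ext <| by
    change nabla.along (eulerField x) (c • (v : V)) = c • nabla.along (eulerField x) (v : V)
    rw [← algebraMap_complex (x := x), nabla.along_smul, Derivation.map_algebraMap, zero_smul,
      zero_add, algebraMap_complex]

theorem Connection.eulerOp_mem (nabla : Connection x V) (L : Submodule (HolGerm x) V)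
    (h : nabla.IsLogarithmic L) {v : L}
    (hv : v ∈ (IsLocalRing.maximalIdeal (HolGerm x) • ⊤ : Submodule (HolGerm x) L)) :
    nabla.eulerOp L h v ∈ (IsLocalRing.maximalIdeal (HolGerm x) • ⊤ : Submodule (HolGerm x) L) := by
  induction hv using Submodule.smul_induction_on' with
  | smul a ha v _ =>
    have : nabla.eulerOp L h (a • v) =
        (chartCoord x * holDeriv x a) • v + a • nabla.eulerOp L h v := by
      refine Subtype.ext ?_
      change nabla.along (eulerField x) (a • (v : V)) =
        (chartCoord x * holDeriv x a) • (v : V) + a • nabla.along (eulerField x) (v : V)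
      rw [← algebraMap_smul (MerGerm x) a (v : V), nabla.along_smul, eulerField_algebraMap,
        algebraMap_smul, algebraMap_smul]
    rw [this]
    exact Submodule.add_mem _
      (Submodule.smul_mem_smul (Ideal.mul_mem_right _ _ (chartCoord_mem x)) trivial)
      (Submodule.smul_mem_smul ha trivial)
  | add v _ w _ h1 h2 => rw [map_add]; exact Submodule.add_mem _ h1 h2

/-- The residue of a connection on the fibre of a logarithmic lattice: the endomorphism of
`L / 𝔪 L` induced by `∇_{ζ d/dζ}` (any coordinate `ζ` induces the same endomorphism). -/
def Connection.residue (nabla : Connection x V) (L : Submodule (HolGerm x) V)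
    (h : nabla.IsLogarithmic L) : Module.End ℂ (Fiber L) :=
  Submodule.liftQ ((IsLocalRing.maximalIdeal (HolGerm x) • ⊤ :
      Submodule (HolGerm x) L).restrictScalars ℂ) (toFiber L ∘ₗ nabla.eulerOp L h)
    (fun _ hv => (Submodule.Quotient.mk_eq_zero _).2 (nabla.eulerOp_mem L h hv)) ∘ₗ
  (Submodule.Quotient.restrictScalarsEquiv ℂ (IsLocalRing.maximalIdeal (HolGerm x) • ⊤ :
      Submodule (HolGerm x) L)).symm.toLinearMap

theorem Connection.residue_toFiber (nabla : Connection x V) (L : Submodule (HolGerm x) V)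
    (h : nabla.IsLogarithmic L) (v : L) :
    nabla.residue L h (toFiber L v) = toFiber L (nabla.eulerOp L h v) := rfl

/-- `L` is the Deligne lattice attached to a section `σ` of `ℂ → ℂ/ℤ`: a logarithmic lattice the
eigenvalues of whose residue lie in the image of `σ`. -/
structure Connection.IsDeligneLattice (nabla : Connection x V)
    (σ : ℂ ⧸ AddSubgroup.zmultiples (1 : ℂ) → ℂ) (L : Submodule (HolGerm x) V) : Prop where
  isLattice : IsLattice L
  isLogarithmic : nabla.IsLogarithmic L
  eigenvalue_mem : ∀ μ : ℂ, (nabla.residue L isLogarithmic).HasEigenvalue μ → μ ∈ Set.range σ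

/-- The Birkhoff form attached to the coordinate `z`: the complex span of (the members of) all the
`O`-bases of `L` in which the matrix of the connection is `A dz/z` with `A` constant. -/
def Connection.birkhoffForm (nabla : Connection x V) (z : HolGerm x)
    (L : Submodule (HolGerm x) V) : Submodule ℂ V :=
  Submodule.span ℂ {v | ∃ b : Module.Basis (Fin (Module.finrank (MerGerm x) V)) (MerGerm x) V,
    L = Submodule.span (HolGerm x) (Set.range b) ∧
    (∃ A : Matrix (Fin (Module.finrank (MerGerm x) V)) (Fin (Module.finrank (MerGerm x) V)) ℂ,
      nabla.IsMatrix b (fun i j => algebraMap ℂ (MerGerm x) (A i j) • dlog z)) ∧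
    v ∈ Set.range b}

/-! ### Flags and admissible pairs -/

/-- A strictly increasing chain `F₀ < F₁ < ⋯ < Fₛ` of subspaces is a flag if `F₀ = 0` and `Fₛ` is
the whole space. -/
def IsFlag {W : Type*} [AddCommGroup W] [Module ℂ W] (F : LTSeries (Submodule ℂ W)) : Prop :=
  F.head = ⊥ ∧ F.last = ⊤

/-- The block of indices attached to the `j`-th step of a flag: (counting from zero) the `i` with
`dim Fⱼ ≤ i < dim Fⱼ₊₁`. -/
def flagBlock {W : Type*} [AddCommGroup W] [Module ℂ W] (n : ℕ) (F : LTSeries (Submodule ℂ W))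
    (j : Fin F.length) : Set (Fin n) :=
  {i | Module.finrank ℂ (F j.castSucc) ≤ (i : ℕ) ∧ (i : ℕ) < Module.finrank ℂ (F j.succ)}

/-- `k` is constant on the blocks of the flag, with strictly increasing values. -/
def IsAdmissible {W : Type*} [AddCommGroup W] [Module ℂ W] {n : ℕ} (F : LTSeries (Submodule ℂ W))
    (k : Fin n → ℤ) : Prop :=
  ∃ κ : Fin F.length → ℤ, StrictMono κ ∧ ∀ j, ∀ i ∈ flagBlock n F j, k i = κ j

/-- The admissible pairs of an `n`-dimensional space `W`. -/
def admissiblePairs (W : Type*) [AddCommGroup W] [Module ℂ W] (n : ℕ) :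
    Set (LTSeries (Submodule ℂ W) × (Fin n → ℤ)) :=
  {p | IsFlag p.1 ∧ IsAdmissible p.1 p.2}

/-- The image in the fibre `L / 𝔪 L` of (the part in `L` of) a complex subspace of `V`. -/
def reduction (L : Submodule (HolGerm x) V) (U : Submodule ℂ V) : Submodule ℂ (Fiber L) :=
  (U.comap (L.subtype.restrictScalars ℂ)).map (toFiber L)

/-- The admissible pairs of a form `Y` in `L` whose flag, transported to `L / 𝔪 L`, is stabilised
by the residue. -/
def Connection.stablePairs (nabla : Connection x V) (L : Submodule (HolGerm x) V)
    (h : nabla.IsLogarithmic L) (Y : Submodule ℂ V) :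
    Set (LTSeries (Submodule ℂ Y) × (Fin (Module.finrank (MerGerm x) V) → ℤ)) :=
  {p | p ∈ admissiblePairs Y (Module.finrank (MerGerm x) V) ∧
    ∀ j, ∀ d ∈ reduction L ((p.1 j).map Y.subtype),
      nabla.residue L h d ∈ reduction L ((p.1 j).map Y.subtype)}

/-- The twist by `zᵏ` of a flag in `Y`: the `O`-module generated by the `z ^ kᵢ • v`, where `i` is
in the `j`-th block and `v` is in the `j`-th (nonzero) member of the flag. -/
def twist (z : HolGerm x) (Y : Submodule ℂ V) {n : ℕ}
    (p : LTSeries (Submodule ℂ Y) × (Fin n → ℤ)) : Submodule (HolGerm x) V :=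
  Submodule.span (HolGerm x) {w | ∃ j : Fin p.1.length, ∃ i ∈ flagBlock n p.1 j,
    ∃ v ∈ p.1 j.succ, w = algebraMap (HolGerm x) (MerGerm x) z ^ p.2 i • (v : V)}

/-- The member with index `m` of the flag induced by the lattice `M` in `L / 𝔪 L`: the image of
`𝔪⁻ᵐ M ∩ L`. -/
def relativeFlag (z : HolGerm x) (L M : Submodule (HolGerm x) V) (m : ℤ) :
    Submodule ℂ (Fiber L) :=
  reduction L ((M.restrictScalars ℂ).comap
    (Algebra.lsmul ℂ ℂ V (algebraMap (HolGerm x) (MerGerm x) z ^ m)))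

/-- `Y` is a Smith form in `L` for `M`, the elementary divisors of `M` in `L` being `k`: some
`O`-basis `b` of `L` which spans `Y` over `ℂ` is such that `z ^ kᵢ • bᵢ` is an `O`-basis of `M`. -/
def IsSmithForm (z : HolGerm x) (L M : Submodule (HolGerm x) V) (Y : Submodule ℂ V)
    (k : Fin (Module.finrank (MerGerm x) V) → ℤ) : Prop :=
  Monotone k ∧ ∃ b : Module.Basis (Fin (Module.finrank (MerGerm x) V)) (MerGerm x) V,
    L = Submodule.span (HolGerm x) (Set.range b) ∧ Y = Submodule.span ℂ (Set.range b) ∧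
    M = Submodule.span (HolGerm x)
      (Set.range fun i => algebraMap (HolGerm x) (MerGerm x) z ^ k i • b i)

end Lattices

end LogLattice
end

/-! Write D for `nabla.logOp z`, that is ∇ along z d/dz, and p for the minimal polynomial of the
residue δ of Δ. Since dz/z generates Ω(1), a lattice is logarithmic exactly when D maps it to itself
(`Connection.isLogarithmic_iff`), and p(D) maps Δ into zΔ. Eigenvalues of δ are chosen
representatives modulo ℤ, so no two of them differ by a nonzero integer: p is coprime to p(X + k)
for every k ≠ 0 (`IsNonresonant`). Everything rests on this coprimality together with the rule
D(zᵏv) = zᵏ(Dv + kv).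

Coprimality makes the Birkhoff form a form. In an arbitrary basis of Δ, removing the nonconstant
part of the matrix of D is a Fuchsian system for the change of basis P with P(x) = 1. In degree k ≥
1 one must invert k − [residue commutator], which is injective by nonresonance; a geometric estimate
of the coefficients gives convergence (`exists_solution`, `exists_constant_matrix`). Two D-stable
forms agree, because the leading term of a difference would be killed by both p(D) and p(D + k)
(`IsForm.le_of_isNonresonant`). Hence Υ is the span of one good basis, is D-stable, and is killed by
p(D).

Now zᵐΥ is killed by p(D − m), and these polynomials are pairwise coprime. The projections of a
finite sum of terms zᵐy onto its terms are therefore polynomials in D, so a D-stable lattice M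
contains every homogeneous term of its elements (`IsForm.eq_span_level`). Thus M is determined by
the increasing filtration of its levels {y ∈ Υ | zᵐy ∈ M}. The distinct values of this filtration
form a flag and its jumps are the κⱼ (`IsForm.exists_twist_eq`); conversely the levels of a twist
give back the flag and the exponents (`IsForm.injOn_twist`).

The projection Υ → Δ/𝔪Δ is injective and intertwines D with δ, so stability of a subspace may be
tested on either side (`IsForm.residue_stable_iff`). A basis adapted to the flag yields the Smith
form and the induced flag. -/

noncomputable section

namespace LogLattice

set_option linter.unusedSectionVars false

/-! ### Taylor series of holomorphic germs -/

section TaylorSeries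

variable {X : Type*} [TopologicalSpace X] [ChartedSpace ℂ X] {x : X}

theorem evalGerm_algebraMap (c : ℂ) : evalGerm x (algebraMap ℂ (HolGerm x) c) = c := by
  change c • (1 : ℂ) = c
  simp

theorem evalGerm_smul (c : ℂ) (a : HolGerm x) : evalGerm x (c • a) = c * evalGerm x a := by
  rw [Algebra.smul_def, map_mul, evalGerm_algebraMap]

theorem evalGerm_chartCoord : evalGerm x (chartCoord x) = 0 :=
  mem_maximalIdeal_iff.1 (chartCoord_mem x)

/-- A holomorphic function on a neighbourhood of the chart point, seen as a germ on the surface. -/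
theorem analyticAt_inChart_comp {g : ℂ → ℂ} (hg : AnalyticAt ℂ g (chartAt ℂ x x)) :
    AnalyticAt ℂ (inChart x fun y => g (chartAt ℂ x y)) (chartAt ℂ x x) := by
  refine hg.congr ?_
  filter_upwards [chart_right_inv x] with w hw
  simp only [inChart, hw]

theorem mk_eq_pow_mul {f : X → ℂ} (hf : AnalyticAt ℂ (inChart x f) (chartAt ℂ x x)) {g : ℂ → ℂ}
    (hg : AnalyticAt ℂ g (chartAt ℂ x x)) {n : ℕ}
    (h : ∀ᶠ w in 𝓝 (chartAt ℂ x x), inChart x f w = (w - chartAt ℂ x x) ^ n * g w) :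
    HolGerm.mk f hf = chartCoord x ^ n * HolGerm.mk _ (analyticAt_inChart_comp hg) := by
  have h1 : AnalyticAt ℂ (inChart x fun y => (chartAt ℂ x y - chartAt ℂ x x) ^ n *
      g (chartAt ℂ x y)) (chartAt ℂ x x) :=
    analyticAt_inChart_comp (g := fun w => (w - chartAt ℂ x x) ^ n * g w)
      (((analyticAt_id.sub analyticAt_const).pow n).mul hg)
  refine Eq.trans (b := HolGerm.mk _ h1) (HolGerm.mk_eq_mk.2 ?_) rfl
  filter_upwards [eventually_of_inChart h, chart_left_inv x] with y hy hy'
  simpa only [inChart, hy'] using hy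

/-- The exponent is the order of vanishing: a nonzero analytic function of one variable is locally a
power of the coordinate times a function not vanishing at the point. This makes the stalk a discrete
valuation ring. -/
theorem exists_eq_chartCoord_pow_mul {a : HolGerm x} (ha : a ≠ 0) :
    ∃ (n : ℕ) (u : HolGerm x), IsUnit u ∧ a = chartCoord x ^ n * u := by
  obtain ⟨f, hf, rfl⟩ := a.exists_rep
  have h0 : ¬ ∀ᶠ w in 𝓝 (chartAt ℂ x x), inChart x f w = 0 := fun h => ha <|
    HolGerm.mk_eq_mk (hg := analyticAt_const (v := (0 : ℂ))) |>.2 (eventually_iff_inChart.2 h)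
  obtain ⟨n, g, hg, hg0, h⟩ := hf.exists_eventuallyEq_pow_smul_nonzero_iff.2 h0
  exact ⟨n, _, (isUnit_iff_evalGerm_ne_zero _).2 hg0, mk_eq_pow_mul hf hg h⟩

theorem chartCoord_dvd_iff {a : HolGerm x} : chartCoord x ∣ a ↔ evalGerm x a = 0 := by
  refine ⟨?_, fun h => ?_⟩
  · rintro ⟨b, rfl⟩
    rw [map_mul, evalGerm_chartCoord, zero_mul]
  · by_cases ha : a = 0
    · rw [ha]; exact dvd_zero _
    obtain ⟨n, u, hu, rfl⟩ := exists_eq_chartCoord_pow_mul ha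
    rcases n with _ | n
    · rw [pow_zero, one_mul] at h
      exact absurd h ((isUnit_iff_evalGerm_ne_zero _).1 hu)
    · exact Dvd.dvd.mul_right (dvd_pow_self _ n.succ_ne_zero) u

theorem chartCoord_ne_zero : chartCoord x ≠ 0 := by
  intro h
  have := holDeriv_chartCoord x
  rw [h, map_zero] at this
  exact zero_ne_one this

theorem eq_zero_of_chartCoord_pow_dvd {a : HolGerm x} (h : ∀ n, chartCoord x ^ n ∣ a) : a = 0 := by
  by_contra ha
  obtain ⟨n, u, hu, rfl⟩ := exists_eq_chartCoord_pow_mul ha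
  have := h (n + 1)
  rw [pow_succ, mul_dvd_mul_iff_left (pow_ne_zero _ chartCoord_ne_zero), chartCoord_dvd_iff] at this
  exact (isUnit_iff_evalGerm_ne_zero _).1 hu this

/-- `φ` is the Taylor series of the germ `a` in the chart coordinate. -/
def HasTaylor (a : HolGerm x) (φ : PowerSeries ℂ) : Prop :=
  ∀ n, chartCoord x ^ n ∣ a - Polynomial.aeval (chartCoord x) (φ.trunc n)

theorem aeval_chartCoord_trunc (φ : PowerSeries ℂ) (n : ℕ) :
    Polynomial.aeval (chartCoord x) (φ.trunc n) =
      ∑ i ∈ Finset.range n, φ.coeff i • chartCoord x ^ i := by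
  rw [Polynomial.aeval_def, PowerSeries.eval₂_trunc_eq_sum_range]
  exact Finset.sum_congr rfl fun i _ => (Algebra.smul_def _ _).symm

theorem HasTaylor.add {a b : HolGerm x} {φ ψ : PowerSeries ℂ} (ha : HasTaylor a φ)
    (hb : HasTaylor b ψ) : HasTaylor (a + b) (φ + ψ) := by
  intro n
  rw [map_add, map_add, add_sub_add_comm]
  exact dvd_add (ha n) (hb n)

theorem HasTaylor.neg {a : HolGerm x} {φ : PowerSeries ℂ} (ha : HasTaylor a φ) :
    HasTaylor (-a) (-φ) := by
  intro n
  rw [map_neg, map_neg, ← neg_sub_neg, neg_neg, neg_neg, ← neg_sub, dvd_neg,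
    ← dvd_neg, neg_sub]
  exact (dvd_sub_comm).1 (ha n)

theorem hasTaylor_zero : HasTaylor (0 : HolGerm x) 0 := fun n => by simp

theorem HasTaylor.sum {ι : Type*} (s : Finset ι) {a : ι → HolGerm x} {φ : ι → PowerSeries ℂ}
    (h : ∀ i, HasTaylor (a i) (φ i)) : HasTaylor (∑ i ∈ s, a i) (∑ i ∈ s, φ i) := by
  classical
  induction s using Finset.induction_on with
  | empty => exact hasTaylor_zero
  | insert i s hi ih => rw [Finset.sum_insert hi, Finset.sum_insert hi]; exact (h i).add ih

/-- The coefficients of φψ below degree n depend only on the truncations at n, so the product of the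
truncations and the truncation of the product agree modulo Xⁿ. -/
theorem HasTaylor.mul {a b : HolGerm x} {φ ψ : PowerSeries ℂ} (ha : HasTaylor a φ)
    (hb : HasTaylor b ψ) : HasTaylor (a * b) (φ * ψ) := by
  intro n
  obtain ⟨c, hc⟩ := ha n
  obtain ⟨d, hd⟩ := hb n
  have h : (Polynomial.X : Polynomial ℂ) ^ n ∣ φ.trunc n * ψ.trunc n - (φ * ψ).trunc n := by
    rw [Polynomial.X_pow_dvd_iff]
    intro k hk
    rw [Polynomial.coeff_sub, PowerSeries.coeff_trunc, if_pos hk,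
      PowerSeries.coeff_mul_eq_coeff_trunc_mul_trunc φ ψ hk, ← Polynomial.coe_mul,
      Polynomial.coeff_coe, sub_self]
  obtain ⟨q, hq⟩ := h
  have hq' := congrArg (Polynomial.aeval (chartCoord x)) hq
  rw [map_sub, map_mul (Polynomial.aeval (chartCoord x)) (φ.trunc n),
    map_mul (Polynomial.aeval (chartCoord x)) (Polynomial.X ^ n), map_pow,
    Polynomial.aeval_X] at hq'
  refine ⟨c * b + Polynomial.aeval (chartCoord x) (φ.trunc n) * d +
    Polynomial.aeval (chartCoord x) q, ?_⟩
  linear_combination b * hc + Polynomial.aeval (chartCoord x) (φ.trunc n) * hd + hq'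

/-- The operator ζ d/dζ multiplies ζᵏ by k and, unlike d/dζ, preserves the ideal (ζⁿ), so no order
of approximation is lost. -/
theorem HasTaylor.euler {a : HolGerm x} {φ : PowerSeries ℂ} (ha : HasTaylor a φ) :
    HasTaylor (chartCoord x * holDeriv x a) (PowerSeries.mk fun k => (k : ℂ) * φ.coeff k) := by
  intro n
  obtain ⟨c, hc⟩ := ha n
  have h1 : ∀ i : ℕ, chartCoord x * holDeriv x (chartCoord x ^ i) = (i :
      HolGerm x) * chartCoord x ^ i := by
    intro i
    rw [Derivation.leibniz_pow, holDeriv_chartCoord]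
    rcases i with _ | i
    · simp
    · rw [Nat.add_sub_cancel, smul_eq_mul, nsmul_eq_mul, mul_one]; ring
  rw [sub_eq_iff_eq_add] at hc
  have h2 : chartCoord x * holDeriv x (Polynomial.aeval (chartCoord x) (φ.trunc n)) =
      Polynomial.aeval (chartCoord x) ((PowerSeries.mk fun k => (k : ℂ) * φ.coeff k).trunc n) := by
    rw [aeval_chartCoord_trunc, aeval_chartCoord_trunc, map_sum, Finset.mul_sum]
    refine Finset.sum_congr rfl fun i _ => ?_
    rw [Derivation.map_smul, mul_smul_comm, h1, PowerSeries.coeff_mk, mul_comm (i : ℂ), mul_smul,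
      Nat.cast_smul_eq_nsmul, nsmul_eq_mul]
  rw [hc, map_add, mul_add, h2, add_sub_cancel_right, Derivation.leibniz, smul_eq_mul, smul_eq_mul,
    mul_add]
  refine dvd_add ?_ ?_
  · exact ⟨chartCoord x * holDeriv x c, by ring⟩
  · exact ⟨n * c, by linear_combination c * h1 n⟩

/-- This is what turns a formal solution into an actual one: the defect of the differential equation
is a germ whose Taylor series vanishes. -/
theorem HasTaylor.eq_zero {a : HolGerm x} (ha : HasTaylor a 0) : a = 0 :=
  eq_zero_of_chartCoord_pow_dvd fun n => by simpa using ha n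

theorem HasTaylor.coeff_zero {a : HolGerm x} {φ : PowerSeries ℂ} (ha : HasTaylor a φ) :
    φ.coeff 0 = evalGerm x a := by
  have := ha 1
  rw [pow_one, chartCoord_dvd_iff, aeval_chartCoord_trunc, Finset.sum_range_one, pow_zero, map_sub,
    evalGerm_smul, map_one, mul_one, sub_eq_zero] at this
  exact this.symm

theorem hasTaylor_mk {f : X → ℂ} {p : FormalMultilinearSeries ℂ ℂ ℂ}
    (hp : HasFPowerSeriesAt (inChart x f) p (chartAt ℂ x x)) :
    HasTaylor (HolGerm.mk f hp.analyticAt) (PowerSeries.mk p.coeff) := by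
  intro n
  rw [aeval_chartCoord_trunc]
  simp only [PowerSeries.coeff_mk]
  induction n generalizing f p with
  | zero => simp
  | succ n ih =>
    -- The difference quotient at the centre has the shifted series, so the induction passes from f
    -- to its slope and multiplies back by ζ.
    have hd := hp.has_fpower_series_dslope_fslope
    set g := dslope (inChart x f) (chartAt ℂ x x) with hg
    have hg' : HasFPowerSeriesAt (inChart x fun y => g (chartAt ℂ x y)) p.fslope
        (chartAt ℂ x x) := by
      refine hd.congr ?_
      filter_upwards [chart_right_inv x] with w hw
      simp only [inChart, hw]
    have h0 : inChart x f (chartAt ℂ x x) = p.coeff 0 := (hp.coeff_zero 1).symm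
    have hrec : HolGerm.mk f hp.analyticAt =
        algebraMap ℂ _ (p.coeff 0) + chartCoord x * HolGerm.mk _ hg'.analyticAt := by
      have e1 : AnalyticAt ℂ (inChart x fun y => p.coeff 0 • (1 : ℂ)) (chartAt ℂ x x) :=
        analyticAt_const
      have e2 : AnalyticAt ℂ (inChart x (f - fun y => p.coeff 0 • (1 : ℂ))) (chartAt ℂ x x) :=
        hp.analyticAt.sub e1
      have h1 := mk_eq_pow_mul (n := 1) (f := f - fun y => p.coeff 0 • (1 : ℂ))
        e2 (g := g) hd.analyticAt <| by
        filter_upwards with w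
        have := sub_smul_dslope (inChart x f) (chartAt ℂ x x) w
        rw [pow_one, hg, ← smul_eq_mul, this, h0]
        simp [inChart]
      rw [pow_one] at h1
      rw [← h1]
      have h2 : HolGerm.mk (f - fun y => p.coeff 0 • (1 : ℂ)) e2 =
        HolGerm.mk f hp.analyticAt - algebraMap ℂ _ (p.coeff 0) := rfl
      rw [h2]; ring
    obtain ⟨c, hc⟩ := ih hg'
    simp only [FormalMultilinearSeries.coeff_fslope] at hc
    refine ⟨c, ?_⟩
    rw [hrec, Finset.sum_range_succ', pow_succ', mul_assoc, ← hc, mul_sub, Finset.mul_sum,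
      pow_zero, Algebra.smul_def, mul_one]
    simp only [mul_smul_comm, pow_succ']
    ring

theorem exists_hasTaylor (a : HolGerm x) : ∃ φ : PowerSeries ℂ, HasTaylor a φ ∧
    ∃ C r : ℝ, 0 < r ∧ ∀ k, ‖φ.coeff k‖ * r ^ k ≤ C := by
  obtain ⟨f, hf, rfl⟩ := a.exists_rep
  obtain ⟨p, hp⟩ := id hf
  refine ⟨_, hasTaylor_mk hp, ?_⟩
  obtain ⟨r, hr0, hr⟩ := ENNReal.lt_iff_exists_nnreal_btwn.1 hp.radius_pos
  obtain ⟨C, -, hC⟩ := p.norm_mul_pow_le_of_lt_radius hr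
  refine ⟨C, r, by exact_mod_cast hr0, fun k => ?_⟩
  rw [PowerSeries.coeff_mk, ← FormalMultilinearSeries.norm_apply_eq_norm_coef]
  exact hC k

/-- A geometric bound on the coefficients gives a positive radius of convergence; the sum, recentred
at the chart point, is the germ. -/
theorem exists_hasTaylor_of_bound {φ : PowerSeries ℂ} {C r : ℝ} (hr : 0 < r)
    (h : ∀ k, ‖φ.coeff k‖ * r ^ k ≤ C) : ∃ a : HolGerm x, HasTaylor a φ := by
  set p : FormalMultilinearSeries ℂ ℂ ℂ :=
    fun k => ContinuousMultilinearMap.mkPiRing ℂ (Fin k) (φ.coeff k) with hp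
  have hpc : ∀ k, p.coeff k = φ.coeff k := fun k => by
    simp [hp, FormalMultilinearSeries.coeff]
  have hrad : 0 < p.radius := by
    refine lt_of_lt_of_le (b := ((r.toNNReal : NNReal) : ENNReal)) ?_
        (p.le_radius_of_bound C fun k => ?_)
    · simpa using hr
    · rw [FormalMultilinearSeries.norm_apply_eq_norm_coef, hpc, Real.coe_toNNReal r hr.le]
      exact h k
  have h1 : HasFPowerSeriesAt (fun w => p.sum (w - chartAt ℂ x x)) p (chartAt ℂ x x) := by
    have := (p.hasFPowerSeriesOnBall hrad).hasFPowerSeriesAt.comp_sub (chartAt ℂ x x)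
    rwa [zero_add] at this
  have h2 : HasFPowerSeriesAt (inChart x fun y => p.sum (chartAt ℂ x y - chartAt ℂ x x)) p
      (chartAt ℂ x x) := by
    refine h1.congr ?_
    filter_upwards [chart_right_inv x] with w hw
    simp only [inChart, hw]
  refine ⟨HolGerm.mk _ h2.analyticAt, ?_⟩
  convert! hasTaylor_mk h2
  ext k
  rw [PowerSeries.coeff_mk, hpc]

end TaylorSeries

/-! ### Convergent solutions of Fuchsian systems -/

section FuchsianSystem

/-- A sequence solving the recursion of a Fuchsian system with geometrically bounded coefficients
is geometrically bounded. -/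
theorem exists_bound_of_recursion {E : Type*} [NormedAddCommGroup E] [NormedSpace ℂ E]
    {G : ℕ → E → E} {P : ℕ → E} {K r : ℝ} (hK : 0 ≤ K) (hr : 0 < r)
    (hG : ∀ j v, ‖G j v‖ * r ^ j ≤ K * ‖v‖)
    (hP : ∀ k : ℕ, 1 ≤ k → (k : ℂ) • P k = ∑ l ∈ Finset.range (k + 1), G (k - l) (P l)) :
    ∃ C s : ℝ, 0 < s ∧ ∀ k, ‖P k‖ * s ^ k ≤ C := by
  set p : ℕ → ℝ := fun k => ‖P k‖ * r ^ k with hp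
  have hp0 : ∀ k, 0 ≤ p k := fun k => by positivity
  set S : ℕ → ℝ := fun k => ∑ l ∈ Finset.range (k + 1), p l with hS
  have hS0 : ∀ k, 0 ≤ S k := fun k => Finset.sum_nonneg fun _ _ => hp0 _
  have hSsucc : ∀ k, S (k + 1) = S k + p (k + 1) := fun k => Finset.sum_range_succ _ _
  -- Take norms in the recursion and split rᵏ as rᵏ⁻ˡ · rˡ: the first factor absorbs the growth of
  -- the coefficient, the second that of the solution.
  have hmain : ∀ k : ℕ, 1 ≤ k → (k : ℝ) * p k ≤ K * S k := by
    intro k hk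
    have h1 : (k : ℝ) * ‖P k‖ ≤ ∑ l ∈ Finset.range (k + 1), ‖G (k - l) (P l)‖ := by
      have := norm_sum_le (Finset.range (k + 1)) fun l => G (k - l) (P l)
      rwa [← hP k hk, norm_smul, Complex.norm_natCast] at this
    calc (k : ℝ) * p k = (k : ℝ) * ‖P k‖ * r ^ k := by rw [hp]; ring
      _ ≤ (∑ l ∈ Finset.range (k + 1), ‖G (k - l) (P l)‖) * r ^ k := by gcongr
      _ = ∑ l ∈ Finset.range (k + 1), ‖G (k - l) (P l)‖ * r ^ (k - l) * r ^ l := by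
        rw [Finset.sum_mul]
        refine Finset.sum_congr rfl fun l hl => ?_
        rw [mul_assoc, ← pow_add, Nat.sub_add_cancel (Nat.lt_succ_iff.1 (Finset.mem_range.1 hl))]
      _ ≤ ∑ l ∈ Finset.range (k + 1), K * ‖P l‖ * r ^ l := by
        refine Finset.sum_le_sum fun l _ => ?_
        exact mul_le_mul_of_nonneg_right (hG _ _) (by positivity)
      _ = K * S k := by
        rw [hS, Finset.mul_sum]
        exact Finset.sum_congr rfl fun l _ => by rw [hp]; ring
  -- Since S (k + 1) contains p (k + 1), the estimate is implicit. Once k + 1 ≥ K + 1 the term K · p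
  -- (k + 1) can be absorbed on the left, leaving p (k + 1) ≤ K · S k.
  obtain ⟨N, hN⟩ := exists_nat_ge (K + 1)
  have hstep : ∀ k, N ≤ k → S (k + 1) ≤ (1 + K) * S k := by
    intro k hk
    have h1 := hmain (k + 1) (Nat.le_add_left _ _)
    have h2 : K + 1 ≤ ((k + 1 : ℕ) : ℝ) := hN.trans (by exact_mod_cast hk.trans k.le_succ)
    have h3 : (K + 1) * p (k + 1) ≤ ((k + 1 : ℕ) : ℝ) * p (k + 1) :=
      mul_le_mul_of_nonneg_right h2 (hp0 _)
    rw [hSsucc] at h1 ⊢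
    linarith
  have hbound : ∀ k, S k ≤ S N * (1 + K) ^ k := by
    intro k
    have hmono : Monotone S := monotone_nat_of_le_succ fun k => by
      rw [hSsucc]; linarith [hp0 (k + 1)]
    rcases le_total k N with h | h
    · exact (hmono h).trans (le_mul_of_one_le_right (hS0 _) (one_le_pow₀ (by linarith)))
    · induction k, h using Nat.le_induction with
      | base => exact le_mul_of_one_le_right (hS0 _) (one_le_pow₀ (by linarith))
      | succ k hk ih =>
        calc S (k + 1) ≤ (1 + K) * S k := hstep k hk
          _ ≤ (1 + K) * (S N * (1 + K) ^ k) := by gcongr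
          _ = S N * (1 + K) ^ (k + 1) := by ring
  refine ⟨S N, r / (1 + K), by positivity, fun k => ?_⟩
  rw [div_pow, ← mul_div_assoc, div_le_iff₀ (by positivity)]
  exact (Finset.single_le_sum (f := p) (fun _ _ => hp0 _) (Finset.self_mem_range_succ k)).trans
    (hbound k)

/-- The coefficients of the formal solution of a Fuchsian system, `S k` being a right inverse of
the operator which has to be inverted in degree `k`. -/
def recursiveSolution {E : Type*} [AddCommGroup E] (G S : ℕ → E → E) (P₀ : E) : ℕ → E
  | 0 => P₀
  | k + 1 => S (k + 1) (∑ l : Fin (k + 1), G (k + 1 - l) (recursiveSolution G S P₀ l))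

theorem exists_recursiveSolution {E : Type*} [AddCommGroup E] [Module ℂ E] (G : ℕ → E → E) (P₀ : E)
    (h : ∀ k : ℕ, 1 ≤ k → Function.Surjective fun v => (k : ℂ) • v - G 0 v) :
    ∃ P : ℕ → E, P 0 = P₀ ∧
      ∀ k : ℕ, 1 ≤ k → (k : ℂ) • P k = ∑ l ∈ Finset.range (k + 1), G (k - l) (P l) := by
  choose! S hS using h
  refine ⟨recursiveSolution G S P₀, by rw [recursiveSolution], fun k hk => ?_⟩
  obtain ⟨k, rfl⟩ := Nat.exists_eq_add_of_le' hk
  -- The top term of the sum contains the unknown P (k + 1); moved to the left it produces the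
  -- operator (k + 1) − G 0 that S (k + 1) inverts.
  rw [Finset.sum_range_succ, Nat.sub_self, ← sub_eq_iff_eq_add]
  conv_lhs => rw [recursiveSolution]
  refine (hS (k + 1) hk _).trans ?_
  exact (Finset.sum_range fun l => G (k + 1 - l) (recursiveSolution G S P₀ l)).symm

variable {X : Type*} [TopologicalSpace X] [ChartedSpace ℂ X] {x : X}

/-- A Fuchsian system `ζ dP/dζ = G P` whose residue matrix has no positive integer as an eigenvalue
has a convergent solution with any given initial value killed by the residue matrix. -/
theorem exists_solution {ι : Type*} [Fintype ι] [DecidableEq ι] (G : Matrix ι ι (HolGerm x))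
    (P₀ : ι → ℂ) (h0 : (G.map (evalGerm x)).mulVec P₀ = 0)
    (h : ∀ k : ℕ, 1 ≤ k → ∀ v, (G.map (evalGerm x)).mulVec v = (k : ℂ) • v → v = 0) :
    ∃ P : ι → HolGerm x, (∀ i, evalGerm x (P i) = P₀ i) ∧
      ∀ i, chartCoord x * holDeriv x (P i) = ∑ j, G i j * P j := by
  choose g hg C r hr hC using fun i j => exists_hasTaylor (G i j)
  set A : ℕ → Matrix ι ι ℂ := fun k => Matrix.of fun i j => (g i j).coeff k with hA
  have hA0 : A 0 = G.map (evalGerm x) := by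
    ext i j
    exact (hg i j).coeff_zero
  obtain ⟨P, hP0, hP⟩ := exists_recursiveSolution (fun k v => (A k).mulVec v) P₀ <| by
    intro k hk
    -- In finite dimension it suffices that k is not an eigenvalue of the residue matrix.
    have : Function.Injective ((k : ℂ) • (LinearMap.id : (ι → ℂ) →ₗ[ℂ] ι → ℂ) -
        (A 0).mulVecLin) := by
      rw [← LinearMap.ker_eq_bot, LinearMap.ker_eq_bot']
      intro v hv
      refine h k hk v ?_
      rw [← hA0]
      exact (sub_eq_zero.1 hv).symm
    exact LinearMap.injective_iff_surjective.1 this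
  obtain ⟨ρ, hρ0, hρ⟩ : ∃ ρ : ℝ, 0 < ρ ∧ ∀ i j, ρ ≤ r i j := by
    rcases isEmpty_or_nonempty ι with hι | hι
    · exact ⟨1, one_pos, fun i => hι.elim i⟩
    · obtain ⟨q, -, hq⟩ := (Finset.univ : Finset (ι × ι)).exists_min_image (fun q => r q.1 q.2)
        Finset.univ_nonempty
      exact ⟨r q.1 q.2, hr _ _, fun i j => hq (i, j) (Finset.mem_univ _)⟩
  have hC0 : ∀ i j, 0 ≤ C i j := fun i j =>
    (mul_nonneg (norm_nonneg _) (pow_nonneg (hr i j).le 0)).trans (hC i j 0)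
  have hK : 0 ≤ ∑ i, ∑ j, C i j := Finset.sum_nonneg fun i _ => Finset.sum_nonneg fun j _ => hC0 i j
  obtain ⟨M, s, hs, hM⟩ := exists_bound_of_recursion (P := P) (G := fun k v => (A k).mulVec v)
    hK hρ0 (fun k v => by
      rw [← le_div_iff₀ (by positivity), pi_norm_le_iff_of_nonneg (by positivity)]
      intro i
      rw [le_div_iff₀ (by positivity)]
      calc ‖∑ j, A k i j * v j‖ * ρ ^ k ≤ (∑ j, ‖A k i j * v j‖) * ρ ^ k := by
            gcongr; exact norm_sum_le _ _
        _ = ∑ j, (‖A k i j‖ * ρ ^ k) * ‖v j‖ := by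
            rw [Finset.sum_mul]
            exact Finset.sum_congr rfl fun j _ => by rw [norm_mul]; ring
        _ ≤ ∑ j, C i j * ‖v‖ := by
            gcongr with j _
            · exact hC0 i j
            · refine le_trans ?_ (hC i j k)
              change ‖(g i j).coeff k‖ * ρ ^ k ≤ _
              gcongr
              exact hρ i j
            · exact norm_le_pi_norm v j
        _ = (∑ j, C i j) * ‖v‖ := (Finset.sum_mul ..).symm
        _ ≤ (∑ i, ∑ j, C i j) * ‖v‖ := by
            refine mul_le_mul_of_nonneg_right ?_ (norm_nonneg v)
            exact Finset.single_le_sum (f := fun i => ∑ j, C i j)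
              (fun i _ => Finset.sum_nonneg fun j _ => hC0 i j) (Finset.mem_univ i)) hP
  have hb : ∀ i k, ‖(PowerSeries.mk fun k => P k i).coeff k‖ * s ^ k ≤ M := fun i k => by
    rw [PowerSeries.coeff_mk]
    exact le_trans (by gcongr; exact norm_le_pi_norm (P k) i) (hM k)
  choose a ha using fun i => exists_hasTaylor_of_bound (x := x) hs (hb i)
  refine ⟨a, fun i => ?_, fun i => ?_⟩
  · rw [← (ha i).coeff_zero, PowerSeries.coeff_mk, hP0]
  · rw [← sub_eq_zero, sub_eq_add_neg]
    refine HasTaylor.eq_zero ?_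
    convert! (ha i).euler.add (HasTaylor.sum Finset.univ fun j => (hg i j).mul (ha j)).neg
    ext k
    -- The recursion is known only for k ≥ 1; in degree 0 it is the condition `h0` that the residue
    -- matrix kills the initial value.
    have key : (k : ℂ) • P k = ∑ l ∈ Finset.range (k + 1), (A (k - l)).mulVec (P l) := by
      rcases Nat.eq_zero_or_pos k with rfl | hk
      · simp [hP0, hA0, h0]
      · exact hP k hk
    have key' := congrFun key i
    rw [map_zero, map_add, map_neg, PowerSeries.coeff_mk, PowerSeries.coeff_mk, map_sum, eq_comm,
      add_neg_eq_zero]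
    refine key'.trans ?_
    rw [Finset.sum_apply]
    simp only [PowerSeries.coeff_mul, PowerSeries.coeff_mk, Matrix.mulVec, dotProduct]
    rw [Finset.sum_comm]
    refine Finset.sum_congr rfl fun j _ => ?_
    rw [← Finset.Nat.sum_antidiagonal_swap]
    exact (Finset.Nat.sum_antidiagonal_eq_sum_range_succ
      (fun l m => (g i j).coeff m * P l j) k).symm

end FuchsianSystem

/-! ### Uniformising parameters and the field z d/dz -/

section Uniformizer

variable {X : Type*} [TopologicalSpace X] [ChartedSpace ℂ X] {x : X} {z : HolGerm x}

theorem IsUniformizer.dvd_iff (hz : IsUniformizer z) {a : HolGerm x} :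
    z ∣ a ↔ evalGerm x a = 0 := by
  rw [← mem_maximalIdeal_iff, hz, Ideal.mem_span_singleton]

theorem IsUniformizer.evalGerm_eq_zero (hz : IsUniformizer z) : evalGerm x z = 0 :=
  hz.dvd_iff.1 dvd_rfl

theorem IsUniformizer.exists_eq_chartCoord_mul (hz : IsUniformizer z) :
    ∃ w : HolGerm x, IsUnit w ∧ z = chartCoord x * w := by
  have h : Associated (chartCoord x) z :=
    associated_of_dvd_dvd (chartCoord_dvd_iff.2 hz.evalGerm_eq_zero)
      (hz.dvd_iff.2 evalGerm_chartCoord)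
  obtain ⟨w, hw⟩ := h
  exact ⟨w, w.isUnit, hw.symm⟩

theorem IsUniformizer.ne_zero (hz : IsUniformizer z) : z ≠ 0 := by
  obtain ⟨w, hw, rfl⟩ := hz.exists_eq_chartCoord_mul
  exact mul_ne_zero chartCoord_ne_zero hw.ne_zero

theorem IsUniformizer.algebraMap_ne_zero (hz : IsUniformizer z) :
    algebraMap (HolGerm x) (MerGerm x) z ≠ 0 :=
  (map_ne_zero_iff _ (IsFractionRing.injective (HolGerm x) (MerGerm x))).2 hz.ne_zero

theorem IsUniformizer.exists_eq_add (hz : IsUniformizer z) (a : HolGerm x) :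
    ∃ b, a = algebraMap ℂ _ (evalGerm x a) + z * b := by
  have : z ∣ a - algebraMap ℂ _ (evalGerm x a) := by
    rw [hz.dvd_iff, map_sub, evalGerm_algebraMap, sub_self]
  obtain ⟨b, hb⟩ := this
  exact ⟨b, by rw [← hb]; ring⟩

theorem IsUniformizer.eq_zero_of_pow_dvd (hz : IsUniformizer z) {a : HolGerm x}
    (h : ∀ n, z ^ n ∣ a) : a = 0 :=
  eq_zero_of_chartCoord_pow_dvd fun n =>
    (pow_dvd_pow_of_dvd (chartCoord_dvd_iff.2 hz.evalGerm_eq_zero) n).trans (h n)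

/-- A denominator is a unit times a power of the chart coordinate, hence divides a power of z. -/
theorem IsUniformizer.exists_pow_mul_eq (hz : IsUniformizer z) (f : MerGerm x) :
    ∃ (n : ℕ) (a : HolGerm x),
      algebraMap (HolGerm x) (MerGerm x) z ^ n * f = algebraMap _ _ a := by
  obtain ⟨a, b, hb, rfl⟩ := IsFractionRing.div_surjective (A := HolGerm x) f
  obtain ⟨n, u, hu, hbu⟩ := exists_eq_chartCoord_pow_mul (nonZeroDivisors.ne_zero hb)
  have hd : b ∣ z ^ n := by
    rw [hbu]
    exact (hu.dvd_mul_right.1 dvd_rfl).trans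
      (pow_dvd_pow_of_dvd (chartCoord_dvd_iff.2 hz.evalGerm_eq_zero) n)
  obtain ⟨c, hc⟩ := hd
  refine ⟨n, c * a, ?_⟩
  have hb0 : algebraMap (HolGerm x) (MerGerm x) b ≠ 0 :=
    (map_ne_zero_iff _ (IsFractionRing.injective (HolGerm x) (MerGerm x))).2
      (nonZeroDivisors.ne_zero hb)
  rw [← map_pow, hc, map_mul, map_mul]
  field_simp

theorem evalGerm_holDeriv_chartCoord_mul (w : HolGerm x) :
    evalGerm x (holDeriv x (chartCoord x * w)) = evalGerm x w := by
  rw [Derivation.leibniz, holDeriv_chartCoord, map_add, smul_eq_mul, smul_eq_mul, map_mul,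
    evalGerm_chartCoord, zero_mul, zero_add, mul_one]

theorem IsUniformizer.isUnit_holDeriv (hz : IsUniformizer z) : IsUnit (holDeriv x z) := by
  obtain ⟨w, hw, rfl⟩ := hz.exists_eq_chartCoord_mul
  rw [isUnit_iff_evalGerm_ne_zero, evalGerm_holDeriv_chartCoord_mul]
  exact (isUnit_iff_evalGerm_ne_zero w).1 hw

/-- The vector field `z d/dz`. -/
def coordField (z : HolGerm x) : merVectorField x :=
  (algebraMap (HolGerm x) (MerGerm x) z * (algebraMap _ _ (holDeriv x z))⁻¹) •
    ⟨merDeriv x, Submodule.mem_span_singleton_self _⟩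

theorem coordField_apply (f : MerGerm x) :
    (coordField z : Derivation ℂ (MerGerm x) (MerGerm x)) f =
      algebraMap (HolGerm x) (MerGerm x) z * (algebraMap _ _ (holDeriv x z))⁻¹ * merDeriv x f := rfl

theorem IsUniformizer.algebraMap_holDeriv_ne_zero (hz : IsUniformizer z) :
    algebraMap (HolGerm x) (MerGerm x) (holDeriv x z) ≠ 0 :=
  (map_ne_zero_iff _ (IsFractionRing.injective (HolGerm x) (MerGerm x))).2
    hz.isUnit_holDeriv.ne_zero

theorem IsUniformizer.coordField_self (hz : IsUniformizer z) :
    (coordField z : Derivation ℂ (MerGerm x) (MerGerm x)) (algebraMap _ _ z) =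
      algebraMap (HolGerm x) (MerGerm x) z := by
  rw [coordField_apply, merDeriv_algebraMap,
    inv_mul_cancel_right₀ hz.algebraMap_holDeriv_ne_zero]

theorem IsUniformizer.dlog_coordField (hz : IsUniformizer z) : dlog z (coordField z) = 1 := by
  change (algebraMap (HolGerm x) (MerGerm x) z)⁻¹ *
    (coordField z : Derivation ℂ (MerGerm x) (MerGerm x)) (algebraMap _ _ z) = 1
  rw [hz.coordField_self, inv_mul_cancel₀ hz.algebraMap_ne_zero]

/-- The derivative of z along the chart is a unit, so z d/dz sends holomorphic germs into the
maximal ideal. Consequently D is 𝒪-linear modulo z. -/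
theorem IsUniformizer.coordField_algebraMap (hz : IsUniformizer z) (a : HolGerm x) :
    ∃ b, (coordField z : Derivation ℂ (MerGerm x) (MerGerm x)) (algebraMap _ _ a) =
      algebraMap (HolGerm x) (MerGerm x) (z * b) := by
  obtain ⟨u, hu⟩ := hz.isUnit_holDeriv
  have h0 := hz.algebraMap_holDeriv_ne_zero
  refine ⟨↑u⁻¹ * holDeriv x a, ?_⟩
  rw [coordField_apply, merDeriv_algebraMap, map_mul, map_mul, ← mul_assoc]
  congr 2
  rw [← hu]
  refine inv_eq_of_mul_eq_one_right ?_
  rw [← map_mul, Units.mul_inv, map_one]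

theorem coordField_zpow (hz : IsUniformizer z) (k : ℤ) :
    (coordField z : Derivation ℂ (MerGerm x) (MerGerm x)) (algebraMap _ _ z ^ k) =
      (k : MerGerm x) * algebraMap (HolGerm x) (MerGerm x) z ^ k := by
  rw [Derivation.leibniz_zpow, hz.coordField_self, zsmul_eq_mul, smul_eq_mul,
    zpow_sub_one₀ hz.algebraMap_ne_zero, inv_mul_cancel_right₀ hz.algebraMap_ne_zero]

/-- The two logarithmic vector fields `ζ d/dζ` and `z d/dz` differ by a unit with value one. -/
theorem IsUniformizer.exists_eulerField_eq (hz : IsUniformizer z) :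
    ∃ u : HolGerm x, evalGerm x u = 1 ∧
      eulerField x = algebraMap (HolGerm x) (MerGerm x) u • coordField z := by
  obtain ⟨w, ⟨v, rfl⟩, hw⟩ := hz.exists_eq_chartCoord_mul
  refine ⟨holDeriv x z * ↑v⁻¹, ?_, ?_⟩
  · rw [map_mul, hw, evalGerm_holDeriv_chartCoord_mul, ← map_mul, Units.mul_inv, map_one]
  · refine Subtype.ext (Derivation.ext fun f => ?_)
    change algebraMap (HolGerm x) (MerGerm x) (chartCoord x) * merDeriv x f =
      algebraMap (HolGerm x) (MerGerm x) (holDeriv x z * ↑v⁻¹) *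
      (algebraMap (HolGerm x) (MerGerm x) z * (algebraMap _ _ (holDeriv x z))⁻¹ * merDeriv x f)
    have h0 := hz.algebraMap_holDeriv_ne_zero
    have h1 : chartCoord x = z * ↑v⁻¹ := by rw [hw, Units.mul_inv_cancel_right]
    rw [h1, map_mul, map_mul]
    field_simp

theorem exists_smul_coordField (hz : IsUniformizer z) (τ : merVectorField x) :
    ∃ f : MerGerm x, τ = f • coordField z := by
  obtain ⟨τ, hτ⟩ := τ
  obtain ⟨f, rfl⟩ := Submodule.mem_span_singleton.1 hτ
  refine ⟨f * ((algebraMap (HolGerm x) (MerGerm x) z)⁻¹ * algebraMap _ _ (holDeriv x z)), ?_⟩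
  have h0 := hz.algebraMap_holDeriv_ne_zero
  have h1 := hz.algebraMap_ne_zero
  rw [coordField, smul_smul]
  refine Subtype.ext ?_
  change f • merDeriv x = _ • merDeriv x
  congr 1
  field_simp

/-- Every vector field is a multiple of z d/dz, on which dz/z takes the value 1: the two are dual
bases. -/
theorem IsUniformizer.form_eq (hz : IsUniformizer z) (α : MerForm x) :
    α = α (coordField z) • dlog z := by
  refine LinearMap.ext fun τ => ?_
  obtain ⟨f, rfl⟩ := exists_smul_coordField hz τ
  rw [map_smul, LinearMap.smul_apply, map_smul, hz.dlog_coordField, smul_eq_mul, smul_eq_mul,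
    smul_eq_mul, mul_one, mul_comm]

theorem IsUniformizer.dlog_mem_polarForms (hz : IsUniformizer z) : dlog z ∈ polarForms x 1 :=
  Submodule.subset_span ⟨z, hz, by rw [dlog, zpow_neg_one]⟩

end Uniformizer

/-! ### The operator D = ∇ along z d/dz -/

section LogDerivative

variable {X : Type*} [TopologicalSpace X] [ChartedSpace ℂ X] {x : X} {z : HolGerm x}
  {V : Type*} [AddCommGroup V] [Module (MerGerm x) V]

theorem contract_smul (f : MerGerm x) (τ : merVectorField x) (t : V ⊗[MerGerm x] MerForm x) :
    contract V (f • τ) t = f • contract V τ t := by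
  induction t using TensorProduct.induction_on with
  | zero => rw [map_zero, map_zero, smul_zero]
  | tmul v α => rw [contract_tmul, contract_tmul, map_smul, smul_assoc]
  | add s t hs ht => rw [map_add, map_add, hs, ht, smul_add]

theorem IsUniformizer.eq_contract_tmul (hz : IsUniformizer z) (t : V ⊗[MerGerm x] MerForm x) :
    t = contract V (coordField z) t ⊗ₜ dlog z := by
  induction t using TensorProduct.induction_on with
  | zero => rw [map_zero, TensorProduct.zero_tmul]
  | tmul v α => rw [contract_tmul, TensorProduct.smul_tmul, ← hz.form_eq]
  | add s t hs ht => rw [map_add, TensorProduct.add_tmul, ← hs, ← ht]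

theorem Connection.toFun_eq (nabla : Connection x V) (hz : IsUniformizer z) (v : V) :
    nabla.toFun v = nabla.along (coordField z) v ⊗ₜ dlog z :=
  hz.eq_contract_tmul _

theorem Connection.along_field_smul (nabla : Connection x V) (f : MerGerm x)
    (τ : merVectorField x) (v : V) : nabla.along (f • τ) v = f • nabla.along τ v :=
  contract_smul f τ _

variable [Module (HolGerm x) V]
  [IsScalarTower (HolGerm x) (MerGerm x) V] [Module ℂ V] [IsScalarTower ℂ (MerGerm x) V]
  [IsScalarTower ℂ (HolGerm x) V]

/-- The operator `∇_{z d/dz}`. -/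
def Connection.logOp (nabla : Connection x V) (z : HolGerm x) : Module.End ℂ V where
  toFun := nabla.along (coordField z)
  map_add' := map_add _
  map_smul' c v := by
    rw [← algebraMap_complex (x := x), nabla.along_smul, Derivation.map_algebraMap, zero_smul,
      zero_add, algebraMap_complex]
    rfl

theorem Connection.logOp_apply (nabla : Connection x V) (v : V) :
    nabla.logOp z v = nabla.along (coordField z) v := rfl

/-- Multiplication by zᵏ shifts D by k. All later eigenvalue separation between powers of z comes
from this rule. -/
theorem Connection.logOp_zpow_smul (nabla : Connection x V) (hz : IsUniformizer z) (k : ℤ) (v : V) :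
    nabla.logOp z (algebraMap (HolGerm x) (MerGerm x) z ^ k • v) =
      algebraMap (HolGerm x) (MerGerm x) z ^ k • (nabla.logOp z v + (k : ℂ) • v) := by
  rw [logOp_apply, nabla.along_smul, coordField_zpow hz, smul_add, logOp_apply, add_comm, mul_comm,
    mul_smul, ← algebraMap_complex (x := x), map_intCast]

theorem Connection.exists_logOp_smul (nabla : Connection x V) (hz : IsUniformizer z)
    (a : HolGerm x) : ∃ b : HolGerm x, ∀ v : V,
      nabla.logOp z (a • v) = (z * b) • v + a • nabla.logOp z v := by
  obtain ⟨b, hb⟩ := hz.coordField_algebraMap a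
  refine ⟨b, fun v => ?_⟩
  rw [logOp_apply, ← algebraMap_smul (MerGerm x) a v, nabla.along_smul, hb, algebraMap_smul,
    algebraMap_smul, logOp_apply]

/-- Contraction with ζ d/dζ has no pole on Ω(1), and this field is a unit times z d/dz; conversely
∇v = Dv ⊗ dz/z with dz/z in Ω(1). -/
theorem Connection.isLogarithmic_iff (nabla : Connection x V) (hz : IsUniformizer z)
    {L : Submodule (HolGerm x) V} :
    nabla.IsLogarithmic L ↔ ∀ v ∈ L, nabla.logOp z v ∈ L := by
  constructor
  · intro h v hv
    obtain ⟨u, hu, he⟩ := hz.exists_eulerField_eq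
    have h1 := h.along_mem hv
    obtain ⟨w, rfl⟩ := (isUnit_iff_evalGerm_ne_zero u).2 (hu ▸ one_ne_zero)
    rw [he, nabla.along_field_smul, algebraMap_smul] at h1
    have h2 := L.smul_mem (↑w⁻¹ : HolGerm x) h1
    rwa [smul_smul, Units.inv_mul, one_smul] at h2
  · intro h v hv
    rw [nabla.toFun_eq hz]
    exact Submodule.subset_span ⟨_, h v hv, _, hz.dlog_mem_polarForms, rfl⟩

end LogDerivative

/-! ### Polynomials in an operator and nonresonance -/

section Polynomials

variable {W W' : Type*} [AddCommGroup W] [Module ℂ W] [AddCommGroup W'] [Module ℂ W']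

/-- Applied below to inclusions, to quotient maps, to multiplication by zᵏ and to matrices, in order
to carry polynomial identities from one operator to another. -/
theorem aeval_intertwine (f : W →ₗ[ℂ] W') {S : Module.End ℂ W} {T : Module.End ℂ W'}
    (h : ∀ w, f (S w) = T (f w)) (p : Polynomial ℂ) (w : W) :
    f (Polynomial.aeval S p w) = Polynomial.aeval T p (f w) := by
  induction p using Polynomial.induction_on' with
  | add p q hp hq => simp only [map_add, LinearMap.add_apply, hp, hq]
  | monomial n a =>
    have hn : f ((S ^ n) w) = (T ^ n) (f w) := by
      induction n with
      | zero => simp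
      | succ n ih => rw [pow_succ', pow_succ', Module.End.mul_apply, Module.End.mul_apply, h, ih]
    simp [Polynomial.aeval_monomial, hn]

theorem aeval_mem {S : Module.End ℂ W} {N : Submodule ℂ W} (h : ∀ w ∈ N, S w ∈ N)
    (p : Polynomial ℂ) {w : W} (hw : w ∈ N) : Polynomial.aeval S p w ∈ N := by
  have := aeval_intertwine N.subtype (S := S.restrict h) (T := S) (fun _ => rfl) p ⟨w, hw⟩
  rw [N.subtype_apply, N.subtype_apply] at this
  exact this ▸ Subtype.coe_prop _

theorem aeval_add_smul (S : Module.End ℂ W) (c : ℂ) (p : Polynomial ℂ) :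
    Polynomial.aeval (S + c • LinearMap.id) p =
      Polynomial.aeval S (p.comp (Polynomial.X + Polynomial.C c)) := by
  rw [Polynomial.aeval_comp]
  congr 1
  rw [map_add, Polynomial.aeval_X, Polynomial.aeval_C, Algebra.algebraMap_eq_smul_one]
  rfl

/-- No two roots of `p` differ by a nonzero integer. -/
def IsNonresonant (p : Polynomial ℂ) : Prop :=
  ∀ k : ℤ, k ≠ 0 → IsCoprime p (p.comp (Polynomial.X + Polynomial.C (k : ℂ)))

theorem isNonresonant_of_roots {p : Polynomial ℂ}
    (h : ∀ a, p.IsRoot a → ∀ k : ℤ, k ≠ 0 → ¬ p.IsRoot (a + k)) : IsNonresonant p := by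
  intro k hk
  rw [Polynomial.isCoprime_iff_aeval_ne_zero_of_isAlgClosed ℂ ℂ]
  intro a
  by_contra! hc
  rw [Polynomial.coe_aeval_eq_eval, Polynomial.eval_comp] at hc
  simp only [Polynomial.eval_add, Polynomial.eval_X, Polynomial.eval_C] at hc
  exact h a hc.1 k hk hc.2

/-- A Bézout relation writes the identity as a combination of two operators that both kill w. -/
theorem IsNonresonant.eq_zero {p : Polynomial ℂ} (hp : IsNonresonant p) {k : ℤ} (hk : k ≠ 0)
    {S : Module.End ℂ W} {w : W} (h1 : Polynomial.aeval S p w = 0)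
    (h2 : Polynomial.aeval S (p.comp (Polynomial.X + Polynomial.C (k : ℂ))) w = 0) : w = 0 := by
  obtain ⟨a, b, hab⟩ := hp k hk
  have := congrArg (fun q => Polynomial.aeval S q w) hab
  simp only [map_add, map_mul, LinearMap.add_apply, Module.End.mul_apply, h1, h2, map_zero,
    add_zero, map_one, Module.End.one_apply] at this
  exact this.symm

end Polynomials

/-! ### Forms in a lattice and uniqueness of stable forms -/

section Forms

variable {X : Type*} [TopologicalSpace X] [ChartedSpace ℂ X] {x : X} {z : HolGerm x}
  {V : Type*} [AddCommGroup V] [Module (MerGerm x) V] [Module (HolGerm x) V]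
  [IsScalarTower (HolGerm x) (MerGerm x) V] [Module ℂ V] [IsScalarTower ℂ (MerGerm x) V]
  [IsScalarTower ℂ (HolGerm x) V]

theorem zpow_smul_eq (hz : IsUniformizer z) {k l : ℤ} (h : k ≤ l) (v : V) :
    algebraMap (HolGerm x) (MerGerm x) z ^ l • v = algebraMap (HolGerm x) (MerGerm x) z ^ k •
        (z ^ (l - k).toNat • v) := by
  rw [← algebraMap_smul (MerGerm x) (z ^ (l - k).toNat) v, map_pow, smul_smul, ← zpow_natCast,
    ← zpow_add₀ hz.algebraMap_ne_zero, Int.toNat_of_nonneg (sub_nonneg.2 h), add_sub_cancel]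

theorem smul_zpow_smul (f : MerGerm x) (a : HolGerm x) (v : V) : a • f • v = f • a • v := by
  rw [← algebraMap_smul (MerGerm x) a v, ← algebraMap_smul (MerGerm x) a (f • v), smul_comm]

theorem complex_smul_zpow_smul (f : MerGerm x) (c : ℂ) (v : V) : c • f • v = f • c • v := by
  rw [← algebraMap_complex (x := x) c v, ← algebraMap_complex (x := x) c, smul_comm]

/-- The lattice `zᵏ L`. -/
def zShift (z : HolGerm x) (k : ℤ) (L : Submodule (HolGerm x) V) : Submodule (HolGerm x) V where
  carrier := {v | ∃ w ∈ L, algebraMap (HolGerm x) (MerGerm x) z ^ k • w = v}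
  add_mem' := by
    rintro _ _ ⟨v, hv, rfl⟩ ⟨w, hw, rfl⟩
    exact ⟨v + w, L.add_mem hv hw, smul_add _ _ _⟩
  zero_mem' := ⟨0, L.zero_mem, smul_zero _⟩
  smul_mem' := by
    rintro a _ ⟨v, hv, rfl⟩
    exact ⟨a • v, L.smul_mem a hv, (smul_zpow_smul _ _ _).symm⟩

theorem mem_zShift {k : ℤ} {L : Submodule (HolGerm x) V} {v : V} :
    v ∈ zShift z k L ↔ ∃ w ∈ L, algebraMap (HolGerm x) (MerGerm x) z ^ k • w = v := Iff.rfl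

theorem zpow_smul_mem_zShift {k : ℤ} {L : Submodule (HolGerm x) V} {v : V} (hv : v ∈ L) :
    algebraMap (HolGerm x) (MerGerm x) z ^ k • v ∈ zShift z k L := ⟨v, hv, rfl⟩

theorem zShift_le (hz : IsUniformizer z) {k l : ℤ} (h : k ≤ l) (L : Submodule (HolGerm x) V) :
    zShift z l L ≤ zShift z k L := by
  rintro _ ⟨v, hv, rfl⟩
  exact ⟨_, L.smul_mem (z ^ (l - k).toNat) hv, (zpow_smul_eq hz h v).symm⟩

theorem zShift_zero (L : Submodule (HolGerm x) V) : zShift z 0 L = L := by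
  ext v
  simp [mem_zShift]

theorem zShift_one {L : Submodule (HolGerm x) V} {v : V} :
    v ∈ zShift z 1 L ↔ ∃ w ∈ L, v = z • w := by
  simp only [mem_zShift, zpow_one, algebraMap_smul, eq_comm]

theorem logOp_mem_zShift {nabla : Connection x V} (hz : IsUniformizer z)
    {L : Submodule (HolGerm x) V} (hL : ∀ v ∈ L, nabla.logOp z v ∈ L) (k : ℤ) :
    ∀ v ∈ zShift z k L, nabla.logOp z v ∈ zShift z k L := by
  rintro _ ⟨v, hv, rfl⟩
  rw [nabla.logOp_zpow_smul hz]
  exact zpow_smul_mem_zShift (L.add_mem (hL v hv) ((L.restrictScalars ℂ).smul_mem _ hv))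

theorem aeval_logOp_mem {nabla : Connection x V} {L : Submodule (HolGerm x) V}
    (hL : ∀ v ∈ L, nabla.logOp z v ∈ L) (p : Polynomial ℂ) {v : V} (hv : v ∈ L) :
    Polynomial.aeval (nabla.logOp z) p v ∈ L :=
  aeval_mem (N := L.restrictScalars ℂ) hL p hv

theorem aeval_logOp_zpow_smul (nabla : Connection x V) (hz : IsUniformizer z) (k : ℤ)
    (p : Polynomial ℂ) (v : V) :
    Polynomial.aeval (nabla.logOp z) p (algebraMap (HolGerm x) (MerGerm x) z ^ k • v) =
      algebraMap (HolGerm x) (MerGerm x) z ^ k • Polynomial.aeval (nabla.logOp z)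
        (p.comp (Polynomial.X + Polynomial.C (k : ℂ))) v := by
  rw [← aeval_add_smul]
  exact (aeval_intertwine (Algebra.lsmul ℂ ℂ V (algebraMap (HolGerm x) (MerGerm x) z ^ k))
    (S := nabla.logOp z + (k : ℂ) • LinearMap.id) (T := nabla.logOp z)
    (fun w => (nabla.logOp_zpow_smul hz k w).symm) p v).symm

theorem IsForm.isLattice {L : Submodule (HolGerm x) V} {Y : Submodule ℂ V} (h : IsForm L Y) :
    IsLattice L := by
  obtain ⟨b, hb, -⟩ := h
  exact ⟨b, hb⟩

theorem IsForm.mem {L : Submodule (HolGerm x) V} {Y : Submodule ℂ V} (h : IsForm L Y) {y : V}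
    (hy : y ∈ Y) : y ∈ L := by
  obtain ⟨b, rfl, rfl⟩ := h
  have : Submodule.span ℂ (Set.range b) ≤
      (Submodule.span (HolGerm x) (Set.range b)).restrictScalars ℂ :=
    Submodule.span_le.2 Submodule.subset_span
  exact this hy

/-- Coefficientwise this is 𝒪 = ℂ + z𝒪. With `IsForm.eq_zero` it gives L = Y ⊕ zL, so Y is a copy of
the fibre inside L. -/
theorem IsForm.exists_eq_add {L : Submodule (HolGerm x) V} {Y : Submodule ℂ V} (h : IsForm L Y)
    (hz : IsUniformizer z) {v : V} (hv : v ∈ L) : ∃ y ∈ Y, ∃ w ∈ L, v = y + z • w := by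
  obtain ⟨b, rfl, rfl⟩ := h
  induction hv using Submodule.span_induction with
  | mem v hv => exact ⟨v, Submodule.subset_span hv, 0, Submodule.zero_mem _, by simp⟩
  | zero => exact ⟨0, Submodule.zero_mem _, 0, Submodule.zero_mem _, by simp⟩
  | add v v' _ _ h h' =>
    obtain ⟨y, hy, w, hw, rfl⟩ := h
    obtain ⟨y', hy', w', hw', rfl⟩ := h'
    exact ⟨y + y', Submodule.add_mem _ hy hy', w + w', Submodule.add_mem _ hw hw', by
      rw [smul_add]; abel⟩
  | smul a v hv h =>
    obtain ⟨y, hy, w, hw, h⟩ := h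
    obtain ⟨a', ha⟩ := hz.exists_eq_add a
    refine ⟨evalGerm x a • y, Submodule.smul_mem _ _ hy, algebraMap ℂ _ (evalGerm x a) • w + a' • v,
      Submodule.add_mem _ (Submodule.smul_mem _ _ hw) (Submodule.smul_mem _ _ hv), ?_⟩
    conv_lhs => rw [ha, add_smul]
    conv_lhs => enter [1]; rw [h]
    rw [smul_add, algebraMap_smul, smul_add, smul_smul, smul_smul, smul_smul, mul_comm z
        (algebraMap ℂ _ _),
      add_assoc]

theorem IsForm.eq_zero {L : Submodule (HolGerm x) V} {Y : Submodule ℂ V} (h : IsForm L Y)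
    (hz : IsUniformizer z) {y : V} (hy : y ∈ Y) (hyL : y ∈ zShift z 1 L) : y = 0 := by
  obtain ⟨b, rfl, rfl⟩ := h
  obtain ⟨w, hw, rfl⟩ := zShift_one.1 hyL
  refine b.ext_elem fun i => ?_
  obtain ⟨c, hc⟩ := (b.mem_span_iff_repr_mem ℂ _).1 hy i
  obtain ⟨a, ha⟩ := (b.mem_span_iff_repr_mem (HolGerm x) _).1 hw i
  have h1 : algebraMap ℂ (HolGerm x) c = z * a := by
    apply IsFractionRing.injective (HolGerm x) (MerGerm x)
    rw [← IsScalarTower.algebraMap_apply, hc, ← algebraMap_smul (MerGerm x) z w, map_smul,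
      Finsupp.smul_apply, ← ha, map_mul, smul_eq_mul]
  have h2 : c = 0 := by
    have := congrArg (evalGerm x) h1
    rwa [evalGerm_algebraMap, map_mul, hz.evalGerm_eq_zero, zero_mul] at this
  rw [← hc, h2, map_zero, map_zero, Finsupp.zero_apply]

/-- The lattice is z-adically separated: each coordinate is divisible by every power of z. -/
theorem IsLattice.eq_zero_of_forall_mem {L : Submodule (HolGerm x) V} (h : IsLattice L)
    (hz : IsUniformizer z) {v : V} (hv : ∀ n : ℕ, v ∈ zShift z n L) : v = 0 := by
  obtain ⟨b, rfl⟩ := h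
  refine b.ext_elem fun i => ?_
  have h0 := hv 0
  rw [Nat.cast_zero, zShift_zero] at h0
  obtain ⟨a, ha⟩ := (b.mem_span_iff_repr_mem (HolGerm x) _).1 h0 i
  have : a = 0 := hz.eq_zero_of_pow_dvd fun n => by
    obtain ⟨w, hw, rfl⟩ := hv n
    obtain ⟨c, hc⟩ := (b.mem_span_iff_repr_mem (HolGerm x) _).1 hw i
    refine ⟨c, IsFractionRing.injective (HolGerm x) (MerGerm x) ?_⟩
    rw [ha, map_mul, hc, map_smul, Finsupp.smul_apply, map_pow, zpow_natCast, smul_eq_mul]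
  rw [← ha, this, map_zero, map_zero, Finsupp.zero_apply]

/-- Stability puts p(D)y in Y and the hypothesis puts it in zL, and Y ∩ zL = 0. Thus the congruence
p(D) ≡ 0 modulo z becomes an equality on Y. -/
theorem IsForm.aeval_eq_zero {nabla : Connection x V} {L : Submodule (HolGerm x) V}
    {Y : Submodule ℂ V} (h : IsForm L Y) (hz : IsUniformizer z)
    (hY : ∀ y ∈ Y, nabla.logOp z y ∈ Y) {p : Polynomial ℂ}
    (hp : ∀ v ∈ L, Polynomial.aeval (nabla.logOp z) p v ∈ zShift z 1 L) {y : V} (hy : y ∈ Y) :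
    Polynomial.aeval (nabla.logOp z) p y = 0 :=
  h.eq_zero hz (aeval_mem hY p hy) (hp y (h.mem hy))

/-- Two stable forms in a lattice with nonresonant residue coincide. -/
theorem IsForm.le_of_isNonresonant {nabla : Connection x V} {L : Submodule (HolGerm x) V}
    {Y Y' : Submodule ℂ V} (h : IsForm L Y) (h' : IsForm L Y') (hz : IsUniformizer z)
    (hL : ∀ v ∈ L, nabla.logOp z v ∈ L) (hY : ∀ y ∈ Y, nabla.logOp z y ∈ Y)
    (hY' : ∀ y ∈ Y', nabla.logOp z y ∈ Y') {p : Polynomial ℂ} (hpn : IsNonresonant p)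
    (hp : ∀ v ∈ L, Polynomial.aeval (nabla.logOp z) p v ∈ zShift z 1 L) : Y' ≤ Y := by
  intro v hv
  obtain ⟨y, hy, w, hw, hvy⟩ := h.exists_eq_add hz (h'.mem hv)
  have hpv : Polynomial.aeval (nabla.logOp z) p (v - y) = 0 := by
    rw [map_sub, h'.aeval_eq_zero hz hY' hp hv, h.aeval_eq_zero hz hY hp hy, sub_zero]
  -- Successive approximation: v − y vanishes to order 1 by construction, and killing its leading
  -- coefficient raises the order by one each time.
  have key : ∀ n : ℕ, v - y ∈ zShift z ((n + 1 : ℕ) : ℤ) L := by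
    intro n
    induction n with
    | zero =>
      rw [zero_add, Nat.cast_one, zShift_one]
      exact ⟨w, hw, by rw [hvy]; abel⟩
    | succ n ih =>
      obtain ⟨w, hw, hwv⟩ := ih
      obtain ⟨y₁, hy₁, w₁, hw₁, rfl⟩ := h.exists_eq_add hz hw
      rw [← hwv, aeval_logOp_zpow_smul _ hz,
        smul_eq_zero_iff_right (zpow_ne_zero _ hz.algebraMap_ne_zero), map_add] at hpv
      -- Dividing p(D)(v − y) = 0 by zⁿ⁺¹ replaces D by D + (n + 1). The coefficient y₁ is then sent
      -- into Y and, up to sign, onto the image of z w₁, which lies in zL.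
      have h0 : Polynomial.aeval (nabla.logOp z)
          (p.comp (Polynomial.X + Polynomial.C (((n + 1 : ℕ) : ℤ) : ℂ))) y₁ = 0 := by
        refine h.eq_zero hz (aeval_mem hY _ hy₁) ?_
        rw [eq_neg_of_add_eq_zero_left hpv]
        exact Submodule.neg_mem _ (aeval_logOp_mem (logOp_mem_zShift hz hL 1) _
          (zShift_one.2 ⟨w₁, hw₁, rfl⟩))
      have h1 : y₁ = 0 := hpn.eq_zero (by positivity) (h.aeval_eq_zero hz hY hp hy₁) h0
      rw [← hwv, h1, zero_add]
      refine ⟨w₁, hw₁, ?_⟩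
      rw [Nat.cast_succ (n + 1), zpow_add_one₀ hz.algebraMap_ne_zero, mul_smul, algebraMap_smul]
  have : v - y = 0 := h.isLattice.eq_zero_of_forall_mem hz fun n =>
    zShift_le hz (by simp) L (key n)
  rw [sub_eq_zero.1 this]
  exact hy

end Forms

/-! ### Existence of a basis with constant matrix -/

section ExistsForm

variable {X : Type*} [TopologicalSpace X] [ChartedSpace ℂ X] {x : X} {z : HolGerm x}
  {V : Type*} [AddCommGroup V] [Module (MerGerm x) V] [Module (HolGerm x) V]
  [IsScalarTower (HolGerm x) (MerGerm x) V] [Module ℂ V] [IsScalarTower ℂ (MerGerm x) V]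
  [IsScalarTower ℂ (HolGerm x) V]

theorem IsLattice.exists_basis {L : Submodule (HolGerm x) V} (hL : IsLattice L)
    {b : Fin (Module.finrank (MerGerm x) V) → V} (hb : L = Submodule.span (HolGerm x)
        (Set.range b)) :
    ∃ b' : Module.Basis (Fin (Module.finrank (MerGerm x) V)) (MerGerm x) V, ⇑b' = b := by
  obtain ⟨e, he⟩ := hL
  have hspan : ⊤ ≤ Submodule.span (MerGerm x) (Set.range b) := by
    rw [← e.span_eq, Submodule.span_le]
    rintro _ ⟨i, rfl⟩
    have h1 : e i ∈ Submodule.span (HolGerm x) (Set.range b) := by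
      rw [← hb, he]
      exact Submodule.subset_span ⟨i, rfl⟩
    have h2 : Submodule.span (HolGerm x) (Set.range b) ≤
        (Submodule.span (MerGerm x) (Set.range b)).restrictScalars (HolGerm x) :=
      Submodule.span_le.2 Submodule.subset_span
    exact h2 h1
  exact ⟨basisOfTopLeSpanOfCardEqFinrank b hspan (Fintype.card_fin _),
    coe_basisOfTopLeSpanOfCardEqFinrank b hspan _⟩

/-- Change of basis of a lattice by a matrix which is invertible at `x`. -/
theorem IsLattice.exists_basis_of_isUnit_det {L : Submodule (HolGerm x) V}
    {e : Module.Basis (Fin (Module.finrank (MerGerm x) V)) (MerGerm x) V}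
    (he : L = Submodule.span (HolGerm x) (Set.range e))
    {P : Matrix (Fin (Module.finrank (MerGerm x) V)) (Fin (Module.finrank (MerGerm x) V))
        (HolGerm x)}
    (hP : IsUnit P.det) :
    ∃ b : Module.Basis (Fin (Module.finrank (MerGerm x) V)) (MerGerm x) V,
      L = Submodule.span (HolGerm x) (Set.range b) ∧ ∀ j, b j = ∑ i, P i j • e i := by
  have hspan : L = Submodule.span (HolGerm x) (Set.range fun j => ∑ i, P i j • e i) := by
    refine le_antisymm ?_ ?_
    · rw [he, Submodule.span_le]
      rintro _ ⟨i, rfl⟩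
      have : e i = ∑ j, P⁻¹ j i • ∑ l, P l j • e l := by
        simp only [Finset.smul_sum, smul_smul]
        rw [Finset.sum_comm]
        simp only [← Finset.sum_smul]
        have h1 : ∀ l, ∑ j, P⁻¹ j i * P l j = (1 : Matrix _ _ (HolGerm x)) l i := fun l => by
          rw [← Matrix.mul_nonsing_inv P hP, Matrix.mul_apply]
          exact Finset.sum_congr rfl fun _ _ => mul_comm _ _
        simp only [h1, Matrix.one_apply, ite_smul, one_smul, zero_smul, Finset.sum_ite_eq',
          Finset.mem_univ, if_true]
      rw [this]
      exact Submodule.sum_mem _ fun j _ => Submodule.smul_mem _ _ (Submodule.subset_span ⟨j, rfl⟩)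
    · rw [he, Submodule.span_le]
      rintro _ ⟨j, rfl⟩
      exact Submodule.sum_mem _ fun i _ => Submodule.smul_mem _ _ (Submodule.subset_span ⟨i, rfl⟩)
  obtain ⟨b, hb⟩ := IsLattice.exists_basis ⟨e, he⟩ hspan
  exact ⟨b, by rw [hb, ← hspan], fun j => congrFun hb j⟩

/-- The formal recursion of a nonresonant Fuchsian system can be solved in every degree. -/
theorem IsNonresonant.eq_zero_of_commutator {n : ℕ} {p : Polynomial ℂ} (hp : IsNonresonant p)
    {A P : Matrix (Fin n) (Fin n) ℂ} (hA : ∀ c, Polynomial.aeval A.mulVecLin p c = 0) {k : ℤ}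
    (hk : k ≠ 0) (h : P * A - A * P = (k : ℂ) • P) : P = 0 := by
  have hinter := aeval_intertwine P.mulVecLin
    (S := A.mulVecLin + (((-k : ℤ)) : ℂ) • LinearMap.id) (T := A.mulVecLin) (fun c => by
      have h1 : P * A = A * P + (k : ℂ) • P := by rw [← h]; abel
      have h2 := congrArg (fun M => M.mulVec c) h1
      simp only [Matrix.add_mulVec, ← Matrix.mulVec_mulVec, Matrix.smul_mulVec] at h2
      simp only [LinearMap.add_apply, LinearMap.smul_apply, LinearMap.id_apply, map_add, map_smul,
        Matrix.mulVecLin_apply, h2]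
      push_cast
      rw [neg_smul, add_neg_cancel_right]) p
  have hzero : ∀ c, P.mulVec c = 0 := by
    intro c
    -- Because p(A) = 0, coprimality makes p(A − k) surjective, with preimage b(A)c of c. The
    -- relation P(A − k) = AP then gives Pc = p(A)Pb(A)c = 0.
    obtain ⟨a, b, hab⟩ := hp (-k) (neg_ne_zero.2 hk)
    have h1 := congrArg (fun q => Polynomial.aeval A.mulVecLin q c) hab
    simp only [map_add, mul_comm b, map_mul, LinearMap.add_apply, Module.End.mul_apply, map_one,
      Module.End.one_apply, hA] at h1
    have h2 := hinter (Polynomial.aeval A.mulVecLin b c)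
    rwa [hA, aeval_add_smul, ← zero_add (Polynomial.aeval A.mulVecLin _ _),
      ← map_zero (Polynomial.aeval A.mulVecLin a), h1, map_zero] at h2
  exact Matrix.mulVec_injective (funext fun c => by rw [hzero, Matrix.zero_mulVec])

theorem complex_smul_sum_eq_zero {n : ℕ} (e : Module.Basis (Fin n) (MerGerm x) V) {c : Fin n → ℂ}
    (h : ∑ i, c i • e i = 0) : c = 0 := by
  have h1 : ∑ i, algebraMap ℂ (MerGerm x) (c i) • e i = 0 := by
    simpa only [algebraMap_complex] using h
  funext i
  have h2 := Fintype.linearIndependent_iff.1 e.linearIndependent _ h1 i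
  exact (map_eq_zero _).1 h2

/-- If `p (∇_{z d/dz})` maps the lattice to its multiple by `z`, then `p` kills the residue
matrix. -/
theorem aeval_residueMatrix {nabla : Connection x V} (hz : IsUniformizer z)
    {L : Submodule (HolGerm x) V} (hL : ∀ v ∈ L, nabla.logOp z v ∈ L)
    {e : Module.Basis (Fin (Module.finrank (MerGerm x) V)) (MerGerm x) V}
    (he : L = Submodule.span (HolGerm x) (Set.range e)) {p : Polynomial ℂ}
    (hp : ∀ v ∈ L, Polynomial.aeval (nabla.logOp z) p v ∈ zShift z 1 L)
    {B : Matrix (Fin (Module.finrank (MerGerm x) V)) (Fin (Module.finrank (MerGerm x) V))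
        (HolGerm x)}
    (hB : ∀ j, nabla.logOp z (e j) = ∑ i, B i j • e i)
    (c : Fin (Module.finrank (MerGerm x) V) → ℂ) :
    Polynomial.aeval (B.map (evalGerm x)).mulVecLin p c = 0 := by
  set N : Submodule ℂ V := (zShift z 1 L).restrictScalars ℂ with hN
  have hDN : N ≤ N.comap (nabla.logOp z) := logOp_mem_zShift hz hL 1
  set φ : (Fin (Module.finrank (MerGerm x) V) → ℂ) →ₗ[ℂ] V := Fintype.linearCombination ℂ e with hφ
  have hφe : ∀ c, φ c = ∑ i, c i • e i := fun c => Fintype.linearCombination_apply ..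
  -- Modulo zL only the value of B at x survives, so φ intertwines the residue matrix with the
  -- operator induced by D on V/zL.
  have h1 : ∀ c, (N.mkQ ∘ₗ φ) ((B.map (evalGerm x)).mulVecLin c) =
      N.mapQ N (nabla.logOp z) hDN ((N.mkQ ∘ₗ φ) c) := by
    intro c
    change N.mkQ _ = N.mkQ _
    rw [← sub_eq_zero, ← map_sub, Submodule.mkQ_apply, Submodule.Quotient.mk_eq_zero, ← neg_mem_iff,
      neg_sub, hφe, hφe, map_sum]
    have h2 : ∀ i j, ∃ a, B i j = algebraMap ℂ _ (evalGerm x (B i j)) + z * a := fun i j =>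
      hz.exists_eq_add _
    choose B' hB' using h2
    have h3 : ∑ i, nabla.logOp z (c i • e i) -
        ∑ i, (B.map (evalGerm x)).mulVecLin c i • e i =
        z • ∑ j, c j • ∑ i, B' i j • e i := by
      simp only [map_smul, hB, Matrix.mulVecLin_apply, Matrix.mulVec, dotProduct, Matrix.map_apply,
        Finset.smul_sum, Finset.sum_smul]
      rw [Finset.sum_comm (f := fun i j => (evalGerm x (B i j) * c j) • e i),
        ← Finset.sum_sub_distrib]
      refine Finset.sum_congr rfl fun j _ => ?_
      rw [← Finset.sum_sub_distrib]
      refine Finset.sum_congr rfl fun i _ => ?_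
      conv_lhs => enter [1]; rw [hB', add_smul, algebraMap_smul]
      rw [smul_add, smul_smul, mul_comm, add_sub_cancel_left, mul_smul, smul_comm]
    rw [h3]
    refine zShift_one.2 ⟨_, ?_, rfl⟩
    refine Submodule.sum_mem _ fun j _ => (L.restrictScalars ℂ).smul_mem _
      (Submodule.sum_mem L fun i _ => L.smul_mem _ ?_)
    rw [he]
    exact Submodule.subset_span ⟨i, rfl⟩
  have hY : IsForm L (Submodule.span ℂ (Set.range e)) := ⟨e, he, rfl⟩
  have hmem : ∀ c, φ c ∈ Submodule.span ℂ (Set.range e) := fun c => by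
    rw [hφe]
    exact Submodule.sum_mem _ fun i _ => Submodule.smul_mem _ _ (Submodule.subset_span ⟨i, rfl⟩)
  have h4 := aeval_intertwine _ h1 p c
  have h5 := aeval_intertwine N.mkQ (S := nabla.logOp z) (T := N.mapQ N (nabla.logOp z) hDN)
    (fun _ => rfl) p (φ c)
  rw [LinearMap.comp_apply, LinearMap.comp_apply, ← h5] at h4
  have h6 : N.mkQ (Polynomial.aeval (nabla.logOp z) p (φ c)) = 0 :=
    (Submodule.Quotient.mk_eq_zero N).2 (hp _ (hY.mem (hmem c)))
  have h7 := (Submodule.Quotient.mk_eq_zero N).1 (h4.trans h6)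
  have h8 := hY.eq_zero hz (hmem _) h7
  rw [hφe] at h8
  exact complex_smul_sum_eq_zero e h8

/-- A stable lattice with nonresonant residue has a basis in which the matrix of `∇_{z d/dz}` is
constant. -/
theorem exists_constant_matrix {nabla : Connection x V} (hz : IsUniformizer z)
    {L : Submodule (HolGerm x) V} (hlat : IsLattice L) (hL : ∀ v ∈ L, nabla.logOp z v ∈ L)
    {p : Polynomial ℂ} (hpn : IsNonresonant p)
    (hp : ∀ v ∈ L, Polynomial.aeval (nabla.logOp z) p v ∈ zShift z 1 L) :
    ∃ (b : Module.Basis (Fin (Module.finrank (MerGerm x) V)) (MerGerm x) V)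
      (A : Matrix (Fin (Module.finrank (MerGerm x) V)) (Fin (Module.finrank (MerGerm x) V)) ℂ),
      L = Submodule.span (HolGerm x) (Set.range b) ∧
      ∀ j, nabla.logOp z (b j) = ∑ i, A i j • b i := by
  obtain ⟨e, he⟩ := hlat
  have hB : ∀ j, ∃ B : Fin (Module.finrank (MerGerm x) V) → HolGerm x,
      nabla.logOp z (e j) = ∑ i, B i • e i := by
    intro j
    have h1 : nabla.logOp z (e j) ∈ L := hL _ (he ▸ Submodule.subset_span ⟨j, rfl⟩)
    rw [he] at h1
    obtain ⟨B, hB⟩ := (Submodule.mem_span_range_iff_exists_fun _).1 h1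
    exact ⟨B, hB.symm⟩
  choose B' hB using hB
  set B : Matrix (Fin (Module.finrank (MerGerm x) V)) (Fin (Module.finrank (MerGerm x) V))
    (HolGerm x) := Matrix.of fun i j => B' j i with hBdef
  replace hB : ∀ j, nabla.logOp z (e j) = ∑ i, B i j • e i := hB
  clear_value B
  set A := B.map (evalGerm x) with hA
  have hpA := aeval_residueMatrix hz hL he hp hB
  obtain ⟨u, hu1, hu⟩ := hz.exists_eulerField_eq
  set A' : Matrix _ _ (HolGerm x) := A.map (algebraMap ℂ (HolGerm x)) with hA'
  -- The gauge equation z dP/dz = PA − BP, regarded as a linear system for the entries of P. The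
  -- factor u converts it to the chart field ζ d/dζ; as u(x) = 1, the residue of the system is Q ↦
  -- QA − AQ.
  set G : Matrix (Fin (Module.finrank (MerGerm x) V) × Fin (Module.finrank (MerGerm x) V))
    (Fin (Module.finrank (MerGerm x) V) × Fin (Module.finrank (MerGerm x) V)) (HolGerm x) :=
    Matrix.of fun s t => u * ((if s.1 = t.1 then A' t.2 s.2 else 0) -
      (if s.2 = t.2 then B s.1 t.1 else 0)) with hG
  have hGsum : ∀ (Q : Matrix (Fin (Module.finrank (MerGerm x) V))
      (Fin (Module.finrank (MerGerm x) V)) (HolGerm x)) i j,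
      ∑ t, G (i, j) t * Q t.1 t.2 = u * ((Q * A') i j - (B * Q) i j) := by
    intro Q i j
    rw [Fintype.sum_prod_type]
    simp only [hG, Matrix.of_apply, mul_assoc, ← Finset.mul_sum, sub_mul, ite_mul, zero_mul,
      Finset.sum_sub_distrib, Matrix.mul_apply]
    congr 2
    · rw [Finset.sum_comm]
      simp [mul_comm]
    · simp
  have hGev : ∀ (Q : Fin (Module.finrank (MerGerm x) V) × Fin (Module.finrank (MerGerm x) V) → ℂ)
      i j, (G.map (evalGerm x)).mulVec Q (i, j) =
        ((Matrix.of fun i j => Q (i, j)) * A - A * (Matrix.of fun i j => Q (i, j))) i j := by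
    intro Q i j
    rw [Matrix.mulVec, dotProduct, Fintype.sum_prod_type]
    simp only [hG, Matrix.map_apply, Matrix.of_apply, map_mul, hu1, one_mul, map_sub,
      Matrix.sub_apply, Matrix.mul_apply, sub_mul, Finset.sum_sub_distrib, apply_ite (evalGerm x),
      map_zero, ite_mul, zero_mul, hA', evalGerm_algebraMap]
    congr 1
    · rw [Finset.sum_comm]
      simp [mul_comm]
    · simp [hA]
  -- The identity commutes with A, so it is an allowed initial value; nonresonance excludes positive
  -- integers from the eigenvalues of the commutator.
  obtain ⟨Q, hQ0, hQ⟩ := exists_solution G (fun t => (1 : Matrix _ _ ℂ) t.1 t.2) (by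
    funext ⟨i, j⟩
    rw [hGev]
    have : (Matrix.of fun i j => (1 : Matrix (Fin (Module.finrank (MerGerm x) V))
      (Fin (Module.finrank (MerGerm x) V)) ℂ) i j) = 1 := rfl
    simp [this]) (by
    intro k hk v hv
    have h1 : (Matrix.of fun i j => v (i, j)) = 0 := by
      refine hpn.eq_zero_of_commutator hpA (k := k) (by positivity) ?_
      ext i j
      rw [← hGev, hv]
      simp
    funext ⟨i, j⟩
    exact congrFun (congrFun h1 i) j)
  set P : Matrix _ _ (HolGerm x) := Matrix.of fun i j => Q (i, j) with hP
  have hdet : IsUnit P.det := by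
    rw [isUnit_iff_evalGerm_ne_zero, RingHom.map_det]
    have : (evalGerm x).mapMatrix P = 1 := by
      ext i j
      exact hQ0 (i, j)
    rw [this, Matrix.det_one]
    exact one_ne_zero
  obtain ⟨b, hbL, hb⟩ := IsLattice.exists_basis_of_isUnit_det he hdet
  refine ⟨b, A, hbL, fun j => ?_⟩
  -- Cancelling u returns to z d/dz. By Leibniz the BP terms then cancel in D of the new basis,
  -- leaving the constant matrix A.
  have hode : ∀ i j, (coordField z : Derivation ℂ (MerGerm x) (MerGerm x)) (algebraMap _ _
      (P i j)) =
      algebraMap (HolGerm x) (MerGerm x) ((P * A') i j - (B * P) i j) := by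
    intro i j
    have h1 := congrArg (algebraMap (HolGerm x) (MerGerm x)) ((hQ (i, j)).trans (hGsum P i j))
    rw [← eulerField_algebraMap, hu, map_mul] at h1
    exact mul_left_cancel₀ ((map_ne_zero_iff _ (IsFractionRing.injective (HolGerm x)
      (MerGerm x))).2 fun h => by rw [h, map_zero] at hu1; exact zero_ne_one hu1) h1
  have hD : ∀ i, nabla.logOp z (P i j • e i) =
      ((P * A') i j - (B * P) i j) • e i + P i j • ∑ l, B l i • e l := by
    intro i
    rw [← algebraMap_smul (MerGerm x) (P i j) (e i), nabla.logOp_apply, nabla.along_smul, hode,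
      algebraMap_smul, algebraMap_smul, ← nabla.logOp_apply, hB]
  rw [hb, map_sum]
  simp only [hD, hb, Finset.sum_add_distrib, sub_smul, Finset.sum_sub_distrib, Finset.smul_sum,
    smul_smul]
  have h1 : ∑ i, ∑ l, (P i j * B l i) • e l = ∑ l, (B * P) l j • e l := by
    rw [Finset.sum_comm]
    refine Finset.sum_congr rfl fun l _ => ?_
    rw [← Finset.sum_smul, Matrix.mul_apply]
    simp only [mul_comm]
  rw [h1, sub_add_cancel, Finset.sum_comm]
  refine Finset.sum_congr rfl fun l _ => ?_
  rw [Matrix.mul_apply, Finset.sum_smul]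
  refine Finset.sum_congr rfl fun i _ => ?_
  rw [mul_comm, mul_smul, hA', Matrix.map_apply, algebraMap_smul]

end ExistsForm

/-! ### The residue and the Birkhoff form -/

section BirkhoffForm

variable {X : Type*} [TopologicalSpace X] [ChartedSpace ℂ X] {x : X} {z : HolGerm x}
  {V : Type*} [AddCommGroup V] [Module (MerGerm x) V] [Module (HolGerm x) V]
  [IsScalarTower (HolGerm x) (MerGerm x) V] [Module ℂ V] [IsScalarTower ℂ (MerGerm x) V]
  [IsScalarTower ℂ (HolGerm x) V]

theorem toFiber_eq_zero_iff (hz : IsUniformizer z) {L : Submodule (HolGerm x) V} {v : L} :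
    toFiber L v = 0 ↔ (v : V) ∈ zShift z 1 L := by
  refine (Submodule.Quotient.mk_eq_zero _).trans ?_
  rw [hz, Submodule.ideal_span_singleton_smul, Submodule.mem_smul_pointwise_iff_exists, zShift_one]
  constructor
  · rintro ⟨w, -, rfl⟩
    exact ⟨w, w.2, rfl⟩
  · rintro ⟨w, hw, h⟩
    exact ⟨⟨w, hw⟩, trivial, Subtype.ext h.symm⟩

theorem toFiber_surjective (L : Submodule (HolGerm x) V) : Function.Surjective (toFiber L) :=
  fun d => Submodule.Quotient.mk_surjective _ d

/-- The chart field is (1 + za) z d/dz, so the two covariant derivatives differ on L by elements of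
zL. The residue is therefore independent of the coordinate. -/
theorem Connection.residue_toFiber_logOp (nabla : Connection x V) (hz : IsUniformizer z)
    {L : Submodule (HolGerm x) V} (h : nabla.IsLogarithmic L) (v : L) :
    nabla.residue L h (toFiber L v) =
      toFiber L ⟨nabla.logOp z v, (nabla.isLogarithmic_iff hz).1 h v v.2⟩ := by
  rw [residue_toFiber, ← sub_eq_zero, ← map_sub, toFiber_eq_zero_iff hz]
  obtain ⟨u, hu, he⟩ := hz.exists_eulerField_eq
  obtain ⟨a, ha⟩ := hz.exists_eq_add u
  rw [hu, map_one] at ha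
  change nabla.along (eulerField x) (v : V) - nabla.logOp z v ∈ _
  rw [he, nabla.along_field_smul, algebraMap_smul, ha, add_smul, one_smul, ← nabla.logOp_apply,
    add_sub_cancel_left, mul_smul]
  exact zShift_one.2 ⟨_, L.smul_mem a ((nabla.isLogarithmic_iff hz).1 h v v.2), rfl⟩

theorem Connection.aeval_minpoly_residue_mem (nabla : Connection x V) (hz : IsUniformizer z)
    {L : Submodule (HolGerm x) V} (h : nabla.IsLogarithmic L) {v : V} (hv : v ∈ L) :
    Polynomial.aeval (nabla.logOp z) (minpoly ℂ (nabla.residue L h)) v ∈ zShift z 1 L := by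
  have hL := (nabla.isLogarithmic_iff hz).1 h
  set S : Module.End ℂ L := (nabla.logOp z).restrict (p := L.restrictScalars ℂ)
    (q := L.restrictScalars ℂ) hL
  have h1 := aeval_intertwine (toFiber L) (S := S) (T := nabla.residue L h)
    (fun w => (nabla.residue_toFiber_logOp hz h w).symm) (minpoly ℂ (nabla.residue L h)) ⟨v, hv⟩
  rw [minpoly.aeval, LinearMap.zero_apply, toFiber_eq_zero_iff hz] at h1
  have h2 := aeval_intertwine (L.restrictScalars ℂ).subtype (S := S) (T := nabla.logOp z)
    (fun _ => rfl) (minpoly ℂ (nabla.residue L h)) ⟨v, hv⟩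
  exact h2 ▸ h1

/-- A form surjects onto the fibre since L = Y + zL. Finite dimension is what identifies the roots
of the minimal polynomial of the residue with its eigenvalues. -/
theorem IsLattice.finiteDimensional_fiber {L : Submodule (HolGerm x) V} (hL : IsLattice L)
    (hz : IsUniformizer z) : FiniteDimensional ℂ (Fiber L) := by
  obtain ⟨e, he⟩ := hL
  have hY : IsForm L (Submodule.span ℂ (Set.range e)) := ⟨e, he, rfl⟩
  have : FiniteDimensional ℂ (Submodule.span ℂ (Set.range e)) :=
    FiniteDimensional.span_of_finite ℂ (Set.finite_range e)
  refine Module.Finite.of_surjective (toFiber L ∘ₗ (Submodule.inclusion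
    (show Submodule.span ℂ (Set.range e) ≤ L.restrictScalars ℂ from fun _ h => hY.mem h)))
    fun d => ?_
  obtain ⟨v, rfl⟩ := toFiber_surjective L d
  obtain ⟨y, hy, w, hw, h⟩ := hY.exists_eq_add hz v.2
  refine ⟨⟨y, hy⟩, ?_⟩
  change toFiber L ⟨y, hY.mem hy⟩ = toFiber L v
  rw [← sub_eq_zero, ← map_sub, toFiber_eq_zero_iff hz, zShift_one]
  refine ⟨-w, L.neg_mem hw, ?_⟩
  change y - (v : V) = _
  rw [h, smul_neg]
  abel

/-- Eigenvalues differing by an integer have the same class in ℂ/ℤ, and each is the value of σ at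
its class, so they coincide. -/
theorem Connection.IsDeligneLattice.isNonresonant {nabla : Connection x V}
    {σ : ℂ ⧸ AddSubgroup.zmultiples (1 : ℂ) → ℂ}
    (hσ : ∀ q, (QuotientAddGroup.mk (σ q) : ℂ ⧸ AddSubgroup.zmultiples (1 : ℂ)) = q)
    {L : Submodule (HolGerm x) V} (h : nabla.IsDeligneLattice σ L) (hz : IsUniformizer z) :
    IsNonresonant (minpoly ℂ (nabla.residue L h.isLogarithmic)) := by
  have := h.isLattice.finiteDimensional_fiber hz
  refine isNonresonant_of_roots fun a ha k hk hak => hk ?_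
  obtain ⟨q, hq⟩ := h.eigenvalue_mem a (Module.End.hasEigenvalue_iff_isRoot.2 ha)
  obtain ⟨q', hq'⟩ := h.eigenvalue_mem (a + k) (Module.End.hasEigenvalue_iff_isRoot.2 hak)
  have h1 : (QuotientAddGroup.mk a : ℂ ⧸ AddSubgroup.zmultiples (1 : ℂ)) =
      QuotientAddGroup.mk (a + k) :=
    QuotientAddGroup.eq.2 ⟨k, by simp⟩
  have h2 : q = q' := by rw [← hσ q, ← hσ q', hq, hq', h1]
  rw [h2, hq', add_eq_left] at hq
  exact_mod_cast hq

/-- Contraction with z d/dz strips off dz/z; the sign convention of `Connection.IsMatrix` makes the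
two constant matrices opposite. -/
theorem Connection.exists_isMatrix_iff (nabla : Connection x V) (hz : IsUniformizer z) {n : ℕ}
    (b : Module.Basis (Fin n) (MerGerm x) V) :
    (∃ A : Matrix (Fin n) (Fin n) ℂ,
      nabla.IsMatrix b (fun i j => algebraMap ℂ (MerGerm x) (A i j) • dlog z)) ↔
    ∃ A : Matrix (Fin n) (Fin n) ℂ, ∀ j, nabla.logOp z (b j) = ∑ i, A i j • b i := by
  constructor
  · rintro ⟨A, hA⟩
    refine ⟨-A, fun j => ?_⟩
    change contract V (coordField z) (nabla.toFun (b j)) = _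
    rw [hA j, map_neg, map_sum, ← Finset.sum_neg_distrib]
    refine Finset.sum_congr rfl fun i _ => ?_
    rw [contract_tmul, LinearMap.smul_apply, hz.dlog_coordField, smul_eq_mul, mul_one,
      algebraMap_complex, Matrix.neg_apply, neg_smul]
  · rintro ⟨A, hA⟩
    refine ⟨-A, fun j => ?_⟩
    rw [nabla.toFun_eq hz, ← nabla.logOp_apply, hA, TensorProduct.sum_tmul,
      ← Finset.sum_neg_distrib]
    refine Finset.sum_congr rfl fun i _ => ?_
    change _ = -(b i ⊗ₜ[MerGerm x] (algebraMap ℂ (MerGerm x) (-A i j) • dlog z))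
    rw [← TensorProduct.smul_tmul, algebraMap_complex, neg_smul, TensorProduct.neg_tmul, neg_neg]

theorem Connection.logOp_mem_span (nabla : Connection x V) {n : ℕ} {b : Fin n → V}
    {A : Matrix (Fin n) (Fin n) ℂ} (hA : ∀ j, nabla.logOp z (b j) = ∑ i, A i j • b i) :
    ∀ y ∈ Submodule.span ℂ (Set.range b), nabla.logOp z y ∈ Submodule.span ℂ (Set.range b) := by
  have : Submodule.span ℂ (Set.range b) ≤
      (Submodule.span ℂ (Set.range b)).comap (nabla.logOp z) := by
    rw [Submodule.span_le]
    rintro _ ⟨j, rfl⟩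
    change nabla.logOp z (b j) ∈ Submodule.span ℂ (Set.range b)
    rw [hA]
    exact Submodule.sum_mem _ fun i _ => Submodule.smul_mem _ _ (Submodule.subset_span ⟨i, rfl⟩)
  exact this

/-- The Birkhoff form of a nonresonant lattice is a form, stable under `∇_{z d/dz}`. -/
theorem Connection.isForm_birkhoffForm {nabla : Connection x V} (hz : IsUniformizer z)
    {L : Submodule (HolGerm x) V} (hlat : IsLattice L) (hL : ∀ v ∈ L, nabla.logOp z v ∈ L)
    {p : Polynomial ℂ} (hpn : IsNonresonant p)
    (hp : ∀ v ∈ L, Polynomial.aeval (nabla.logOp z) p v ∈ zShift z 1 L) :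
    IsForm L (nabla.birkhoffForm z L) ∧
      ∀ y ∈ nabla.birkhoffForm z L, nabla.logOp z y ∈ nabla.birkhoffForm z L := by
  obtain ⟨b, A, hb, hA⟩ := exists_constant_matrix hz hlat hL hpn hp
  have hY : IsForm L (Submodule.span ℂ (Set.range b)) := ⟨b, hb, rfl⟩
  have hst := nabla.logOp_mem_span hA
  -- Any other basis with constant matrix also spans a stable form, which uniqueness places inside
  -- the span of b.
  have heq : nabla.birkhoffForm z L = Submodule.span ℂ (Set.range b) := by
    refine le_antisymm (Submodule.span_le.2 ?_) (Submodule.span_mono fun v hv =>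
      ⟨b, hb, (nabla.exists_isMatrix_iff hz b).2 ⟨A, hA⟩, hv⟩)
    rintro v ⟨b', hb', hA', hv⟩
    obtain ⟨A', hA'⟩ := (nabla.exists_isMatrix_iff hz b').1 hA'
    exact hY.le_of_isNonresonant ⟨b', hb', rfl⟩ hz hL hst (nabla.logOp_mem_span hA') hpn hp
      (Submodule.subset_span hv)
  rw [heq]
  exact ⟨hY, hst⟩

end BirkhoffForm

/-! ### Stable lattices contain their homogeneous components -/

section Splitting

/-- By Bézout some multiple of the product of the other polynomials acts as the identity on w k, and
it kills the remaining terms. Being a polynomial in S, it preserves N. -/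
theorem mem_of_sum_mem_of_pairwise_isCoprime {W ι : Type*} [AddCommGroup W] [Module ℂ W]
    {S : Module.End ℂ W} {N : Submodule ℂ W} (hN : ∀ w ∈ N, S w ∈ N) {s : Finset ι}
    {p : ι → Polynomial ℂ} (hp : ∀ i j, i ≠ j → IsCoprime (p i) (p j)) {w : ι → W}
    (hw : ∀ i, Polynomial.aeval S (p i) (w i) = 0) (hsum : ∑ i ∈ s, w i ∈ N) {k : ι} (hk : k ∈ s) :
    w k ∈ N := by
  classical
  obtain ⟨a, b, hab⟩ : IsCoprime (p k) (∏ i ∈ s.erase k, p i) :=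
    IsCoprime.prod_right fun i hi => hp _ _ (Finset.ne_of_mem_erase hi).symm
  have h1 : ∀ i ∈ s, i ≠ k → Polynomial.aeval S (b * ∏ i ∈ s.erase k, p i) (w i) = 0 := by
    intro i hi hik
    obtain ⟨c, hc⟩ := (Finset.dvd_prod_of_mem p (Finset.mem_erase.2 ⟨hik, hi⟩)).mul_left b
    rw [hc, mul_comm, map_mul, Module.End.mul_apply, hw, map_zero]
  have h2 : Polynomial.aeval S (b * ∏ i ∈ s.erase k, p i) (w k) = w k := by
    have := congrArg (fun q => Polynomial.aeval S q (w k)) hab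
    simp only [map_add (Polynomial.aeval S), LinearMap.add_apply, map_mul (Polynomial.aeval S) a,
      Module.End.mul_apply, hw, map_zero, zero_add, map_one, Module.End.one_apply] at this
    exact this
  have h3 := aeval_mem hN (b * ∏ i ∈ s.erase k, p i) hsum
  rwa [map_sum, Finset.sum_eq_single k h1 fun h => absurd hk h, h2] at h3

/-- Substitute X − k in the coprimality of p and p(X + k − l). -/
theorem IsNonresonant.isCoprime_comp {p : Polynomial ℂ} (hp : IsNonresonant p) {k l : ℤ}
    (hkl : k ≠ l) : IsCoprime (p.comp (Polynomial.X + Polynomial.C ((-k : ℤ) : ℂ)))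
      (p.comp (Polynomial.X + Polynomial.C ((-l : ℤ) : ℂ))) := by
  have h := (hp (k - l) (sub_ne_zero.2 hkl)).map
    (Polynomial.compRingHom (Polynomial.X + Polynomial.C ((-k : ℤ) : ℂ)))
  simp only [Polynomial.coe_compRingHom_apply, Polynomial.comp_assoc, Polynomial.add_comp,
    Polynomial.X_comp, Polynomial.C_comp, add_assoc, ← Polynomial.C_add] at h
  convert! h using 4
  push_cast
  ring_nf

variable {X : Type*} [TopologicalSpace X] [ChartedSpace ℂ X] {x : X} {z : HolGerm x}
  {V : Type*} [AddCommGroup V] [Module (MerGerm x) V] [Module (HolGerm x) V]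
  [IsScalarTower (HolGerm x) (MerGerm x) V] [Module ℂ V] [IsScalarTower ℂ (MerGerm x) V]
  [IsScalarTower ℂ (HolGerm x) V]

theorem aeval_comp_zpow_smul (nabla : Connection x V) (hz : IsUniformizer z) (k : ℤ)
    (p : Polynomial ℂ) (v : V) :
    Polynomial.aeval (nabla.logOp z) (p.comp (Polynomial.X + Polynomial.C ((-k : ℤ) : ℂ)))
      (algebraMap (HolGerm x) (MerGerm x) z ^ k • v) = algebraMap (HolGerm x) (MerGerm x) z ^ k •
          Polynomial.aeval (nabla.logOp z) p v := by
  rw [aeval_logOp_zpow_smul _ hz, Polynomial.comp_assoc]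
  simp

theorem zpow_smul_mem_of_le (hz : IsUniformizer z) {M : Submodule (HolGerm x) V} {k l : ℤ}
    (h : k ≤ l) {v : V} (hv : algebraMap (HolGerm x) (MerGerm x) z ^ k • v ∈ M) : algebraMap
        (HolGerm x) (MerGerm x) z ^ l • v ∈ M := by
  rw [zpow_smul_eq hz h, ← smul_zpow_smul]
  exact M.smul_mem _ hv

theorem IsLattice.exists_zpow_smul_mem {M : Submodule (HolGerm x) V} (hM : IsLattice M)
    (hz : IsUniformizer z) (v : V) : ∃ n : ℕ, algebraMap (HolGerm x) (MerGerm x) z ^ (n : ℤ) • v ∈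
        M := by
  obtain ⟨b, rfl⟩ := hM
  choose n a h using fun i => hz.exists_pow_mul_eq (b.repr v i)
  refine ⟨∑ i, n i, (b.mem_span_iff_repr_mem (HolGerm x) _).2 fun i => ?_⟩
  obtain ⟨m, hm⟩ := Nat.exists_eq_add_of_le' (Finset.single_le_sum (f := n)
    (fun _ _ => Nat.zero_le _) (Finset.mem_univ i))
  refine ⟨z ^ m * a i, ?_⟩
  rw [map_smul, Finsupp.smul_apply, hm, zpow_natCast, pow_add, smul_eq_mul, mul_assoc, h, map_mul,
    map_pow]

theorem IsLattice.exists_zShift_le {L M : Submodule (HolGerm x) V} (hL : IsLattice L)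
    (hM : IsLattice M) (hz : IsUniformizer z) : ∃ n : ℕ, zShift z n L ≤ M := by
  obtain ⟨b, rfl⟩ := hL
  choose n hn using fun i => hM.exists_zpow_smul_mem hz (b i)
  refine ⟨∑ i, n i, ?_⟩
  rintro _ ⟨v, hv, rfl⟩
  induction hv using Submodule.span_induction with
  | mem v hv =>
    obtain ⟨i, rfl⟩ := hv
    have hle : n i ≤ ∑ i, n i :=
      Finset.single_le_sum (f := n) (fun _ _ => Nat.zero_le _) (Finset.mem_univ i)
    exact zpow_smul_mem_of_le hz (Int.ofNat_le.2 hle) (hn i)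
  | zero => rw [smul_zero]; exact M.zero_mem
  | add v w _ _ hv hw => rw [smul_add]; exact M.add_mem hv hw
  | smul a v _ hv => rw [← smul_zpow_smul]; exact M.smul_mem a hv

theorem IsLattice.exists_le_zShift {L M : Submodule (HolGerm x) V} (hL : IsLattice L)
    (hM : IsLattice M) (hz : IsUniformizer z) : ∃ n : ℕ, M ≤ zShift z (-n) L := by
  obtain ⟨n, hn⟩ := hM.exists_zShift_le hL hz
  refine ⟨n, fun v hv => ⟨algebraMap (HolGerm x) (MerGerm x) z ^ (n : ℤ) • v, hn
      (zpow_smul_mem_zShift hv), ?_⟩⟩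
  rw [smul_smul, ← zpow_add₀ hz.algebraMap_ne_zero, neg_add_cancel, zpow_zero, one_smul]

/-- The subspace of the elements `y` of `Y` with `zᵐ y ∈ M`. -/
def level (z : HolGerm x) (Y : Submodule ℂ V) (M : Submodule (HolGerm x) V) (m : ℤ) :
    Submodule ℂ Y :=
  ((M.restrictScalars ℂ).comap (Algebra.lsmul ℂ ℂ V (algebraMap (HolGerm x)
      (MerGerm x) z ^ m))).comap Y.subtype

theorem mem_level {Y : Submodule ℂ V} {M : Submodule (HolGerm x) V} {m : ℤ} {y : Y} :
    y ∈ level z Y M m ↔ algebraMap (HolGerm x) (MerGerm x) z ^ m • (y : V) ∈ M := Iff.rfl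

theorem level_mono (hz : IsUniformizer z) (Y : Submodule ℂ V) (M : Submodule (HolGerm x) V) :
    Monotone (level z Y M) := fun _ _ h _ hy => zpow_smul_mem_of_le hz h hy

/-- Truncated Laurent expansion with coefficients in Y, obtained by iterating L = Y + zL on the
remainder. -/
theorem IsForm.exists_expansion {L : Submodule (HolGerm x) V} {Y : Submodule ℂ V} (h : IsForm L Y)
    (hz : IsUniformizer z) {k : ℤ} {v : V} (hv : v ∈ zShift z k L) (n : ℕ) :
    ∃ y : ℕ → V, (∀ i, y i ∈ Y) ∧
      v - ∑ i ∈ Finset.range n, algebraMap (HolGerm x) (MerGerm x) z ^ (k + i) • y i ∈ zShift z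
          (k + n) L := by
  induction n with
  | zero => exact ⟨0, fun _ => Y.zero_mem, by simpa using hv⟩
  | succ n ih =>
    obtain ⟨y, hy, w, hw, hwv⟩ := ih
    obtain ⟨y', hy', w', hw', rfl⟩ := h.exists_eq_add hz hw
    refine ⟨Function.update y n y', fun i => ?_, w', hw', ?_⟩
    · rcases eq_or_ne i n with rfl | hi
      · rwa [Function.update_self]
      · rw [Function.update_of_ne hi]; exact hy i
    · rw [Finset.sum_range_succ, Function.update_self, Finset.sum_congr rfl (g := fun i : ℕ =>
        algebraMap (HolGerm x) (MerGerm x) z ^ (k + i) • y i) (fun i hi => by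
          rw [Function.update_of_ne (Finset.mem_range.1 hi).ne]), ← sub_sub, ← hwv, smul_add,
        add_sub_cancel_left, Nat.cast_succ, ← add_assoc, zpow_add_one₀ hz.algebraMap_ne_zero,
        mul_smul, algebraMap_smul]

theorem IsForm.eq_span {L : Submodule (HolGerm x) V} {Y : Submodule ℂ V} (h : IsForm L Y) :
    L = Submodule.span (HolGerm x) Y := by
  refine le_antisymm ?_ (Submodule.span_le.2 fun y hy => h.mem hy)
  obtain ⟨b, rfl, rfl⟩ := h
  exact Submodule.span_mono Submodule.subset_span

/-- A stable lattice is generated by its homogeneous elements `zᵐ y`. -/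
theorem IsForm.eq_span_level {nabla : Connection x V} {L M : Submodule (HolGerm x) V}
    {Y : Submodule ℂ V} (h : IsForm L Y) (hz : IsUniformizer z)
    {p : Polynomial ℂ} (hpn : IsNonresonant p)
    (hp : ∀ y ∈ Y, Polynomial.aeval (nabla.logOp z) p y = 0)
    (hlat : IsLattice M) (hM : ∀ v ∈ M, nabla.logOp z v ∈ M) :
    M = Submodule.span (HolGerm x) {w | ∃ m : ℤ, ∃ y ∈ level z Y M m, w = algebraMap (HolGerm x)
        (MerGerm x) z ^ m • (y : V)} := by
  refine le_antisymm (fun v hv => ?_) (Submodule.span_le.2 ?_)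
  swap
  · rintro _ ⟨m, y, hy, rfl⟩
    exact hy
  obtain ⟨n, hn⟩ := h.isLattice.exists_zShift_le hlat hz
  obtain ⟨n', hn'⟩ := h.isLattice.exists_le_zShift hlat hz
  have hgen : zShift z n L ≤ Submodule.span (HolGerm x)
      {w | ∃ m : ℤ, ∃ y ∈ level z Y M m, w = algebraMap (HolGerm x) (MerGerm x) z ^ m • (y :
          V)} := by
    rintro _ ⟨w, hw, rfl⟩
    rw [h.eq_span] at hw
    induction hw using Submodule.span_induction with
    | mem y hy =>
      exact Submodule.subset_span ⟨n, ⟨y, hy⟩, hn (zpow_smul_mem_zShift (h.mem hy)), rfl⟩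
    | zero => rw [smul_zero]; exact Submodule.zero_mem _
    | add v w _ _ hv hw => rw [smul_add]; exact Submodule.add_mem _ hv hw
    | smul a v _ hv => rw [← smul_zpow_smul]; exact Submodule.smul_mem _ a hv
  -- Starting at degree −n', after n' + n terms the remainder lies in zⁿL, hence in M. The finite
  -- sum is then in M as well and can be split.
  obtain ⟨y, hy, hr⟩ := h.exists_expansion hz (hn' hv) (n' + n)
  have hr' := hr
  rw [Nat.cast_add, neg_add_cancel_left] at hr
  have hsum : ∑ i ∈ Finset.range (n' + n), algebraMap (HolGerm x) (MerGerm x) z ^ (-(n' :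
      ℤ) + i) • y i ∈ M.restrictScalars ℂ := by
    have := M.sub_mem hv (hn hr)
    rwa [sub_sub_cancel] at this
  have hmem : ∀ i ∈ Finset.range (n' + n), algebraMap (HolGerm x) (MerGerm x) z ^ (-(n' :
      ℤ) + i) • y i ∈ M := fun i hi =>
    mem_of_sum_mem_of_pairwise_isCoprime (N := M.restrictScalars ℂ) hM
      (p := fun i : ℕ => p.comp (Polynomial.X + Polynomial.C ((-(-(n' : ℤ) + i) : ℤ) : ℂ)))
      (fun i j hij => hpn.isCoprime_comp (by simpa using hij))
      (fun i => by rw [aeval_comp_zpow_smul _ hz, hp _ (hy i), smul_zero]) hsum hi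
  rw [← sub_add_cancel v (∑ i ∈ Finset.range (n' + n), algebraMap (HolGerm x)
      (MerGerm x) z ^ (-(n' : ℤ) + i) • y i)]
  exact Submodule.add_mem _ (hgen hr) (Submodule.sum_mem _ fun i hi =>
    Submodule.subset_span ⟨-(n' : ℤ) + i, ⟨y i, hy i⟩, hmem i hi, rfl⟩)

end Splitting

/-! ### Flags, adapted bases and filtrations -/

section Flags

variable {W : Type*} [AddCommGroup W] [Module ℂ W]

/-- A finite chain has only one increasing enumeration; the common cardinality gives equal lengths.
-/
theorem LTSeries_eq_of_range_eq {α : Type*} [PartialOrder α] {F G : LTSeries α}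
    (h : Set.range F = Set.range G) : F = G := by
  classical
  have hc : F.length + 1 = G.length + 1 := by
    rw [← Fintype.card_fin (F.length + 1), ← Fintype.card_fin (G.length + 1),
      ← Set.card_range_of_injective F.strictMono.injective,
      ← Set.card_range_of_injective G.strictMono.injective]
    exact Fintype.card_congr (Equiv.setCongr h)
  have hm : StrictMono (G ∘ Fin.cast hc) := G.strictMono.comp fun _ _ h => h
  refine RelSeries.ext (Nat.succ_injective hc) ((F.strictMono.range_inj hm).1 ?_)
  exact h.trans ((finCongr hc).surjective.range_comp G).symm

/-- Append a basis of a complement of G in H, which the modular law cuts out of a complement in W.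
Sequences are indexed by ℕ so that induction along the flag keeps one type; the terms past dim H are
irrelevant. -/
theorem exists_extend_span [FiniteDimensional ℂ W] {G H : Submodule ℂ W} (hGH : G ≤ H) (e : ℕ → W)
    (he : Submodule.span ℂ (e '' Set.Iio (Module.finrank ℂ G)) = G) :
    ∃ e' : ℕ → W, Set.EqOn e' e (Set.Iio (Module.finrank ℂ G)) ∧
      Submodule.span ℂ (e' '' Set.Iio (Module.finrank ℂ H)) = H := by
  obtain ⟨C₀, hC₀⟩ := G.exists_isCompl
  set C := C₀ ⊓ H with hC
  have hsup : G ⊔ C = H := by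
    rw [hC, ← sup_inf_assoc_of_le _ hGH, hC₀.sup_eq_top, top_inf_eq]
  have hdim : Module.finrank ℂ H = Module.finrank ℂ G + Module.finrank ℂ C := by
    have := Submodule.finrank_sup_add_finrank_inf_eq G C
    rwa [hsup, hC, ← inf_assoc, hC₀.inf_eq_bot, bot_inf_eq, finrank_bot, add_zero] at this
  set c := Module.finBasis ℂ C
  set e' : ℕ → W := fun i => if i < Module.finrank ℂ G then e i else
    if h : i - Module.finrank ℂ G < Module.finrank ℂ C then c ⟨_, h⟩ else 0 with he'
  have heq : Set.EqOn e' e (Set.Iio (Module.finrank ℂ G)) := fun i hi => if_pos hi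
  refine ⟨e', heq, le_antisymm ?_ ?_⟩
  · rw [Submodule.span_le]
    rintro _ ⟨i, hi, rfl⟩
    by_cases hi' : i < Module.finrank ℂ G
    · rw [heq hi']
      exact hGH (he ▸ Submodule.subset_span ⟨i, hi', rfl⟩)
    · have h1 : i - Module.finrank ℂ G < Module.finrank ℂ C := by
        rw [Set.mem_Iio] at hi; omega
      rw [he']
      simp only [if_neg hi', dif_pos h1]
      exact (c ⟨_, h1⟩).2.2
  · conv_lhs => rw [← hsup]
    refine sup_le ?_ ?_
    · conv_lhs => rw [← he]
      rw [← heq.image_eq]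
      exact Submodule.span_mono (Set.image_mono (Set.Iio_subset_Iio (by omega)))
    · intro w hw
      have h1 := congrArg (Submodule.map C.subtype) c.span_eq
      rw [Submodule.map_span, Submodule.map_top, Submodule.range_subtype] at h1
      rw [← h1] at hw
      refine Submodule.span_mono ?_ hw
      rintro _ ⟨_, ⟨i, rfl⟩, rfl⟩
      refine ⟨Module.finrank ℂ G + i, ?_, ?_⟩
      · rw [Set.mem_Iio, hdim]; omega
      · rw [he']
        simp

/-- A basis adapted to a flag. -/
theorem IsFlag.exists_basis [FiniteDimensional ℂ W] {F : LTSeries (Submodule ℂ W)} (hF : IsFlag F)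
    {n : ℕ} (hn : n = Module.finrank ℂ W) : ∃ e : Module.Basis (Fin n) ℂ W,
      ∀ j, F j = Submodule.span ℂ (e '' {i | (i : ℕ) < Module.finrank ℂ (F j)}) := by
  have key : ∀ j, ∃ e : ℕ → W, ∀ j' ≤ j,
      Submodule.span ℂ (e '' Set.Iio (Module.finrank ℂ (F j'))) = F j' := by
    intro j
    induction j using Fin.induction with
    | zero =>
      refine ⟨0, fun j' hj' => ?_⟩
      have h0 : F j' = ⊥ := by rw [Fin.le_zero_iff.1 hj']; exact hF.1
      rw [h0, finrank_bot]
      simp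
    | succ j ih =>
      obtain ⟨e, he⟩ := ih
      obtain ⟨e', h1, h2⟩ := exists_extend_span (F.monotone (Fin.castSucc_lt_succ (i := j)).le) e
        (he _ le_rfl)
      refine ⟨e', fun j' hj' => ?_⟩
      rcases hj'.eq_or_lt with rfl | hj'
      · exact h2
      · have hj'' : j' ≤ j.castSucc := Fin.le_castSucc_iff.2 hj'
        rw [(h1.mono (Set.Iio_subset_Iio (Submodule.finrank_mono (F.monotone hj'')))).image_eq]
        exact he _ hj''
  obtain ⟨e, he⟩ := key (Fin.last _)
  have himg : ∀ j, F j = Submodule.span ℂ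
      ((fun i : Fin n => e i) '' {i | (i : ℕ) < Module.finrank ℂ (F j)}) := by
    intro j
    refine (he j (Fin.le_last j)).symm.trans ?_
    congr 1
    ext w
    constructor
    · rintro ⟨i, hi, rfl⟩
      have hi' : i < Module.finrank ℂ (F j) := hi
      refine ⟨⟨i, ?_⟩, hi, rfl⟩
      rw [hn]
      exact hi'.trans_le (Submodule.finrank_le _)
    · rintro ⟨i, hi, rfl⟩
      exact ⟨i, hi, rfl⟩
  have htop : ⊤ ≤ Submodule.span ℂ (Set.range fun i : Fin n => e i) := by
    rw [← hF.2, ← F.apply_last, himg (Fin.last _)]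
    exact Submodule.span_mono (Set.image_subset_range _ _)
  refine ⟨basisOfTopLeSpanOfCardEqFinrank _ htop (by rw [Fintype.card_fin, hn]), fun j => ?_⟩
  rw [coe_basisOfTopLeSpanOfCardEqFinrank]
  exact himg j

variable {n : ℕ} {F : LTSeries (Submodule ℂ W)} {k : Fin n → ℤ}

theorem flagBlock_unique [FiniteDimensional ℂ W] {i : Fin n} {j j' : Fin F.length}
    (h : i ∈ flagBlock n F j) (h' : i ∈ flagBlock n F j') : j = j' := by
  by_contra hne
  wlog hlt : j < j' generalizing j j'
  · exact this h' h (Ne.symm hne) (lt_of_le_of_ne (not_lt.1 hlt) (Ne.symm hne))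
  have := Submodule.finrank_mono (F.monotone (Fin.succ_le_castSucc_iff.2 hlt))
  exact absurd (h.2.trans_le this) (not_lt.2 h'.1)

theorem IsFlag.exists_mem_flagBlock (hF : IsFlag F) (hn : n = Module.finrank ℂ W) (i : Fin n) :
    ∃ j, i ∈ flagBlock n F j := by
  have key : ∀ j, (i : ℕ) < Module.finrank ℂ (F j) → ∃ j, i ∈ flagBlock n F j := by
    intro j
    induction j using Fin.induction with
    | zero =>
      intro h
      rw [F.apply_zero, hF.1, finrank_bot] at h
      exact absurd h (Nat.not_lt_zero _)
    | succ j ih =>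
      intro h
      by_cases h' : (i : ℕ) < Module.finrank ℂ (F j.castSucc)
      · exact ih h'
      · exact ⟨j, not_lt.1 h', h⟩
  refine key (Fin.last _) ?_
  rw [F.apply_last, hF.2, finrank_top, ← hn]
  exact i.2

/-- Strict inclusion raises the dimension. Each exponent κⱼ is thus attained by some index, so each
step of the flag contributes generators to the twist. -/
theorem flagBlock_nonempty [FiniteDimensional ℂ W] (hn : n = Module.finrank ℂ W)
    (j : Fin F.length) : (flagBlock n F j).Nonempty := by
  have h := Submodule.finrank_lt_finrank_of_lt (F.strictMono (Fin.castSucc_lt_succ (i := j)))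
  exact ⟨⟨_, h.trans_le ((Submodule.finrank_le _).trans hn.ge)⟩, le_rfl, h⟩

/-- The members of a flag are the sets on which `k` takes the smallest values. -/
theorem IsFlag.lt_finrank_iff [FiniteDimensional ℂ W] (hF : IsFlag F)
    (hn : n = Module.finrank ℂ W) {κ : Fin F.length → ℤ} (hκ : StrictMono κ)
    (hk : ∀ j, ∀ i ∈ flagBlock n F j, k i = κ j) (i : Fin n) (j : Fin F.length) :
    (i : ℕ) < Module.finrank ℂ (F j.succ) ↔ k i ≤ κ j := by
  obtain ⟨j', hj'⟩ := hF.exists_mem_flagBlock hn i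
  rw [hk j' i hj', hκ.le_iff_le]
  constructor
  · intro h
    by_contra hlt
    have := Submodule.finrank_mono (F.monotone (Fin.succ_le_castSucc_iff.2 (not_le.1 hlt)))
    exact absurd (h.trans_le this) (not_lt.2 hj'.1)
  · intro h
    exact hj'.2.trans_le (Submodule.finrank_mono (F.monotone (Fin.succ_le_succ_iff.2 h)))

theorem IsFlag.monotone_of_isAdmissible [FiniteDimensional ℂ W] (hF : IsFlag F)
    (hn : n = Module.finrank ℂ W) (hk : IsAdmissible F k) : Monotone k := by
  obtain ⟨κ, hκ, hk⟩ := hk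
  intro i i' h
  obtain ⟨j, hj⟩ := hF.exists_mem_flagBlock hn i'
  rw [hk j i' hj]
  exact (hF.lt_finrank_iff hn hκ hk i j).1 (lt_of_le_of_lt h hj.2)

/-- Every sublevel set of an admissible sequence is given by a member of the flag. -/
theorem IsFlag.exists_le_iff [FiniteDimensional ℂ W] (hF : IsFlag F)
    (hn : n = Module.finrank ℂ W) (hk : IsAdmissible F k) (m : ℤ) :
    ∃ j, ∀ i : Fin n, k i ≤ m ↔ (i : ℕ) < Module.finrank ℂ (F j) := by
  obtain ⟨κ, hκ, hk⟩ := hk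
  by_cases h : ∃ j, κ j ≤ m
  · obtain ⟨j, hj, hmax⟩ := (Finset.univ.filter fun j => κ j ≤ m).exists_max_image id
      (h.imp fun j hj => Finset.mem_filter.2 ⟨Finset.mem_univ _, hj⟩)
    rw [Finset.mem_filter] at hj
    refine ⟨j.succ, fun i => ?_⟩
    rw [hF.lt_finrank_iff hn hκ hk]
    refine ⟨fun hi => ?_, fun hi => hi.trans hj.2⟩
    obtain ⟨j', hj'⟩ := hF.exists_mem_flagBlock hn i
    rw [hk j' i hj'] at hi ⊢
    exact hκ.monotone (hmax j' (Finset.mem_filter.2 ⟨Finset.mem_univ _, hi⟩))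
  · refine ⟨0, fun i => ?_⟩
    rw [F.apply_zero, hF.1, finrank_bot]
    refine ⟨fun hi => ?_, fun hi => absurd hi (Nat.not_lt_zero _)⟩
    obtain ⟨j', hj'⟩ := hF.exists_mem_flagBlock hn i
    rw [hk j' i hj'] at hi
    exact absurd ⟨j', hi⟩ h

/-- Every member of a flag is given by a sublevel set of an admissible sequence. -/
theorem IsFlag.exists_le_iff' [FiniteDimensional ℂ W] (hF : IsFlag F)
    (hn : n = Module.finrank ℂ W) (hk : IsAdmissible F k) (j : Fin (F.length + 1)) :
    ∃ m : ℤ, ∀ i : Fin n, k i ≤ m ↔ (i : ℕ) < Module.finrank ℂ (F j) := by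
  obtain ⟨κ, hκ, hk⟩ := hk
  refine Fin.cases ?_ (fun j => ?_) j
  · obtain ⟨m, hm⟩ := (Set.finite_range k).bddBelow
    -- An integer strictly below all exponents gives the zero member of the flag.
    refine ⟨m - 1, fun i => ?_⟩
    have h1 : m ≤ k i := hm ⟨i, rfl⟩
    rw [F.apply_zero, hF.1, finrank_bot]
    refine ⟨fun hi => by omega, fun hi => absurd hi (Nat.not_lt_zero _)⟩
  · exact ⟨κ j, fun i => (hF.lt_finrank_iff hn hκ hk i j).symm⟩

/-- The flag of the values of an exhaustive and separated filtration. -/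
theorem exists_flag_of_filtration {Φ : ℤ → Submodule ℂ W} (hΦ : Monotone Φ) {a b : ℤ}
    (ha : ∀ m ≤ a, Φ m = ⊥) (hb : ∀ m, b ≤ m → Φ m = ⊤) :
    ∃ F : LTSeries (Submodule ℂ W), IsFlag F ∧ ∃ κ : Fin F.length → ℤ, StrictMono κ ∧
      (∀ j, F j.succ = Φ (κ j)) ∧ ∀ m, Φ m = ⊥ ∨ ∃ j, κ j ≤ m ∧ Φ m = Φ (κ j) := by
  -- The jumps of the filtration. They lie in [a, b], and enumerating them increasingly gives the
  -- κⱼ; between jumps Φ is constant.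
  set J : Set ℤ := {m | Φ (m - 1) < Φ m} with hJ
  have hfin : J.Finite := (Set.finite_Icc a b).subset fun m hm => by
    constructor
    · by_contra h
      refine (show Φ (m - 1) < Φ m from hm).ne ?_
      rw [ha _ (by omega), ha _ (by omega)]
    · by_contra h
      refine (show Φ (m - 1) < Φ m from hm).ne ?_
      rw [hb _ (by omega), hb _ (by omega)]
  set κ := hfin.toFinset.orderEmbOfFin rfl with hκ
  have hκJ : ∀ j, Φ (κ j - 1) < Φ (κ j) := fun j =>
    hfin.mem_toFinset.1 (Finset.orderEmbOfFin_mem hfin.toFinset rfl j)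
  have hvalues : ∀ m, Φ m = ⊥ ∨ ∃ j, κ j ≤ m ∧ Φ m = Φ (κ j) := by
    intro m
    rcases le_total m a with h | h
    · exact Or.inl (ha m h)
    induction m, h using Int.leInduction with
    | base => exact Or.inl (ha a le_rfl)
    | succ m hm ih =>
      rcases (hΦ (Int.le_add_one (le_refl m))).eq_or_lt with h | h
      · rw [← h]
        exact ih.imp_right fun ⟨j, hj, hj'⟩ => ⟨j, by omega, hj'⟩
      · right
        have hmem : m + 1 ∈ Set.range κ := by
          rw [hκ, Finset.range_orderEmbOfFin, Finset.mem_coe, hfin.mem_toFinset]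
          change Φ (m + 1 - 1) < Φ (m + 1)
          rwa [add_sub_cancel_right]
        obtain ⟨j, hj⟩ := hmem
        exact ⟨j, hj.le, by rw [hj]⟩
  let F : LTSeries (Submodule ℂ W) :=
    { length := hfin.toFinset.card
      toFun := Fin.cons ⊥ (Φ ∘ κ)
      step := fun i => by
        change (Fin.cons ⊥ (Φ ∘ κ) : Fin (hfin.toFinset.card + 1) → Submodule ℂ W) i.castSucc <
          (Fin.cons ⊥ (Φ ∘ κ) : Fin (hfin.toFinset.card + 1) → Submodule ℂ W) i.succ
        rw [Fin.cons_succ]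
        refine lt_of_le_of_lt ?_ (hκJ i)
        rcases Fin.eq_zero_or_eq_succ i.castSucc with h | ⟨j, h⟩
        · rw [h, Fin.cons_zero]; exact bot_le
        · rw [h, Fin.cons_succ]
          refine hΦ ?_
          -- Since κ j ≤ κ i − 1, the strict jump just before κ i makes the chain strictly
          -- increasing.
          have : j < i := by
            rw [← Fin.succ_le_castSucc_iff, h]
          have := κ.strictMono this
          omega }
  have hFs : ∀ j : Fin F.length, F j.succ = Φ (κ j) := fun j => rfl
  refine ⟨F, ⟨rfl, top_unique ?_⟩, κ, κ.strictMono, hFs, hvalues⟩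
  rcases hvalues b with h | ⟨j, -, h⟩
  · rw [← hb b le_rfl, h]; exact bot_le
  · rw [← hb b le_rfl, h, ← hFs j, ← F.apply_last]
    exact F.monotone (Fin.le_last _)

end Flags

/-! ### Twists, levels and induced flags in an adapted basis -/

section Twist

variable {X : Type*} [TopologicalSpace X] [ChartedSpace ℂ X] {x : X} {z : HolGerm x}
  {V : Type*} [AddCommGroup V] [Module (MerGerm x) V] [Module (HolGerm x) V]
  [IsScalarTower (HolGerm x) (MerGerm x) V] [Module ℂ V] [IsScalarTower ℂ (MerGerm x) V]
  [IsScalarTower ℂ (HolGerm x) V]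

theorem IsForm.finrank_eq {L : Submodule (HolGerm x) V} {Y : Submodule ℂ V} (h : IsForm L Y) :
    Module.finrank (MerGerm x) V = Module.finrank ℂ Y := by
  obtain ⟨b, -, rfl⟩ := h
  have : LinearIndependent ℂ b := Fintype.linearIndependent_iff.2 fun c hc i =>
    congrFun (complex_smul_sum_eq_zero b hc) i
  rw [finrank_span_eq_card this, Fintype.card_fin]

theorem IsForm.finiteDimensional {L : Submodule (HolGerm x) V} {Y : Submodule ℂ V}
    (h : IsForm L Y) : FiniteDimensional ℂ Y := by
  obtain ⟨b, -, rfl⟩ := h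
  exact FiniteDimensional.span_of_finite ℂ (Set.finite_range b)

/-- Every complex basis of a form is a basis of the lattice. -/
theorem IsForm.exists_basis {L : Submodule (HolGerm x) V} {Y : Submodule ℂ V} (h : IsForm L Y)
    (e : Module.Basis (Fin (Module.finrank (MerGerm x) V)) ℂ Y) :
    ∃ b : Module.Basis (Fin (Module.finrank (MerGerm x) V)) (MerGerm x) V,
      L = Submodule.span (HolGerm x) (Set.range b) ∧ Y = Submodule.span ℂ (Set.range b) ∧
      ∀ i, b i = e i := by
  have hY : Y = Submodule.span ℂ (Set.range fun i => (e i : V)) := by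
    have h1 := congrArg (Submodule.map Y.subtype) e.span_eq
    rw [Submodule.map_span, Submodule.map_top, Submodule.range_subtype, ← Set.range_comp] at h1
    exact h1.symm
  have hL : L = Submodule.span (HolGerm x) (Set.range fun i => (e i : V)) := by
    rw [h.eq_span]
    refine le_antisymm (Submodule.span_le.2 ?_) (Submodule.span_mono ?_)
    · have : Submodule.span ℂ (Set.range fun i => (e i : V)) ≤
          (Submodule.span (HolGerm x) (Set.range fun i => (e i : V))).restrictScalars ℂ :=
        Submodule.span_le.2 Submodule.subset_span
      rwa [← hY] at this
    · rintro _ ⟨i, rfl⟩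
      exact (e i).2
  obtain ⟨b, hb⟩ := h.isLattice.exists_basis hL
  exact ⟨b, by rw [hb, ← hL], by rw [hb, ← hY], fun i => congrFun hb i⟩

theorem mem_span_zpow_smul_iff (hz : IsUniformizer z) {n : ℕ}
    (b : Module.Basis (Fin n) (MerGerm x) V) (k : Fin n → ℤ) {v : V} :
    v ∈ Submodule.span (HolGerm x) (Set.range fun i => algebraMap (HolGerm x)
        (MerGerm x) z ^ k i • b i) ↔
      ∀ i, ∃ a, b.repr v i = algebraMap (HolGerm x) (MerGerm x) z ^ k i * algebraMap (HolGerm x)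
          (MerGerm x) a := by
  have h0 : ∀ i, algebraMap (HolGerm x) (MerGerm x) z ^ k i ≠ 0 := fun i =>
      zpow_ne_zero _ hz.algebraMap_ne_zero
  have h1 : (fun i => algebraMap (HolGerm x) (MerGerm x) z ^ k i • b i) = b.unitsSMul fun i =>
      Units.mk0 _ (h0 i) := by
    funext i
    rw [Module.Basis.unitsSMul_apply]
    rfl
  rw [h1, Module.Basis.mem_span_iff_repr_mem]
  refine forall_congr' fun i => exists_congr fun a => ?_
  rw [Module.Basis.repr_unitsSMul, Units.smul_def, Units.val_inv_eq_inv_val, Units.val_mk0,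
    smul_eq_mul, eq_inv_mul_iff_mul_eq₀ (h0 i), eq_comm]

theorem isLattice_span_zpow_smul (hz : IsUniformizer z)
    (b : Module.Basis (Fin (Module.finrank (MerGerm x) V)) (MerGerm x) V)
    (k : Fin (Module.finrank (MerGerm x) V) → ℤ) :
    IsLattice (Submodule.span (HolGerm x) (Set.range fun i => algebraMap (HolGerm x)
        (MerGerm x) z ^ k i • b i)) := by
  refine ⟨b.unitsSMul fun i => Units.mk0 _ (zpow_ne_zero (k i) hz.algebraMap_ne_zero), ?_⟩
  congr 2
  funext i
  rw [Module.Basis.unitsSMul_apply]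
  rfl

/-- Dividing by zᵐ leaves a = zᵏ⁻ᵐc with k − m ≥ 1. It detects which coordinates of zᵐv may have a
nonzero leading coefficient when zᵐv lies in M. -/
theorem evalGerm_eq_zero_of_zpow (hz : IsUniformizer z) {m k : ℤ} (h : m < k) {a c : HolGerm x}
    (hac : algebraMap (HolGerm x) (MerGerm x) z ^ m * algebraMap (HolGerm x) (MerGerm x) a =
      algebraMap (HolGerm x) (MerGerm x) z ^ k * algebraMap (HolGerm x) (MerGerm x) c) :
          evalGerm x a = 0 := by
  have h1 := zpow_smul_eq hz (Int.add_one_le_iff.2 h) (algebraMap (HolGerm x) (MerGerm x) c)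
  rw [smul_eq_mul, smul_eq_mul, ← hac, zpow_add_one₀ hz.algebraMap_ne_zero, mul_assoc,
    Algebra.smul_def, ← map_mul, ← map_mul] at h1
  have h2 := mul_left_cancel₀ (zpow_ne_zero m hz.algebraMap_ne_zero) h1
  rw [IsFractionRing.injective (HolGerm x) (MerGerm x) h2, map_mul, hz.evalGerm_eq_zero, zero_mul]

theorem reduction_mono {L : Submodule (HolGerm x) V} {U U' : Submodule ℂ V} (h : U ≤ U') :
    reduction L U ≤ reduction L U' :=
  Submodule.map_mono (Submodule.comap_mono h)

theorem mem_reduction {L : Submodule (HolGerm x) V} {U : Submodule ℂ V} {d : Fiber L} :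
    d ∈ reduction L U ↔ ∃ v : L, (v : V) ∈ U ∧ toFiber L v = d := Iff.rfl

/-- The flag induced by the span of the `z ^ kᵢ • bᵢ` in the fibre comes from its levels. -/
theorem relativeFlag_eq (hz : IsUniformizer z) {L M : Submodule (HolGerm x) V} {Y : Submodule ℂ V}
    {b : Module.Basis (Fin (Module.finrank (MerGerm x) V)) (MerGerm x) V}
    (hL : L = Submodule.span (HolGerm x) (Set.range b)) (hY : Y = Submodule.span ℂ (Set.range b))
    {k : Fin (Module.finrank (MerGerm x) V) → ℤ}
    (hM : M = Submodule.span (HolGerm x) (Set.range fun i => algebraMap (HolGerm x)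
        (MerGerm x) z ^ k i • b i)) (m : ℤ) :
    relativeFlag z L M m = reduction L ((level z Y M m).map Y.subtype) := by
  refine le_antisymm ?_ (reduction_mono ?_)
  swap
  · rintro _ ⟨y, hy, rfl⟩
    exact hy
  rintro d hd
  obtain ⟨v, hv, rfl⟩ := mem_reduction.1 hd
  have hv' : algebraMap (HolGerm x) (MerGerm x) z ^ m • (v : V) ∈ M := hv
  have hvL : (v : V) ∈ Submodule.span (HolGerm x) (Set.range b) := hL ▸ v.2
  choose a ha using (b.mem_span_iff_repr_mem (HolGerm x) _).1 hvL
  -- The component of v in Y modulo zL, having the same image in the fibre. A nonzero constant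
  -- coefficient at i forces k i ≤ m, so zᵐy is again in M.
  set y : V := ∑ i, evalGerm x (a i) • b i with hy
  have hbY : ∀ i, b i ∈ Y := fun i => hY ▸ Submodule.subset_span ⟨i, rfl⟩
  have hbL : ∀ i, b i ∈ L := fun i => hL ▸ Submodule.subset_span ⟨i, rfl⟩
  have hyY : y ∈ Y := Submodule.sum_mem _ fun i _ => Submodule.smul_mem _ _ (hbY i)
  have hyL : y ∈ L := Submodule.sum_mem L fun i _ => (L.restrictScalars ℂ).smul_mem _ (hbL i)
  refine mem_reduction.2 ⟨⟨y, hyL⟩, ⟨⟨y, hyY⟩, ?_, rfl⟩, ?_⟩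
  · change algebraMap (HolGerm x) (MerGerm x) z ^ m • y ∈ M
    rw [hy, Finset.smul_sum]
    refine Submodule.sum_mem _ fun i _ => ?_
    by_cases hi : evalGerm x (a i) = 0
    · rw [hi, zero_smul, smul_zero]; exact M.zero_mem
    · have hki : k i ≤ m := by
        by_contra hlt
        rw [hM, mem_span_zpow_smul_iff hz] at hv'
        obtain ⟨c, hc⟩ := hv' i
        rw [map_smul, Finsupp.smul_apply, ← ha, smul_eq_mul] at hc
        exact hi (evalGerm_eq_zero_of_zpow hz (not_le.1 hlt) hc)
      rw [← complex_smul_zpow_smul]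
      refine (M.restrictScalars ℂ).smul_mem _ (zpow_smul_mem_of_le hz hki ?_)
      rw [hM]
      exact Submodule.subset_span ⟨i, rfl⟩
  · rw [← sub_eq_zero, ← map_sub, toFiber_eq_zero_iff hz]
    choose a' ha' using fun i => hz.exists_eq_add (a i)
    rw [zShift_one]
    refine ⟨-∑ i, a' i • b i, L.neg_mem (L.sum_mem fun i _ => L.smul_mem _ (hbL i)), ?_⟩
    change y - (v : V) = _
    rw [smul_neg, ← neg_sub, neg_inj, sub_eq_iff_eq_add, ← b.sum_repr (v : V), hy, Finset.smul_sum,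
      ← Finset.sum_add_distrib]
    refine Finset.sum_congr rfl fun i _ => ?_
    rw [← ha, algebraMap_smul]
    conv_lhs => rw [ha']
    rw [add_smul, algebraMap_smul, mul_smul, add_comm]

/-- The levels of the span of the `z ^ kᵢ • bᵢ`. -/
theorem level_eq_span (hz : IsUniformizer z) {M : Submodule (HolGerm x) V} {Y : Submodule ℂ V}
    {b : Module.Basis (Fin (Module.finrank (MerGerm x) V)) (MerGerm x) V}
    {e : Module.Basis (Fin (Module.finrank (MerGerm x) V)) ℂ Y} (hbe : ∀ i, b i = e i)
    {k : Fin (Module.finrank (MerGerm x) V) → ℤ}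
    (hM : M = Submodule.span (HolGerm x) (Set.range fun i => algebraMap (HolGerm x)
        (MerGerm x) z ^ k i • b i)) (m : ℤ) :
    level z Y M m = Submodule.span ℂ (e '' {i | k i ≤ m}) := by
  refine le_antisymm (fun y hy => ?_) (Submodule.span_le.2 ?_)
  · rw [mem_level, hM, mem_span_zpow_smul_iff hz] at hy
    rw [← e.sum_repr y]
    refine Submodule.sum_mem _ fun i _ => ?_
    by_cases hi : e.repr y i = 0
    · rw [hi, zero_smul]; exact Submodule.zero_mem _
    · refine Submodule.smul_mem _ _ (Submodule.subset_span ⟨i, ?_, rfl⟩)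
      have hyb : (y : V) = ∑ i, algebraMap ℂ (MerGerm x) (e.repr y i) • b i := by
        conv_lhs => rw [← e.sum_repr y]
        rw [Submodule.coe_sum]
        refine Finset.sum_congr rfl fun i _ => ?_
        rw [algebraMap_complex, hbe, Submodule.coe_smul]
      -- Elements of Y have constant coordinates, so a nonzero coordinate is a unit and cannot
      -- absorb a positive power of z.
      have hrepr : b.repr (y : V) i = algebraMap (HolGerm x) (MerGerm x)
          (algebraMap ℂ (HolGerm x) (e.repr y i)) := by
        rw [hyb, b.repr_sum_self, ← IsScalarTower.algebraMap_apply]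
      by_contra hlt
      obtain ⟨c, hc⟩ := hy i
      rw [map_smul, Finsupp.smul_apply, hrepr, smul_eq_mul] at hc
      have := evalGerm_eq_zero_of_zpow hz (not_le.1 hlt) hc
      rw [evalGerm_algebraMap] at this
      exact hi this
  · rintro _ ⟨i, hi, rfl⟩
    refine zpow_smul_mem_of_le hz (show k i ≤ m from hi) ?_
    rw [Submodule.subtype_apply, ← hbe, hM]
    exact Submodule.subset_span ⟨i, rfl⟩

variable {n : ℕ}

/-- The twist of a flag is spanned by the `z ^ kᵢ • bᵢ` for any adapted basis. -/
theorem twist_eq_span (hz : IsUniformizer z) {Y : Submodule ℂ V} [FiniteDimensional ℂ Y]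
    {F : LTSeries (Submodule ℂ Y)} {k : Fin n → ℤ} (hF : IsFlag F) (hk : IsAdmissible F k)
    (hn : n = Module.finrank ℂ Y) {e : Module.Basis (Fin n) ℂ Y}
    (he : ∀ j, F j = Submodule.span ℂ (e '' {i | (i : ℕ) < Module.finrank ℂ (F j)})) :
    twist z Y (F, k) = Submodule.span (HolGerm x) (Set.range fun i => algebraMap (HolGerm x)
        (MerGerm x) z ^ k i • (e i : V)) := by
  refine le_antisymm (Submodule.span_le.2 ?_) (Submodule.span_le.2 ?_)
  · rintro _ ⟨j, i, hi, v, hv, rfl⟩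
    change v ∈ F j.succ at hv
    change algebraMap (HolGerm x) (MerGerm x) z ^ k i • (v : V) ∈ _
    rw [he] at hv
    induction hv using Submodule.span_induction with
    | mem v hv =>
      obtain ⟨i', hi', rfl⟩ := hv
      obtain ⟨κ, hκ, hk⟩ := hk
      have hle : k i' ≤ k i := by
        rw [hk j i hi]
        exact (hF.lt_finrank_iff hn hκ hk i' j).1 hi'
      exact zpow_smul_mem_of_le hz hle (Submodule.subset_span ⟨i', rfl⟩)
    | zero => rw [Submodule.coe_zero, smul_zero]; exact Submodule.zero_mem _
    | add v w _ _ hv hw =>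
      rw [Submodule.coe_add, smul_add]; exact Submodule.add_mem _ hv hw
    | smul c v _ hv =>
      rw [Submodule.coe_smul, ← complex_smul_zpow_smul]
      exact (Submodule.restrictScalars ℂ (Submodule.span (HolGerm x) _)).smul_mem c hv
  · rintro _ ⟨i, rfl⟩
    obtain ⟨j, hj⟩ := hF.exists_mem_flagBlock hn i
    refine Submodule.subset_span ⟨j, i, hj, e i, ?_, rfl⟩
    change e i ∈ F j.succ
    rw [he]
    exact Submodule.subset_span ⟨i, hj.2, rfl⟩

end Twist

/-! ### Admissible pairs and stable lattices -/

section Correspondence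

variable {X : Type*} [TopologicalSpace X] [ChartedSpace ℂ X] {x : X} {z : HolGerm x}
  {V : Type*} [AddCommGroup V] [Module (MerGerm x) V] [Module (HolGerm x) V]
  [IsScalarTower (HolGerm x) (MerGerm x) V] [Module ℂ V] [IsScalarTower ℂ (MerGerm x) V]
  [IsScalarTower ℂ (HolGerm x) V]

section Admissible

variable {L : Submodule (HolGerm x) V} {Y : Submodule ℂ V} {F : LTSeries (Submodule ℂ Y)}
  {k : Fin (Module.finrank (MerGerm x) V) → ℤ}

/-- A basis adapted to F diagonalises the position of the twist in L. A level is spanned by the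
basis vectors with exponent at most m, which form an initial segment matching a member of F. -/
theorem IsForm.exists_adapted_basis (h : IsForm L Y) (hz : IsUniformizer z) (hF : IsFlag F)
    (hk : IsAdmissible F k) :
    ∃ b : Module.Basis (Fin (Module.finrank (MerGerm x) V)) (MerGerm x) V,
      L = Submodule.span (HolGerm x) (Set.range b) ∧ Y = Submodule.span ℂ (Set.range b) ∧
      twist z Y (F, k) = Submodule.span (HolGerm x) (Set.range fun i => algebraMap (HolGerm x)
          (MerGerm x) z ^ k i • b i) ∧
      ∀ m j, (∀ i, k i ≤ m ↔ (i : ℕ) < Module.finrank ℂ (F j)) →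
        level z Y (twist z Y (F, k)) m = F j := by
  have := h.finiteDimensional
  obtain ⟨e, he⟩ := hF.exists_basis h.finrank_eq
  obtain ⟨b, hbL, hbY, hb⟩ := h.exists_basis e
  have ht := twist_eq_span hz hF hk h.finrank_eq he
  simp only [← hb] at ht
  refine ⟨b, hbL, hbY, ht, fun m j hmj => ?_⟩
  rw [level_eq_span hz hb ht, he j]
  congr 2
  ext i
  exact hmj i

theorem IsForm.range_level_twist (h : IsForm L Y) (hz : IsUniformizer z) (hF : IsFlag F)
    (hk : IsAdmissible F k) : Set.range (level z Y (twist z Y (F, k))) = Set.range F := by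
  have := h.finiteDimensional
  obtain ⟨b, -, -, -, hlev⟩ := h.exists_adapted_basis hz hF hk
  apply Set.Subset.antisymm
  · rintro _ ⟨m, rfl⟩
    obtain ⟨j, hj⟩ := hF.exists_le_iff h.finrank_eq hk m
    exact ⟨j, (hlev m j hj).symm⟩
  · rintro _ ⟨j, rfl⟩
    obtain ⟨m, hm⟩ := hF.exists_le_iff' h.finrank_eq hk j
    exact ⟨m, hlev m j hm⟩

/-- The exponents are read off from the dimensions of the levels, hence from the lattice alone. -/
theorem IsForm.le_iff_lt_finrank_level (h : IsForm L Y) (hz : IsUniformizer z) (hF : IsFlag F)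
    (hk : IsAdmissible F k) (i : Fin (Module.finrank (MerGerm x) V)) (m : ℤ) :
    k i ≤ m ↔ (i : ℕ) < Module.finrank ℂ (level z Y (twist z Y (F, k)) m) := by
  have := h.finiteDimensional
  obtain ⟨b, -, -, -, hlev⟩ := h.exists_adapted_basis hz hF hk
  obtain ⟨j, hj⟩ := hF.exists_le_iff h.finrank_eq hk m
  rw [hlev m j hj, hj]

/-- An admissible pair is determined by its twist. -/
theorem IsForm.injOn_twist (h : IsForm L Y) (hz : IsUniformizer z) :
    Set.InjOn (twist z Y) (admissiblePairs Y (Module.finrank (MerGerm x) V)) := by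
  rintro ⟨F, k⟩ ⟨hF, hk⟩ ⟨F', k'⟩ ⟨hF', hk'⟩ heq
  refine Prod.ext (LTSeries_eq_of_range_eq ?_) (funext fun i => ?_)
  · rw [← h.range_level_twist hz hF hk, ← h.range_level_twist hz hF' hk', heq]
  · refine eq_of_forall_ge_iff fun m => ?_
    rw [h.le_iff_lt_finrank_level hz hF hk, h.le_iff_lt_finrank_level hz hF' hk', heq]

theorem IsForm.range_relativeFlag_twist (h : IsForm L Y) (hz : IsUniformizer z) (hF : IsFlag F)
    (hk : IsAdmissible F k) : Set.range (relativeFlag z L (twist z Y (F, k))) =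
      Set.range fun j => reduction L ((F j).map Y.subtype) := by
  obtain ⟨b, hbL, hbY, ht, -⟩ := h.exists_adapted_basis hz hF hk
  have h1 : relativeFlag z L (twist z Y (F, k)) =
      (fun U => reduction L (U.map Y.subtype)) ∘ level z Y (twist z Y (F, k)) :=
    funext fun m => relativeFlag_eq hz hbL hbY ht m
  rw [h1, Set.range_comp, h.range_level_twist hz hF hk, ← Set.range_comp]
  rfl

theorem IsForm.isSmithForm_twist (h : IsForm L Y) (hz : IsUniformizer z) (hF : IsFlag F)
    (hk : IsAdmissible F k) : IsSmithForm z L (twist z Y (F, k)) Y k := by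
  have := h.finiteDimensional
  obtain ⟨b, hbL, hbY, ht, -⟩ := h.exists_adapted_basis hz hF hk
  exact ⟨hF.monotone_of_isAdmissible h.finrank_eq hk, b, hbL, hbY, ht⟩

end Admissible

/-- A subspace of a stable form is stable if and only if its image in the fibre is stable under
the residue. -/
theorem IsForm.residue_stable_iff {nabla : Connection x V} {L : Submodule (HolGerm x) V}
    {Y : Submodule ℂ V} (h : IsForm L Y) (hz : IsUniformizer z) (hL : nabla.IsLogarithmic L)
    (hY : ∀ y ∈ Y, nabla.logOp z y ∈ Y) (U : Submodule ℂ Y) :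
    (∀ d ∈ reduction L (U.map Y.subtype), nabla.residue L hL d ∈ reduction L (U.map Y.subtype)) ↔
      ∀ y ∈ U.map Y.subtype, nabla.logOp z y ∈ U.map Y.subtype := by
  have hUY : U.map Y.subtype ≤ Y := Submodule.map_subtype_le Y U
  constructor
  · intro hst y hy
    have h1 := hst _ (mem_reduction.2 ⟨⟨y, h.mem (hUY hy)⟩, hy, rfl⟩)
    rw [nabla.residue_toFiber_logOp hz] at h1
    obtain ⟨w, hw, hwd⟩ := mem_reduction.1 h1
    rw [← sub_eq_zero, ← map_sub, toFiber_eq_zero_iff hz] at hwd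
    -- Both vectors lie in Y and have the same image in the fibre, and Y ∩ zL = 0.
    have h2 : (w : V) - nabla.logOp z y = 0 :=
      h.eq_zero hz (Y.sub_mem (hUY hw) (hY y (hUY hy))) hwd
    rwa [← sub_eq_zero.1 h2]
  · intro hst d hd
    obtain ⟨v, hv, rfl⟩ := mem_reduction.1 hd
    rw [nabla.residue_toFiber_logOp hz]
    exact mem_reduction.2 ⟨_, hst v hv, rfl⟩

/-- On generators D(zᵏy) = zᵏ(Dy + ky), and Dy + ky stays in the same member of the flag; the
Leibniz rule extends this to the 𝒪-span. -/
theorem twist_stable {nabla : Connection x V} (hz : IsUniformizer z) {Y : Submodule ℂ V} {n : ℕ}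
    {F : LTSeries (Submodule ℂ Y)} {k : Fin n → ℤ}
    (hst : ∀ j, ∀ y ∈ (F j).map Y.subtype, nabla.logOp z y ∈ (F j).map Y.subtype) :
    ∀ v ∈ twist z Y (F, k), nabla.logOp z v ∈ twist z Y (F, k) := by
  intro v hv
  rw [twist] at hv
  induction hv using Submodule.span_induction with
  | mem w hw =>
    obtain ⟨j, i, hi, y, hy, rfl⟩ := hw
    rw [nabla.logOp_zpow_smul hz]
    have h1 : nabla.logOp z y + ((k i : ℤ) : ℂ) • (y : V) ∈ (F j.succ).map Y.subtype :=
      Submodule.add_mem _ (hst _ _ ⟨y, hy, rfl⟩) (Submodule.smul_mem _ _ ⟨y, hy, rfl⟩)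
    obtain ⟨y', hy', h2⟩ := h1
    exact Submodule.subset_span ⟨j, i, hi, y', hy', by rw [← h2]; rfl⟩
  | zero => rw [map_zero]; exact Submodule.zero_mem _
  | add v w _ _ hv hw => rw [map_add]; exact Submodule.add_mem _ hv hw
  | smul a v hv' hv =>
    obtain ⟨b, hb⟩ := nabla.exists_logOp_smul (V := V) hz a
    rw [hb]
    exact Submodule.add_mem _ (Submodule.smul_mem _ _ hv') (Submodule.smul_mem _ _ hv)

/-- The element zᵐDy equals D(zᵐy) − m zᵐy, and both terms are in M. -/
theorem level_stable {nabla : Connection x V} (hz : IsUniformizer z) {Y : Submodule ℂ V}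
    (hY : ∀ y ∈ Y, nabla.logOp z y ∈ Y) {M : Submodule (HolGerm x) V}
    (hM : ∀ v ∈ M, nabla.logOp z v ∈ M) (m : ℤ) :
    ∀ y ∈ (level z Y M m).map Y.subtype, nabla.logOp z y ∈ (level z Y M m).map Y.subtype := by
  rintro _ ⟨y, hy, rfl⟩
  refine ⟨⟨nabla.logOp z y, hY _ y.2⟩, ?_, rfl⟩
  have hy' : algebraMap (HolGerm x) (MerGerm x) z ^ m • (y : V) ∈ M := hy
  have h1 := hM _ hy'
  rw [nabla.logOp_zpow_smul hz, smul_add, ← complex_smul_zpow_smul] at h1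
  have h2 := M.sub_mem h1 ((M.restrictScalars ℂ).smul_mem (m : ℂ) hy')
  rwa [add_sub_cancel_right] at h2

/-- If zᵐy lies in z⁻ⁿL, then y lies in z⁻ⁿ⁻ᵐL, which is inside zL as soon as −n − m ≥ 1; this
accounts for the −1 in the bound. -/
theorem IsForm.level_eq_bot {L M : Submodule (HolGerm x) V} {Y : Submodule ℂ V} (h : IsForm L Y)
    (hz : IsUniformizer z) {n : ℕ} (hn : M ≤ zShift z (-n) L) {m : ℤ} (hm : m ≤ -n - 1) :
    level z Y M m = ⊥ := by
  refine (Submodule.eq_bot_iff _).2 fun y hy => Subtype.ext ?_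
  refine h.eq_zero hz y.2 ?_
  obtain ⟨w, hw, h1⟩ := hn (mem_level.1 hy)
  have h2 : (y : V) = algebraMap (HolGerm x) (MerGerm x) z ^ (-n - m) • w := by
    rw [sub_eq_add_neg, zpow_add₀ hz.algebraMap_ne_zero, mul_comm, mul_smul, h1, smul_smul,
      ← zpow_add₀ hz.algebraMap_ne_zero, neg_add_cancel, zpow_zero, one_smul]
  rw [h2]
  exact zShift_le hz (by omega) L (zpow_smul_mem_zShift hw)

theorem IsForm.level_eq_top {L M : Submodule (HolGerm x) V} {Y : Submodule ℂ V} (h : IsForm L Y)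
    (hz : IsUniformizer z) {n : ℕ} (hn : zShift z n L ≤ M) {m : ℤ} (hm : n ≤ m) :
    level z Y M m = ⊤ :=
  Submodule.eq_top_iff'.2 fun y => hn (zShift_le hz hm L (zpow_smul_mem_zShift (h.mem y.2)))

/-- Every stable lattice is the twist of an admissible pair whose flag is made of levels. -/
theorem IsForm.exists_twist_eq {L M : Submodule (HolGerm x) V}
    {Y : Submodule ℂ V} (h : IsForm L Y) (hz : IsUniformizer z) (hlat : IsLattice M)
    (hM : M = Submodule.span (HolGerm x)
      {w | ∃ m : ℤ, ∃ y ∈ level z Y M m, w = algebraMap (HolGerm x) (MerGerm x) z ^ m • (y : V)}) :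
    ∃ p ∈ admissiblePairs Y (Module.finrank (MerGerm x) V), twist z Y p = M ∧
      ∀ j, p.1 j = ⊥ ∨ ∃ m, p.1 j = level z Y M m := by
  classical
  have := h.finiteDimensional
  obtain ⟨a, ha⟩ := h.isLattice.exists_le_zShift hlat hz
  obtain ⟨b, hb⟩ := h.isLattice.exists_zShift_le hlat hz
  obtain ⟨F, hF, κ, hκ, hFκ, hval⟩ := exists_flag_of_filtration (level_mono hz Y M)
    (fun m hm => h.level_eq_bot hz ha hm) (fun m hm => h.level_eq_top hz hb hm)
  -- The exponent of a block is the jump at that step. The blocks cover all indices, so the default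
  -- 0 is never taken.
  set k : Fin (Module.finrank (MerGerm x) V) → ℤ := fun i =>
    if hi : ∃ j, i ∈ flagBlock _ F j then κ hi.choose else 0 with hkdef
  have hk : ∀ j, ∀ i ∈ flagBlock _ F j, k i = κ j := by
    intro j i hi
    have hex : ∃ j, i ∈ flagBlock _ F j := ⟨j, hi⟩
    rw [hkdef]
    simp only [dif_pos hex]
    rw [flagBlock_unique hex.choose_spec hi]
  refine ⟨(F, k), ⟨hF, κ, hκ, hk⟩, le_antisymm (Submodule.span_le.2 ?_) ?_, fun j => ?_⟩
  · rintro _ ⟨j, i, hi, y, hy, rfl⟩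
    change y ∈ F j.succ at hy
    rw [hFκ] at hy
    change algebraMap (HolGerm x) (MerGerm x) z ^ k i • (y : V) ∈ M
    rw [hk j i hi]
    exact hy
  · conv_lhs => rw [hM]
    refine Submodule.span_le.2 ?_
    rintro _ ⟨m, y, hy, rfl⟩
    -- A generator at level m already belongs to the level of the last jump κⱼ ≤ m, so it is a
    -- nonnegative power of z times a generator of the twist.
    rcases hval m with hbot | ⟨j, hj, hlev⟩
    · rw [hbot, Submodule.mem_bot] at hy
      rw [hy, Submodule.coe_zero, smul_zero]
      exact Submodule.zero_mem _
    · obtain ⟨i, hi⟩ := flagBlock_nonempty (F := F) h.finrank_eq j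
      rw [hlev, ← hFκ] at hy
      refine zpow_smul_mem_of_le hz (k := k i) ((hk j i hi).trans_le hj) ?_
      exact Submodule.subset_span ⟨j, i, hi, y, hy, rfl⟩
  · refine Fin.cases (Or.inl hF.1) (fun j => Or.inr ⟨_, hFκ j⟩) j

end Correspondence

end LogLattice
end

/-! ### Logarithmic lattices and stable admissible pairs -/

theorem mainTheorem1 {X : Type*} [TopologicalSpace X] [ChartedSpace ℂ X] [IsManifold 𝓘(ℂ, ℂ) ω X]
    (x : X) {V : Type*} [AddCommGroup V] [Module (LogLattice.MerGerm x) V]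
    [FiniteDimensional (LogLattice.MerGerm x) V]
    [Module (LogLattice.HolGerm x) V]
    [IsScalarTower (LogLattice.HolGerm x) (LogLattice.MerGerm x) V]
    [Module ℂ V] [IsScalarTower ℂ (LogLattice.MerGerm x) V] [IsScalarTower ℂ (LogLattice.HolGerm x) V]
    (nabla : LogLattice.Connection x V)
    (σ : ℂ ⧸ AddSubgroup.zmultiples (1 : ℂ) → ℂ)
    (hσ : ∀ q, (QuotientAddGroup.mk (σ q) : ℂ ⧸ AddSubgroup.zmultiples (1 : ℂ)) = q)
    (Δ : Submodule (LogLattice.HolGerm x) V) (hΔ : nabla.IsDeligneLattice σ Δ)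
    (z : LogLattice.HolGerm x) (hz : LogLattice.IsUniformizer z)
    (Υ : Submodule ℂ V) (hΥ : Υ = nabla.birkhoffForm z Δ) :
    LogLattice.IsForm Δ Υ ∧
    Set.BijOn (LogLattice.twist z Υ) (nabla.stablePairs Δ hΔ.isLogarithmic Υ) nabla.logLattices ∧
    ∀ p ∈ nabla.stablePairs Δ hΔ.isLogarithmic Υ,
      Set.range (LogLattice.relativeFlag z Δ (LogLattice.twist z Υ p)) =
        Set.range (fun j => LogLattice.reduction Δ ((p.1 j).map Υ.subtype)) ∧
      LogLattice.IsSmithForm z Δ (LogLattice.twist z Υ p) Υ p.2 := by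
  have hpn := hΔ.isNonresonant hσ hz
  have hp := fun v hv => nabla.aeval_minpoly_residue_mem hz hΔ.isLogarithmic (v := v) hv
  have hL := (nabla.isLogarithmic_iff hz).1 hΔ.isLogarithmic
  obtain ⟨hform, hst⟩ := LogLattice.Connection.isForm_birkhoffForm hz hΔ.isLattice hL hpn hp
  rw [← hΥ] at hform hst
  refine ⟨hform, ⟨?_, ?_, ?_⟩, ?_⟩
  · rintro ⟨F, k⟩ ⟨⟨hF, hk⟩, hstable⟩
    obtain ⟨b, -, -, ht, -⟩ := hform.exists_adapted_basis hz hF hk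
    refine ⟨?_, (nabla.isLogarithmic_iff hz).2 (LogLattice.twist_stable hz fun j =>
      (hform.residue_stable_iff hz hΔ.isLogarithmic hst (F j)).1 (hstable j))⟩
    rw [ht]
    exact LogLattice.isLattice_span_zpow_smul hz b k
  · exact (hform.injOn_twist hz).mono fun p hp => hp.1
  · rintro M ⟨hlat, hlog⟩
    have hM := (nabla.isLogarithmic_iff hz).1 hlog
    obtain ⟨p, hadm, hpM, hlev⟩ := hform.exists_twist_eq hz hlat
      (hform.eq_span_level hz hpn (fun y hy => hform.aeval_eq_zero hz hst hp hy) hlat hM)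
    refine ⟨p, ⟨hadm, fun j => ?_⟩, hpM⟩
    refine (hform.residue_stable_iff hz hΔ.isLogarithmic hst (p.1 j)).2 ?_
    -- Each member of the flag is zero or a level of M, and levels of a D-stable lattice are
    -- D-stable.
    rcases hlev j with h | ⟨m, h⟩
    · rw [h]
      rintro y ⟨y', hy', rfl⟩
      rw [(Submodule.mem_bot ℂ).1 hy', map_zero, map_zero]
      exact Submodule.zero_mem _
    · rw [h]
      exact LogLattice.level_stable hz hst hM m
  · rintro ⟨F, k⟩ ⟨⟨hF, hk⟩, -⟩
    exact ⟨hform.range_relativeFlag_twist hz hF hk, hform.isSmithForm_twist hz hF hk⟩
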